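/- Let $n\ge 0$, let $w_0\in S_n$ be the longest permutation, let $x_1,\dots,x_n$, $y_1,\dots,y_n$, $q_1,\dots,q_{n-1}$ and $t=(t_w)_{w\in S_n}$ be variables, and put $A=\mathbb{Q}[[q_1,\dots,q_{n-1},\{t_w\}_{w\in S_n}]]$. For $k\le n$ let $\Delta_k(z\,|\,x_1,\dots,x_k)$ be the determinant of the $k\times k$ tridiagonal matrix with diagonal entries $x_1+z,\dots,x_k+z$, superdiagonal entries $q_1,\dots,q_{k-1}$ and subdiagonal entries $-1$. Let $\widetilde e_i$ be the coefficient of $z^{n-i}$ in $\Delta_n(z\,|\,x_1,\dots,x_n)$ and $\widetilde I_n=(\widetilde e_1,\dots,\widetilde e_n)$. The quantum Schubert polynomial of $w\in S_n$ is $$\widetilde{\mathfrak S}_w(x)=\partial^{(y)}_{ww_0}\Big(\prod_{i=1}^{n-1}\Delta_i(y_{n-i}\,|\,x_1,\dots,x_i)\Big)\Big|_{y=0},$$ where $\partial^{(y)}_{v}=\partial_{a_1}\cdots\partial_{a_p}$ for a reduced decomposition $v=s_{a_1}\cdots s_{a_p}$, with $\partial_a f=(f-s_af)/(y_a-y_{a+1})$.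 Every $f\in\mathbb{Q}[x_1,\dots,x_n][[q,t]]$ is congruent modulo the ideal generated by $\widetilde I_n$ to exactly one element $[f]$ of the $A$-span of the $\widetilde{\mathfrak S}_w$, $w\in S_n$. The Grothendieck residue $\langle\cdot\rangle_{\widetilde I_n}:A[x_1,\dots,x_n]\to A$ with respect to $(\widetilde e_1,\dots,\widetilde e_n)$ is well defined; it is the unique $A$-linear form that vanishes on $\widetilde I_n A[x]$ and that, applied in the variables $x$ to the Bezoutian $\det\big(a_{ij}(x,y)\big)$, gives $1$ modulo the ideal $(\widetilde e_1(y),\dots,\widetilde e_n(y))$, where $$(x_j-y_j)\,a_{ij}(x,y)=\widetilde e_i(x_1,\dots,x_j,y_{j+1},\dots,y_n)-\widetilde e_i(x_1,\dots,x_{j-1},y_j,\dots,y_n).$$ Put $$K(x,t)=\Big[\exp\Big(\sum_{w\in S_n}t_w\widetilde{\mathfrak S}_w(x)\Big)\Big],\qquad \mathcal F(t)=\langle K(x,t)\rangle_{\widetilde I_n}\in A,\qquad \widetilde{\mathfrak S}^t_w(x)=\big[K(x,t)\,\widetilde{\mathfrak S}_w(x)\big].$$ Then for all $u,w\in S_n$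 there are unique $\Lambda_{uw\tau}(t)\in A$, $\tau\in S_n$, such that $$\big[\widetilde{\mathfrak S}^t_u\,\widetilde{\mathfrak S}^t_w\big]=\sum_{\tau\in S_n}\Lambda_{uw\tau}(t)\,\widetilde{\mathfrak S}^t_{w_0\tau},$$ and they are $$\Lambda_{uw\tau}(t)=\frac{\partial}{\partial t_u}\frac{\partial}{\partial t_w}\frac{\partial}{\partial t_\tau}\mathcal F(t).$$ -/

import Mathlib

noncomputable section

namespace ToyGW

open MvPolynomial

/-! ### Exact division and divided differences -/

/-- Two algebra homomorphisms on a polynomial ring whose values on the variables agree modulo `d`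
agree modulo `d` everywhere. -/
theorem dvd_algHom_sub {R S σ : Type*} [CommRing R] [CommRing S] [Algebra R S]
    (φ ψ : MvPolynomial σ R →ₐ[R] S) (d : S) (h : ∀ i, d ∣ φ (X i) - ψ (X i))
    (f : MvPolynomial σ R) : d ∣ φ f - ψ f := by
  have key : (Ideal.Quotient.mkₐ R (Ideal.span {d})).comp φ =
      (Ideal.Quotient.mkₐ R (Ideal.span {d})).comp ψ := by
    apply MvPolynomial.algHom_ext
    intro i
    simp only [AlgHom.comp_apply, Ideal.Quotient.mkₐ_eq_mk]
    rw [Ideal.Quotient.eq, Ideal.mem_span_singleton]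
    exact h i
  have := DFunLike.congr_fun key f
  simp only [AlgHom.comp_apply, Ideal.Quotient.mkₐ_eq_mk] at this
  rwa [Ideal.Quotient.eq, Ideal.mem_span_singleton] at this

theorem dvd_sub_swap {R : Type*} [CommRing R] {n : ℕ} (a b : Fin n)
    (f : MvPolynomial (Fin n) R) :
    (X a - X b : MvPolynomial (Fin n) R) ∣ f - rename (Equiv.swap a b) f := by
  refine dvd_algHom_sub (AlgHom.id R _) (rename (Equiv.swap a b)) _ (fun i => ?_) f
  simp only [AlgHom.id_apply, rename_X]
  rcases eq_or_ne i a with rfl | ha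
  · simp
  rcases eq_or_ne i b with rfl | hb
  · rw [Equiv.swap_apply_right]
    exact ⟨-1, by ring⟩
  · simp [Equiv.swap_apply_of_ne_of_ne ha hb]

/-- The simple transposition `s_{i+1} = (i+1, i+2)` of `S_n`, in zero-based numbering `(i, i+1)`. -/
def simpleTransposition (n : ℕ) (i : Fin (n - 1)) : Equiv.Perm (Fin n) :=
  Equiv.swap ⟨i, by omega⟩ ⟨i + 1, by omega⟩

/-- The divided difference operator
`∂_i f = (f - s_i f) / (y_i - y_{i+1})` for the simple transposition `s_i`. -/
def simpleDividedDifference {R : Type*} [CommRing R] {n : ℕ} (i : Fin (n - 1))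
    (f : MvPolynomial (Fin n) R) : MvPolynomial (Fin n) R :=
  Classical.choose (dvd_sub_swap (⟨i, by omega⟩ : Fin n) ⟨i + 1, by omega⟩ f)

/-- `l` is a reduced word of `w`: `w = s_{l₁} ⋯ s_{l_p}` with `p` minimal. -/
def IsReducedWord {n : ℕ} (w : Equiv.Perm (Fin n)) (l : List (Fin (n - 1))) : Prop :=
  (l.map (simpleTransposition n)).prod = w ∧
    ∀ l' : List (Fin (n - 1)), (l'.map (simpleTransposition n)).prod = w → l.length ≤ l'.length

theorem exists_word {n : ℕ} (w : Equiv.Perm (Fin n)) :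
    ∃ l : List (Fin (n - 1)), (l.map (simpleTransposition n)).prod = w := by
  cases n with
  | zero => exact ⟨[], Subsingleton.elim _ _⟩
  | succ m =>
    have hw : w ∈ Submonoid.closure (Set.range fun i : Fin m => Equiv.swap i.castSucc i.succ) := by
      rw [Equiv.Perm.mclosure_swap_castSucc_succ]
      trivial
    induction hw using Submonoid.closure_induction with
    | mem x hx =>
      obtain ⟨i, rfl⟩ := hx
      exact ⟨[i], by simp [simpleTransposition, Fin.castSucc, Fin.succ]; rfl⟩
    | one => exact ⟨[], rfl⟩
    | mul x y _ _ hx hy =>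
      obtain ⟨l, rfl⟩ := hx
      obtain ⟨l', rfl⟩ := hy
      exact ⟨l ++ l', by simp⟩

theorem exists_reducedWord {n : ℕ} (w : Equiv.Perm (Fin n)) : ∃ l, IsReducedWord w l := by
  obtain ⟨l, hl, hmin⟩ := exists_minimal_of_wellFoundedLT
    (fun k : ℕ => ∃ l : List (Fin (n - 1)),
      l.length = k ∧ (l.map (simpleTransposition n)).prod = w)
    (by obtain ⟨l, hl⟩ := exists_word w; exact ⟨l.length, l, rfl, hl⟩)
  obtain ⟨l, rfl, hl⟩ := hl
  refine ⟨l, hl, fun l' hl' => ?_⟩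
  rcases le_total l.length l'.length with h | h
  · exact h
  · exact hmin ⟨l', rfl, hl'⟩ h

/-- The divided difference operator `∂_w = ∂_{a₁} ∘ ⋯ ∘ ∂_{a_p}`, where `w = s_{a₁} ⋯ s_{a_p}` is a
reduced decomposition (the operator does not depend on the decomposition). -/
def dividedDifference {R : Type*} [CommRing R] {n : ℕ} (w : Equiv.Perm (Fin n))
    (f : MvPolynomial (Fin n) R) : MvPolynomial (Fin n) R :=
  (Classical.choose (exists_reducedWord w)).foldr simpleDividedDifference f

/-! ### Quantum elementary symmetric polynomials and quantum Schubert polynomials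

`R` is a ring of coefficients and `q : Fin (n - 1) → R` gives the `n - 1` quantum parameters. -/

/-- The Givental--Kim determinant `Δ_k(t | x_1, …, x_k)`: the tridiagonal determinant with
diagonal `x_1 + t, …, x_k + t`, superdiagonal `q_1, …, q_{k-1}` and subdiagonal `-1, …, -1`
(variables are numbered from `0` here). -/
def quantumDelta {S : Type*} [CommRing S] (x q : ℕ → S) (k : ℕ) (t : S) : S :=
  Matrix.det (Matrix.of fun i j : Fin k =>
    if i = j then x i + t
    else if (j : ℕ) = i + 1 then q i
    else if (i : ℕ) = j + 1 then -1
    else 0)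

/-- A finite family extended by zero. -/
def extend {S : Type*} [Zero S] {m : ℕ} (v : Fin m → S) (i : ℕ) : S :=
  if h : i < m then v ⟨i, h⟩ else 0

/-- The quantum elementary symmetric polynomial `ẽ_{i+1} = e_{i+1}(x_1, …, x_n | q)`: the
coefficient of `t ^ (n - (i + 1))` in `Δ_n(t | x_1, …, x_n)`. -/
def quantumElementary {R : Type*} [CommRing R] {n : ℕ} (q : Fin (n - 1) → R) (i : Fin n) :
    MvPolynomial (Fin n) R :=
  (quantumDelta (S := Polynomial (MvPolynomial (Fin n) R))
    (extend fun j => Polynomial.C (X j)) (extend fun j => Polynomial.C (C (q j)))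
    n Polynomial.X).coeff (n - (i + 1))

/-- The ideal `Ĩ_n` generated by the quantum elementary symmetric polynomials. -/
def quantumIdeal {R : Type*} [CommRing R] {n : ℕ} (q : Fin (n - 1) → R) :
    Ideal (MvPolynomial (Fin n) R) :=
  Ideal.span (Set.range (quantumElementary q))

/-- The top quantum double Schubert polynomial
`∏_{i=1}^{n-1} Δ_i(y_{n-i} | x_1, …, x_i)`, as a polynomial in `y` over the polynomials in `x`. -/
def quantumDoubleTop {R : Type*} [CommRing R] {n : ℕ} (q : Fin (n - 1) → R) :
    MvPolynomial (Fin n) (MvPolynomial (Fin n) R) :=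
  ∏ i : Fin (n - 1),
    quantumDelta (extend fun j => C (X j)) (extend fun j => C (C (q j)))
      (i + 1) (X ⟨n - 1 - (i + 1), by omega⟩)

/-- The quantum double Schubert polynomial `∂_{w w₀}^{(y)}` of the top one. -/
def quantumDoubleSchubert {R : Type*} [CommRing R] {n : ℕ} (q : Fin (n - 1) → R)
    (w : Equiv.Perm (Fin n)) : MvPolynomial (Fin n) (MvPolynomial (Fin n) R) :=
  dividedDifference (w * Fin.revPerm) (quantumDoubleTop q)

/-- The quantum Schubert polynomial: the value at `y = 0` of the double one. -/
def quantumSchubert {R : Type*} [CommRing R] {n : ℕ} (q : Fin (n - 1) → R)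
    (w : Equiv.Perm (Fin n)) : MvPolynomial (Fin n) R :=
  constantCoeff (quantumDoubleSchubert q w)

/-! ### The Grothendieck residue

For `g_1, …, g_n ∈ R[x_1, …, x_n]` such that `R[x]/(g)` is a free module of finite rank, the
Grothendieck residue `f ↦ Res (f dx_1 ∧ ⋯ ∧ dx_n / (g_1, …, g_n))` is the unique `R`-linear form
that vanishes on the ideal `(g)` and sends the Bezoutian `Δ(x, y)`, as a function of `x`, to `1`
modulo `(g(y))` (Scheja and Storch). -/

/-- The substitution `x_1, …, x_n ↦ x_1, …, x_k, y_{k+1}, …, y_n` into `R[x][y]`. -/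
def mixedEval (R : Type*) [CommRing R] (n k : ℕ) :
    MvPolynomial (Fin n) R →ₐ[R] MvPolynomial (Fin n) (MvPolynomial (Fin n) R) :=
  aeval fun i => if (i : ℕ) < k then C (X i) else X i

theorem dvd_mixedEval_sub {R : Type*} [CommRing R] {n : ℕ} (j : Fin n)
    (f : MvPolynomial (Fin n) R) :
    (C (X j) - X j : MvPolynomial (Fin n) (MvPolynomial (Fin n) R)) ∣
      mixedEval R n (j + 1) f - mixedEval R n j f := by
  refine dvd_algHom_sub _ _ _ (fun i => ?_) f
  simp only [mixedEval, aeval_X]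
  rcases lt_trichotomy (i : ℕ) j with h | h | h
  · simp [h, Nat.lt_succ_of_lt h]
  · obtain rfl : i = j := Fin.ext h
    simp
  · have h1 : ¬ (i : ℕ) < j + 1 := by omega
    have h2 : ¬ (i : ℕ) < j := by omega
    simp [h1, h2]

/-- The Bezoutian `det (a_{ij}(x, y))`, where
`(x_j - y_j) a_{ij} = g_i(x_1, …, x_j, y_{j+1}, …, y_n) - g_i(x_1, …, x_{j-1}, y_j, …, y_n)`,
so that `g_i(x) - g_i(y) = ∑_j a_{ij} (x_j - y_j)`. -/
def bezoutian {R : Type*} [CommRing R] {n : ℕ} (g : Fin n → MvPolynomial (Fin n) R) :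
    MvPolynomial (Fin n) (MvPolynomial (Fin n) R) :=
  Matrix.det (Matrix.of fun i j : Fin n => Classical.choose (dvd_mixedEval_sub j (g i)))

/-- `η` is the Grothendieck residue form of `g_1, …, g_n`. -/
def IsGrothendieckResidue {R : Type*} [CommRing R] {n : ℕ} (g : Fin n → MvPolynomial (Fin n) R)
    (η : MvPolynomial (Fin n) R →ₗ[R] R) : Prop :=
  (∀ f ∈ Ideal.span (Set.range g), η f = 0) ∧
    (∑ m ∈ (bezoutian g).support, monomial m (η ((bezoutian g).coeff m))) - 1
      ∈ Ideal.span (Set.range g)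

/-- The Grothendieck residue form of `g_1, …, g_n`. -/
def grothendieckResidue {R : Type*} [CommRing R] {n : ℕ} (g : Fin n → MvPolynomial (Fin n) R) :
    MvPolynomial (Fin n) R →ₗ[R] R :=
  Classical.epsilon (IsGrothendieckResidue g)

/-! ### The kernel, the potential, and the `t`-deformation -/

/-- The indices of the parameters `q_1, …, q_{n-1}` and `t_w`, `w ∈ S_n`. -/
abbrev Param (n : ℕ) : Type := Fin (n - 1) ⊕ Equiv.Perm (Fin n)

/-- `ℚ[[q_1, …, q_{n-1}, {t_w}]]`. -/
abbrev Coef (n : ℕ) : Type := MvPowerSeries (Param n) ℚ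

/-- `ℚ[[q, t]][x_1, …, x_n]`. -/
abbrev Poly (n : ℕ) : Type := MvPolynomial (Fin n) (Coef n)

/-- `ℚ[x_1, …, x_n][[q, t]]`. -/
abbrev Series (n : ℕ) : Type := MvPowerSeries (Param n) (MvPolynomial (Fin n) ℚ)

/-- The parameter `q_i` in `ℚ[[q, t]]`. -/
def qVar (n : ℕ) (i : Fin (n - 1)) : Coef n := MvPowerSeries.X (Sum.inl i)

/-- The quantum Schubert polynomial of `w`, with coefficients in `ℚ[[q, t]]`. -/
def schubert {n : ℕ} (w : Equiv.Perm (Fin n)) : Poly n := quantumSchubert (qVar n) w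

/-- The inclusion `ℚ[[q, t]][x] ⊆ ℚ[x][[q, t]]`. -/
def toSeries (n : ℕ) : Poly n →+* Series n :=
  eval₂Hom (MvPowerSeries.map (C : ℚ →+* MvPolynomial (Fin n) ℚ))
    fun i => MvPowerSeries.C (X i)

/-- `g` is the projection `[f]` of `f ∈ ℚ[x][[q, t]]`: `g` is a `ℚ[[q, t]]`-linear combination of
quantum Schubert polynomials, congruent to `f` modulo `Ĩ_n`. -/
def IsProjection {n : ℕ} (f : Series n) (g : Poly n) : Prop :=
  g ∈ Submodule.span (Coef n) (Set.range (schubert (n := n))) ∧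
    f - toSeries n g ∈ (quantumIdeal (qVar n)).map (toSeries n)

/-- The projection `[f]`. -/
def proj {n : ℕ} (f : Series n) : Poly n := Classical.epsilon (IsProjection f)

/-- `exp (∑_w t_w S̃_w(x)) ∈ ℚ[x][[q, t]]`. -/
def expSeries (n : ℕ) : Series n :=
  (PowerSeries.exp ℚ).subst
    (∑ w : Equiv.Perm (Fin n), MvPowerSeries.X (Sum.inr w) * toSeries n (schubert w))

/-- The kernel `K(x, t) = [exp (∑_w t_w S̃_w(x))]`. -/
def kernel (n : ℕ) : Poly n := proj (expSeries n)

/-- The potential `F(t)`: the Grothendieck residue of the kernel with respect to the generators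
`ẽ_1, …, ẽ_n` of `Ĩ_n`. -/
def potential (n : ℕ) : Coef n :=
  grothendieckResidue (quantumElementary (qVar n)) (kernel n)

/-- The `t`-deformation `S̃_w^t(x) = [K(x, t) S̃_w(x)]`. -/
def schubertT {n : ℕ} (w : Equiv.Perm (Fin n)) : Poly n :=
  proj (toSeries n (kernel n * schubert w))

/-- The partial derivative `∂/∂t_w` on `ℚ[[q, t]]`. -/
def dt {n : ℕ} (w : Equiv.Perm (Fin n)) (f : Coef n) : Coef n :=
  MvPowerSeries.pderiv ℚ (Sum.inr w) f

end ToyGW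

end

noncomputable section

namespace ToyGW

open MvPolynomial

/-! ### Divided differences -/

/-! Write `A` for `Coef n`, `I` for the quantum ideal, `S_w` for the quantum Schubert polynomials,
`E = exp(∑ t_w S_w)` and `⟨·⟩` for the residue.

The theorem follows from two facts. (a) The residue pairing is perfect, with `⟨S_v S_{w₀u}⟩ =
δ_{vu}`. Hence modulo `I` every `f` is `∑_u ⟨f S_{w₀u}⟩ S_u`, which gives existence and uniqueness
of `[f]`. (b) `⟨·⟩` commutes with `∂/∂t`, because the `ẽ_i` and the `S_w` do not involve `t`. Since
`∂E/∂t_u = E S_u`, the third derivative of the potential is `⟨E S_u S_w S_τ⟩`, which is the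
coefficient of `S_{w₀τ}` in `E S_u S_w`. Multiplying this expansion by `E`, and using that `S^t_w ≡
E S_w` modulo `I`, gives the product formula. The coefficients are unique because `E` is a unit.
This last part is `proj_schubertT_mul_eq_iff`.

The work lies in (a). Products of monomials in the `ẽ_i` with classical Schubert polynomials form a
basis of the polynomial ring: this is the classical freeness over symmetric polynomials, carried
over by comparing top degree forms (`schubertMonomialBasis`). So the quotient by `I` is free of rank
`n!`, and `residueForm` is the coordinate of the staircase monomial.

The Bezoutian can be computed. The determinant `Δ_n` is affine in each diagonal entry, so the
entries of the Bezoutian are coefficients of (leading minor in `x`) times (trailing minor in `y`). A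
determinant of coefficients of one-variable polynomials is a value of `∂_{w₀}` in auxiliary
variables `z` (`topCoeff_prod_aeval`). Newton interpolation in `z` expands the product of leading
minors with coefficients `S_u(x)`. The product of trailing minors agrees, up to a scalar and modulo
the ideals, with the product of leading minors, because `Δ_{n-1} · tail_r ≡ ± (∏ q) Δ_{n-1-r}`
modulo `Δ_n`. The outcome is `Bez(x, y) ≡ ∑_u S_u(x) S_{w₀u}(y)` modulo `I(y)`
(`bezoutian_sub_sum_mem`).

A degree count gives `⟨S_u⟩ = δ_{u,w₀}`, so `residueForm` sends the Bezoutian to `S_1 = 1`.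
Multiplication by `f(x)` and by `f(y)` agree on the Bezoutian modulo the two ideals, so `f ≡ ∑_u ⟨f
S_u⟩ S_{w₀u}`. This yields the duality and the uniqueness of the residue. -/

/-- The index moved by the simple transposition `s_i`, lower end. -/
abbrev lo {n : ℕ} (i : Fin (n - 1)) : Fin n := ⟨i, by omega⟩

/-- The index moved by the simple transposition `s_i`, upper end. -/
abbrev hi {n : ℕ} (i : Fin (n - 1)) : Fin n := ⟨i + 1, by omega⟩

theorem lo_lt_hi {n : ℕ} (i : Fin (n - 1)) : lo i < hi i := by
  simp [Fin.lt_def]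

theorem simpleTransposition_eq {n : ℕ} (i : Fin (n - 1)) :
    simpleTransposition n i = Equiv.swap (lo i) (hi i) := rfl

@[simp] theorem simpleTransposition_lo {n : ℕ} (i : Fin (n - 1)) :
    simpleTransposition n i (lo i) = hi i := Equiv.swap_apply_left _ _

@[simp] theorem simpleTransposition_hi {n : ℕ} (i : Fin (n - 1)) :
    simpleTransposition n i (hi i) = lo i := Equiv.swap_apply_right _ _

theorem simpleTransposition_of_ne {n : ℕ} (i : Fin (n - 1)) {a : Fin n} (h1 : a ≠ lo i)
    (h2 : a ≠ hi i) : simpleTransposition n i a = a := Equiv.swap_apply_of_ne_of_ne h1 h2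

@[simp] theorem simpleTransposition_mul_self {n : ℕ} (i : Fin (n - 1)) :
    simpleTransposition n i * simpleTransposition n i = 1 := Equiv.swap_mul_self _ _

@[simp] theorem simpleTransposition_inv {n : ℕ} (i : Fin (n - 1)) :
    (simpleTransposition n i)⁻¹ = simpleTransposition n i := Equiv.swap_inv _ _

@[simp] theorem simpleTransposition_mul_cancel {n : ℕ} (i : Fin (n - 1))
    (w : Equiv.Perm (Fin n)) : simpleTransposition n i * (simpleTransposition n i * w) = w := by
  rw [← mul_assoc, simpleTransposition_mul_self, one_mul]

theorem simpleTransposition_comm {n : ℕ} {i j : Fin (n - 1)} (h : (i : ℕ) + 1 < j) :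
    simpleTransposition n i * simpleTransposition n j
      = simpleTransposition n j * simpleTransposition n i := by
  refine (Equiv.Perm.Disjoint.commute ?_).eq
  rw [simpleTransposition_eq, simpleTransposition_eq, Equiv.Perm.disjoint_iff_disjoint_support,
    Equiv.Perm.support_swap (lo_lt_hi i).ne, Equiv.Perm.support_swap (lo_lt_hi j).ne]
  simp [Fin.ext_iff]
  omega

theorem simpleTransposition_braid {n : ℕ} {i j : Fin (n - 1)} (h : (j : ℕ) = i + 1) :
    simpleTransposition n i * simpleTransposition n j * simpleTransposition n i
      = simpleTransposition n j * simpleTransposition n i * simpleTransposition n j := by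
  have h1 : hi i = lo j := by simp [Fin.ext_iff, h]
  have h2 : lo i ≠ lo j := by simp [Fin.ext_iff, h]
  have h3 : lo i ≠ hi j := by simp [Fin.ext_iff, h]; omega
  have h4 : lo j ≠ hi j := (lo_lt_hi j).ne
  rw [simpleTransposition_eq, simpleTransposition_eq, h1]
  have e1 := Equiv.swap_mul_swap_mul_swap h4.symm h3.symm
  have e2 := Equiv.swap_mul_swap_mul_swap h2 h3
  rw [Equiv.swap_comm (lo j) (lo i), Equiv.swap_comm (hi j) (lo j)] at e1
  rw [e1, e2, Equiv.swap_comm]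

section Domain

variable {R : Type*} [CommRing R] {n : ℕ}

/-- The action of a permutation on polynomials by permuting the variables. -/
abbrev act (w : Equiv.Perm (Fin n)) : MvPolynomial (Fin n) R →ₐ[R] MvPolynomial (Fin n) R :=
  rename w

theorem act_mul (v w : Equiv.Perm (Fin n)) (f : MvPolynomial (Fin n) R) :
    act (v * w) f = act v (act w f) := by
  simp [act, rename_rename, Equiv.Perm.coe_mul]

@[simp] theorem act_one (f : MvPolynomial (Fin n) R) : act 1 f = f := by
  simp [act]

@[simp] theorem act_simple_act_simple (i : Fin (n - 1)) (f : MvPolynomial (Fin n) R) :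
    act (simpleTransposition n i) (act (simpleTransposition n i) f) = f := by
  rw [← act_mul, simpleTransposition_mul_self, act_one]

theorem mul_simpleDividedDifference (i : Fin (n - 1)) (f : MvPolynomial (Fin n) R) :
    (X (lo i) - X (hi i)) * simpleDividedDifference i f
      = f - act (simpleTransposition n i) f :=
  (Classical.choose_spec (dvd_sub_swap (lo i) (hi i) f)).symm

theorem act_eq_of_simpleDividedDifference_eq_zero {i : Fin (n - 1)} {f : MvPolynomial (Fin n) R}
    (h : simpleDividedDifference i f = 0) : act (simpleTransposition n i) f = f := by
  have := mul_simpleDividedDifference i f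
  rw [h, mul_zero] at this
  exact (sub_eq_zero.mp this.symm).symm

/-! ### Divided differences over an integral domain. -/

variable [IsDomain R]

theorem X_sub_X_ne_zero {a b : Fin n} (h : a ≠ b) :
    (X a - X b : MvPolynomial (Fin n) R) ≠ 0 := by
  intro h'
  exact h (X_injective (sub_eq_zero.mp h'))

/-- The quotient is given by `Classical.choose`. Over a domain it is unique, so identities between
divided differences are proved by clearing denominators. -/
theorem simpleDividedDifference_eq_of_mul {i : Fin (n - 1)} {f g : MvPolynomial (Fin n) R}
    (h : (X (lo i) - X (hi i)) * g = f - act (simpleTransposition n i) f) :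
    simpleDividedDifference i f = g :=
  mul_left_cancel₀ (X_sub_X_ne_zero (lo_lt_hi i).ne)
    ((mul_simpleDividedDifference i f).trans h.symm)

theorem simpleDividedDifference_add (i : Fin (n - 1)) (f g : MvPolynomial (Fin n) R) :
    simpleDividedDifference i (f + g)
      = simpleDividedDifference i f + simpleDividedDifference i g := by
  apply simpleDividedDifference_eq_of_mul
  rw [mul_add, mul_simpleDividedDifference, mul_simpleDividedDifference, map_add]
  ring

theorem simpleDividedDifference_eq_zero {i : Fin (n - 1)} {f : MvPolynomial (Fin n) R}
    (h : act (simpleTransposition n i) f = f) : simpleDividedDifference i f = 0 := by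
  apply simpleDividedDifference_eq_of_mul
  rw [h]; ring

@[simp] theorem simpleDividedDifference_zero (i : Fin (n - 1)) :
    simpleDividedDifference i (0 : MvPolynomial (Fin n) R) = 0 :=
  simpleDividedDifference_eq_zero (map_zero _)

theorem simpleDividedDifference_mul_of_act_eq {i : Fin (n - 1)} {g : MvPolynomial (Fin n) R}
    (h : act (simpleTransposition n i) g = g) (f : MvPolynomial (Fin n) R) :
    simpleDividedDifference i (g * f) = g * simpleDividedDifference i f := by
  apply simpleDividedDifference_eq_of_mul
  rw [map_mul, h, mul_left_comm, mul_simpleDividedDifference]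
  ring

theorem act_simpleDividedDifference (i : Fin (n - 1)) (f : MvPolynomial (Fin n) R) :
    act (simpleTransposition n i) (simpleDividedDifference i f) = simpleDividedDifference i f := by
  symm
  apply simpleDividedDifference_eq_of_mul
  have h := congrArg (act (simpleTransposition n i)) (mul_simpleDividedDifference i f)
  rw [map_mul, map_sub, map_sub, act_simple_act_simple, rename_X, rename_X,
    simpleTransposition_lo, simpleTransposition_hi] at h
  linear_combination -h

@[simp] theorem simpleDividedDifference_self (i : Fin (n - 1)) (f : MvPolynomial (Fin n) R) :
    simpleDividedDifference i (simpleDividedDifference i f) = 0 :=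
  simpleDividedDifference_eq_zero (act_simpleDividedDifference i f)

theorem simpleDividedDifference_act (i : Fin (n - 1)) (f : MvPolynomial (Fin n) R) :
    simpleDividedDifference i (act (simpleTransposition n i) f)
      = - simpleDividedDifference i f := by
  apply simpleDividedDifference_eq_of_mul
  rw [act_simple_act_simple, mul_neg, mul_simpleDividedDifference]
  ring

/-- Shows that `∂_i` is self-adjoint for every form that vanishes on the image of `∂_i`. -/
theorem simpleDividedDifference_mul_sub (i : Fin (n - 1)) (f g : MvPolynomial (Fin n) R) :
    simpleDividedDifference i f * g - f * simpleDividedDifference i g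
      = simpleDividedDifference i (f * act (simpleTransposition n i) g) := by
  symm
  apply simpleDividedDifference_eq_of_mul
  have hf := mul_simpleDividedDifference i f
  have hg := mul_simpleDividedDifference i g
  rw [map_mul, act_simple_act_simple]
  linear_combination g * hf - f * hg

theorem simpleDividedDifference_X_mul {i : Fin (n - 1)} {g : MvPolynomial (Fin n) R}
    (h : act (simpleTransposition n i) g = g) :
    simpleDividedDifference i (X (lo i) * g) = g := by
  apply simpleDividedDifference_eq_of_mul
  rw [map_mul, h, rename_X, simpleTransposition_lo]
  ring

theorem simpleDividedDifference_comm {i j : Fin (n - 1)} (h : (i : ℕ) + 1 < j)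
    (f : MvPolynomial (Fin n) R) :
    simpleDividedDifference i (simpleDividedDifference j f)
      = simpleDividedDifference j (simpleDividedDifference i f) := by
  have hne : ∀ {a b : Fin n}, (a : ℕ) ≠ b → a ≠ b := fun h h' => h (congrArg _ h')
  apply simpleDividedDifference_eq_of_mul
  apply mul_left_cancel₀ (X_sub_X_ne_zero (R := R) (lo_lt_hi j).ne)
  have e1 := mul_simpleDividedDifference j (simpleDividedDifference i f)
  have e2 := mul_simpleDividedDifference i f
  have e3 := congrArg (act (simpleTransposition n j)) e2
  have e4 := mul_simpleDividedDifference j f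
  have e5 := congrArg (act (simpleTransposition n i)) e4
  rw [map_mul, map_sub, map_sub, rename_X, rename_X, ← act_mul,
    simpleTransposition_of_ne j (hne (by simp; omega)) (hne (by simp; omega)),
    simpleTransposition_of_ne j (hne (by simp; omega)) (hne (by simp; omega))] at e3
  rw [map_mul, map_sub, map_sub, rename_X, rename_X, ← act_mul, simpleTransposition_comm h,
    simpleTransposition_of_ne i (hne (by simp; omega)) (hne (by simp; omega)),
    simpleTransposition_of_ne i (hne (by simp; omega)) (hne (by simp; omega))] at e5
  linear_combination (X (lo i) - X (hi i)) * e1 + e2 - e3 - e4 + e5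

/-- The denominators are the three positive roots `α`, `β`, `α + β` of the copy of `S_3` generated
by `s_i` and `s_j`; clearing them leaves the alternating sum over this group. Both orders of `i` and
`j` are allowed, so that the braid relation follows by comparing the formula with its mirror image.
-/
theorem mul_braid (i j : Fin (n - 1)) (h : (j : ℕ) = i + 1 ∨ (i : ℕ) = j + 1)
    (f : MvPolynomial (Fin n) R) :
    (X (lo i) - X (hi i)) * (X (lo j) - X (hi j)) *
      (X (lo i) - X (hi i) + (X (lo j) - X (hi j))) *
      simpleDividedDifference i (simpleDividedDifference j (simpleDividedDifference i f))
      = f - act (simpleTransposition n i) f - act (simpleTransposition n j) f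
        + act (simpleTransposition n j * simpleTransposition n i) f
        + act (simpleTransposition n i * simpleTransposition n j) f
        - act (simpleTransposition n i * simpleTransposition n j * simpleTransposition n i) f := by
  have hne : ∀ {a b : Fin n}, (a : ℕ) ≠ b → a ≠ b := fun h h' => h (congrArg _ h')
  have hs : act (simpleTransposition n i) (X (lo j) - X (hi j) : MvPolynomial (Fin n) R)
      = X (lo i) - X (hi i) + (X (lo j) - X (hi j)) := by
    rw [map_sub, rename_X, rename_X]
    rcases h with h | h
    · have h1 : lo j = hi i := by simp [Fin.ext_iff, h]
      rw [h1, simpleTransposition_hi,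
        simpleTransposition_of_ne i (hne (by simp; omega)) (hne (by simp; omega))]
      ring
    · have h1 : hi j = lo i := by simp [Fin.ext_iff, h]
      rw [h1, simpleTransposition_lo,
        simpleTransposition_of_ne i (hne (by simp; omega)) (hne (by simp; omega))]
      ring
  have hr : act (simpleTransposition n j) (X (lo i) - X (hi i) : MvPolynomial (Fin n) R)
      = X (lo i) - X (hi i) + (X (lo j) - X (hi j)) := by
    rw [map_sub, rename_X, rename_X]
    rcases h with h | h
    · have h1 : hi i = lo j := by simp [Fin.ext_iff, h]
      rw [h1, simpleTransposition_lo,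
        simpleTransposition_of_ne j (hne (by simp; omega)) (hne (by simp; omega))]
      ring
    · have h1 : lo i = hi j := by simp [Fin.ext_iff, h]
      rw [h1, simpleTransposition_hi,
        simpleTransposition_of_ne j (hne (by simp; omega)) (hne (by simp; omega))]
      ring
  have hs2 : act (simpleTransposition n i)
      (X (lo i) - X (hi i) + (X (lo j) - X (hi j)) : MvPolynomial (Fin n) R)
      = X (lo j) - X (hi j) := by
    rw [← hs, act_simple_act_simple]
  set α : MvPolynomial (Fin n) R := X (lo i) - X (hi i)
  set β : MvPolynomial (Fin n) R := X (lo j) - X (hi j)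
  set g := simpleDividedDifference i f with hg
  set h' := simpleDividedDifference j g with hh
  have e1 : α * g = f - act (simpleTransposition n i) f := mul_simpleDividedDifference i f
  have e2 : β * h' = g - act (simpleTransposition n j) g := mul_simpleDividedDifference j g
  have e3 := mul_simpleDividedDifference i h'
  have e4 := congrArg (act (simpleTransposition n i)) e2
  have e5 := congrArg (act (simpleTransposition n j)) e1
  have e6 := congrArg (act (simpleTransposition n i)) e5
  have e0 : act (simpleTransposition n i) g = g := act_simpleDividedDifference i f
  rw [map_mul, hr, map_sub] at e5
  rw [map_mul, map_mul, hr, hs2, map_sub, map_sub] at e6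
  rw [map_mul, hs, map_sub, e0] at e4
  rw [mul_assoc, act_mul, act_mul, act_mul, act_mul]
  change α * simpleDividedDifference i h' = _ at e3
  linear_combination β * (α + β) * e3 + (α + β) * e2 - β * e4 + e1 - e5 + e6

theorem simpleDividedDifference_braid {i j : Fin (n - 1)} (h : (j : ℕ) = i + 1)
    (f : MvPolynomial (Fin n) R) :
    simpleDividedDifference i (simpleDividedDifference j (simpleDividedDifference i f))
      = simpleDividedDifference j
        (simpleDividedDifference i (simpleDividedDifference j f)) := by
  have h1 := mul_braid i j (Or.inl h) f
  have h2 := mul_braid j i (Or.inr h) f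
  have h0 : (X (lo i) - X (hi i)) * (X (lo j) - X (hi j)) *
      (X (lo i) - X (hi i) + (X (lo j) - X (hi j)) : MvPolynomial (Fin n) R) ≠ 0 := by
    refine mul_ne_zero (mul_ne_zero (X_sub_X_ne_zero (lo_lt_hi i).ne)
      (X_sub_X_ne_zero (lo_lt_hi j).ne)) ?_
    have h1 : hi i = lo j := by simp [Fin.ext_iff, h]
    rw [h1, sub_add_sub_cancel]
    exact X_sub_X_ne_zero (Fin.ne_of_lt (by simp [Fin.lt_def]; omega))
  apply mul_left_cancel₀ h0
  rw [simpleTransposition_braid h] at h1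
  linear_combination h1 - h2

end Domain

theorem map_simpleDividedDifference {R R' : Type*} [CommRing R] {n : ℕ} [CommRing R']
    [IsDomain R'] (κ : R →+* R')
    (i : Fin (n - 1)) (f : MvPolynomial (Fin n) R) :
    map κ (simpleDividedDifference i f) = simpleDividedDifference i (map κ f) := by
  symm
  apply simpleDividedDifference_eq_of_mul
  have := congrArg (map κ) (mul_simpleDividedDifference i f)
  simpa [map_rename] using this

end ToyGW

end

noncomputable section

namespace ToyGW

open MvPolynomial

/-! ### Inversions of permutations -/

/-- The set of inversions of a permutation. -/
def inversions {n : ℕ} (w : Equiv.Perm (Fin n)) : Finset (Fin n × Fin n) :=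
  Finset.univ.filter fun p => p.1 < p.2 ∧ w p.2 < w p.1

/-- The number of inversions of a permutation. -/
def inversionNumber {n : ℕ} (w : Equiv.Perm (Fin n)) : ℕ := (inversions w).card

theorem mem_inversions {n : ℕ} {w : Equiv.Perm (Fin n)} {p : Fin n × Fin n} :
    p ∈ inversions w ↔ p.1 < p.2 ∧ w p.2 < w p.1 := by
  simp [inversions]

@[simp] theorem inversionNumber_one {n : ℕ} :
    inversionNumber (1 : Equiv.Perm (Fin n)) = 0 := by
  rw [inversionNumber, Finset.card_eq_zero, Finset.eq_empty_iff_forall_notMem]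
  intro p hp
  rw [mem_inversions] at hp
  exact absurd hp.1 (not_lt_of_gt hp.2)

theorem inversionNumber_inv {n : ℕ} (w : Equiv.Perm (Fin n)) :
    inversionNumber w⁻¹ = inversionNumber w := by
  refine Finset.card_bij' (fun p _ => (w⁻¹ p.2, w⁻¹ p.1)) (fun p _ => (w p.2, w p.1)) ?_ ?_ ?_ ?_
  · intro p hp
    rw [mem_inversions] at hp ⊢
    simpa using hp.symm
  · intro p hp
    rw [mem_inversions] at hp ⊢
    simpa using hp.symm
  · intro p _; simp
  · intro p _; simp

theorem simpleTransposition_lt_iff {n : ℕ} (i : Fin (n - 1)) {a b : Fin n}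
    (h1 : ¬ (a = lo i ∧ b = hi i)) (h2 : ¬ (a = hi i ∧ b = lo i)) :
    simpleTransposition n i a < simpleTransposition n i b ↔ a < b := by
  have key : ∀ c : Fin n, (c = lo i ∧ simpleTransposition n i c = hi i) ∨
      (c = hi i ∧ simpleTransposition n i c = lo i) ∨
      (c ≠ lo i ∧ c ≠ hi i ∧ simpleTransposition n i c = c) := by
    intro c
    by_cases h : c = lo i
    · left; exact ⟨h, by rw [h, simpleTransposition_lo]⟩
    by_cases h' : c = hi i
    · right; left; exact ⟨h', by rw [h', simpleTransposition_hi]⟩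
    · right; right; exact ⟨h, h', simpleTransposition_of_ne i h h'⟩
  rcases key a with ⟨ha, ha'⟩ | ⟨ha, ha'⟩ | ⟨ha, ha2, ha'⟩ <;>
  rcases key b with ⟨hb, hb'⟩ | ⟨hb, hb'⟩ | ⟨hb, hb2, hb'⟩ <;>
  rw [ha', hb'] <;> simp only [Fin.lt_def, Fin.ext_iff, ne_eq] at * <;> omega

/-- Exchanging the adjacent values `i` and `i + 1` alters the relative order of one pair only, the
two positions that carry them. -/
theorem inversionNumber_simple_mul {n : ℕ} (i : Fin (n - 1)) (w : Equiv.Perm (Fin n))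
    (h : w⁻¹ (lo i) < w⁻¹ (hi i)) :
    inversionNumber (simpleTransposition n i * w) = inversionNumber w + 1 := by
  have hnot : (w⁻¹ (lo i), w⁻¹ (hi i)) ∉ inversions w := by
    rw [mem_inversions]
    simp only [not_and, not_lt]
    intro _
    simp
  rw [inversionNumber, inversionNumber, ← Finset.card_insert_of_notMem hnot]
  congr 1
  ext ⟨a, b⟩
  rw [Finset.mem_insert, mem_inversions, mem_inversions]
  simp only [Equiv.Perm.coe_mul, Function.comp_apply, Prod.mk.injEq]
  by_cases h1 : w a = lo i ∧ w b = hi i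
  · have ha : a = w⁻¹ (lo i) := by rw [← h1.1]; simp
    have hb : b = w⁻¹ (hi i) := by rw [← h1.2]; simp
    rw [h1.1, h1.2, simpleTransposition_lo, simpleTransposition_hi]
    refine ⟨fun _ => Or.inl ⟨ha, hb⟩, fun _ => ⟨by rw [ha, hb]; exact h, lo_lt_hi i⟩⟩
  · by_cases h2 : w a = hi i ∧ w b = lo i
    · have ha : a = w⁻¹ (hi i) := by rw [← h2.1]; simp
      have hb : b = w⁻¹ (lo i) := by rw [← h2.2]; simp
      have hba : ¬ a < b := by rw [ha, hb]; exact not_lt_of_gt h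
      constructor
      · exact fun h' => absurd h'.1 hba
      · rintro (h' | h')
        · exfalso
          exact h1 ⟨by simp [h'.1], by simp [h'.2]⟩
        · exact absurd h'.1 hba
    · rw [simpleTransposition_lt_iff i (fun h' => h2 ⟨h'.2, h'.1⟩) (fun h' => h1 ⟨h'.2, h'.1⟩)]
      constructor
      · exact Or.inr
      · rintro (h' | h')
        · exact absurd ⟨by simp [h'.1], by simp [h'.2]⟩ h1
        · exact h'

theorem inversionNumber_simple_mul_of_gt {n : ℕ} (i : Fin (n - 1)) (w : Equiv.Perm (Fin n))
    (h : w⁻¹ (hi i) < w⁻¹ (lo i)) :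
    inversionNumber w = inversionNumber (simpleTransposition n i * w) + 1 := by
  rw [← inversionNumber_simple_mul i (simpleTransposition n i * w)]
  · simp
  · simpa [mul_inv_rev] using h

theorem inv_lo_ne_inv_hi {n : ℕ} (i : Fin (n - 1)) (w : Equiv.Perm (Fin n)) :
    w⁻¹ (lo i) ≠ w⁻¹ (hi i) := fun h => (lo_lt_hi i).ne (w⁻¹.injective h)

theorem inversionNumber_simple_mul_cases {n : ℕ} (i : Fin (n - 1)) (w : Equiv.Perm (Fin n)) :
    inversionNumber (simpleTransposition n i * w) = inversionNumber w + 1 ∨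
      inversionNumber w = inversionNumber (simpleTransposition n i * w) + 1 := by
  rcases lt_or_gt_of_ne (inv_lo_ne_inv_hi i w) with h | h
  · exact Or.inl (inversionNumber_simple_mul i w h)
  · exact Or.inr (inversionNumber_simple_mul_of_gt i w h)

/-- `i` is a left descent of `w`. -/
def IsDescent {n : ℕ} (i : Fin (n - 1)) (w : Equiv.Perm (Fin n)) : Prop :=
  w⁻¹ (hi i) < w⁻¹ (lo i)

theorem isDescent_iff {n : ℕ} {i : Fin (n - 1)} {w : Equiv.Perm (Fin n)} :
    IsDescent i w ↔ inversionNumber w = inversionNumber (simpleTransposition n i * w) + 1 := by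
  refine ⟨inversionNumber_simple_mul_of_gt i w, fun h => ?_⟩
  rcases lt_or_gt_of_ne (inv_lo_ne_inv_hi i w) with h' | h'
  · have := inversionNumber_simple_mul i w h'
    omega
  · exact h'

theorem not_isDescent_iff {n : ℕ} {i : Fin (n - 1)} {w : Equiv.Perm (Fin n)} :
    ¬ IsDescent i w ↔ inversionNumber (simpleTransposition n i * w) = inversionNumber w + 1 := by
  rw [isDescent_iff]
  have := inversionNumber_simple_mul_cases i w
  omega

/-- Without a descent the inverse permutation is monotone, and the identity is the only order
automorphism of `Fin n`. -/
theorem exists_isDescent {n : ℕ} {w : Equiv.Perm (Fin n)} (h : w ≠ 1) : ∃ i, IsDescent i w := by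
  by_contra! hcon
  apply h
  have hmono : ∀ (k : ℕ) (a b : Fin n), (b : ℕ) = a + k → w⁻¹ a ≤ w⁻¹ b := by
    intro k
    induction k with
    | zero => intro a b hab; rw [show b = a from Fin.ext hab]
    | succ k ih =>
      intro a b hab
      refine (ih a ⟨a + k, by omega⟩ rfl).trans ?_
      have := hcon ⟨a + k, by omega⟩
      rw [IsDescent, not_lt] at this
      convert this using 2
      simp [Fin.ext_iff, hab]; omega
  have hm : StrictMono ⇑(w⁻¹) := by
    refine Monotone.strictMono_of_injective (fun a b hab => ?_) w⁻¹.injective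
    exact hmono (b - a) a b (by have : (a : ℕ) ≤ b := hab; omega)
  have h1 : (w⁻¹ : Equiv.Perm (Fin n)) = 1 := by
    have := Subsingleton.elim
      (hm.orderIsoOfSurjective _ w⁻¹.surjective) (OrderIso.refl (Fin n))
    ext a
    exact congrArg Fin.val (DFunLike.congr_fun this a)
  exact inv_eq_one.mp h1

theorem inversionNumber_eq_zero {n : ℕ} {w : Equiv.Perm (Fin n)} (h : inversionNumber w = 0) :
    w = 1 := by
  by_contra hw
  obtain ⟨i, hi⟩ := exists_isDescent hw
  rw [isDescent_iff] at hi
  omega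

/-- The longest permutation. -/
abbrev longest (n : ℕ) : Equiv.Perm (Fin n) := Fin.revPerm

/-! ### Multiplication by the longest permutation. -/

/-- Reversing the positions exchanges inversions and non-inversions, and together these are all the
pairs. -/
theorem inversionNumber_mul_longest {n : ℕ} (w : Equiv.Perm (Fin n)) :
    inversionNumber w + inversionNumber (w * longest n) = inversionNumber (longest n) := by
  have h1 : inversionNumber (w * longest n)
      = (Finset.univ.filter fun p : Fin n × Fin n => p.1 < p.2 ∧ w p.1 < w p.2).card := by
    refine Finset.card_bij' (fun p _ => (p.2.rev, p.1.rev)) (fun p _ => (p.2.rev, p.1.rev))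
      ?_ ?_ ?_ ?_
    · intro p hp
      rw [mem_inversions] at hp
      simpa using hp
    · intro p hp
      rw [mem_inversions]
      simpa using hp
    · intro p _; simp
    · intro p _; simp
  rw [h1, inversionNumber, inversions, ← Finset.card_union_of_disjoint]
  · congr 1
    ext p
    simp only [Finset.mem_union, Finset.mem_filter, Finset.mem_univ, true_and, mem_inversions,
      Fin.revPerm_apply, Fin.rev_lt_rev]
    constructor
    · rintro (h | h) <;> exact ⟨h.1, h.1⟩
    · rintro ⟨h, -⟩
      rcases lt_or_gt_of_ne (fun h' => h.ne (w.injective h')) with h' | h'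
      · exact Or.inr ⟨h, h'⟩
      · exact Or.inl ⟨h, h'⟩
  · rw [Finset.disjoint_filter]
    intro p _ h h'
    exact absurd h.2 (not_lt_of_gt h'.2)

@[simp] theorem longest_mul_self (n : ℕ) : longest n * longest n = 1 := by
  ext a; simp

@[simp] theorem longest_inv (n : ℕ) : (longest n)⁻¹ = longest n :=
  inv_eq_of_mul_eq_one_left (longest_mul_self n)

@[simp] theorem mul_longest_mul_longest {n : ℕ} (w : Equiv.Perm (Fin n)) :
    w * longest n * longest n = w := by
  rw [mul_assoc, longest_mul_self, mul_one]

@[simp] theorem longest_mul_longest_mul {n : ℕ} (w : Equiv.Perm (Fin n)) :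
    longest n * (longest n * w) = w := by
  rw [← mul_assoc, longest_mul_self, one_mul]

theorem inversionNumber_longest_mul {n : ℕ} (w : Equiv.Perm (Fin n)) :
    inversionNumber w + inversionNumber (longest n * w) = inversionNumber (longest n) := by
  have := inversionNumber_mul_longest w⁻¹
  rwa [← inversionNumber_inv (w⁻¹ * longest n), mul_inv_rev, inv_inv, longest_inv,
    inversionNumber_inv] at this

theorem inversionNumber_le {n : ℕ} (w : Equiv.Perm (Fin n)) :
    inversionNumber w ≤ inversionNumber (longest n) := by
  have := inversionNumber_mul_longest w
  omega

theorem eq_longest_of_inversionNumber {n : ℕ} {w : Equiv.Perm (Fin n)}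
    (h : inversionNumber w = inversionNumber (longest n)) : w = longest n := by
  have h1 := inversionNumber_mul_longest w
  have h2 : w * longest n = 1 := inversionNumber_eq_zero (by omega)
  rw [← mul_longest_mul_longest w, h2, one_mul]

theorem inversionNumber_longest (n : ℕ) :
    inversionNumber (longest n) = ∑ k ∈ Finset.range n, k := by
  have h1 : inversions (longest n)
      = Finset.univ.filter fun p : Fin n × Fin n => p.1 < p.2 := by
    ext p; simp [mem_inversions]
  rw [inversionNumber, h1, Finset.card_filter, Fintype.sum_prod_type_right,
    Finset.sum_range]
  refine Finset.sum_congr rfl fun b _ => ?_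
  rw [← Finset.card_filter]
  simp [Finset.filter_gt_eq_Iio]

/-! ### Words -/

/-- The product of the simple transpositions in a word. -/
abbrev wordProd {n : ℕ} (l : List (Fin (n - 1))) : Equiv.Perm (Fin n) :=
  (l.map (simpleTransposition n)).prod

theorem wordProd_cons {n : ℕ} (i : Fin (n - 1)) (l : List (Fin (n - 1))) :
    wordProd (i :: l) = simpleTransposition n i * wordProd l := by
  simp [wordProd]

theorem inversionNumber_wordProd_le {n : ℕ} (l : List (Fin (n - 1))) :
    inversionNumber (wordProd l) ≤ l.length := by
  induction l with
  | nil => simp [wordProd]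
  | cons i l ih =>
    rw [wordProd_cons, List.length_cons]
    have := inversionNumber_simple_mul_cases i (wordProd l)
    omega

theorem exists_word_length_eq {n : ℕ} (w : Equiv.Perm (Fin n)) :
    ∃ l : List (Fin (n - 1)), wordProd l = w ∧ l.length = inversionNumber w := by
  induction hk : inversionNumber w generalizing w with
  | zero => exact ⟨[], by rw [inversionNumber_eq_zero hk]; simp [wordProd]⟩
  | succ k ih =>
    have hw : w ≠ 1 := by rintro rfl; simp at hk
    obtain ⟨i, hi⟩ := exists_isDescent hw
    rw [isDescent_iff] at hi
    obtain ⟨l, hl, hl'⟩ := ih (simpleTransposition n i * w) (by omega)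
    exact ⟨i :: l, by rw [wordProd_cons, hl, simpleTransposition_mul_cancel], by simp [hl']⟩

theorem IsReducedWord.length_eq {n : ℕ} {w : Equiv.Perm (Fin n)} {l : List (Fin (n - 1))}
    (h : IsReducedWord w l) : l.length = inversionNumber w := by
  obtain ⟨l', hl', hlen⟩ := exists_word_length_eq w
  refine le_antisymm (hlen ▸ h.2 l' hl') ?_
  rw [← h.1]
  exact inversionNumber_wordProd_le l

/-! ### Divided differences of words and of permutations -/

section Domain

variable {R : Type*} [CommRing R] [IsDomain R] {n : ℕ}

/-- The composite of the simple divided differences in a word. -/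
abbrev wordDividedDifference (l : List (Fin (n - 1))) (f : MvPolynomial (Fin n) R) :
    MvPolynomial (Fin n) R :=
  l.foldr simpleDividedDifference f

/-- Matsumoto's argument, by induction on length. If the first letters `i` and `j` differ, both are
descents of the common product. It then has reduced words that begin with the two sides of the
commutation or braid relation for `i` and `j`, and the induction hypothesis links the given words to
these. -/
theorem wordDividedDifference_congr (l l' : List (Fin (n - 1))) (h : wordProd l = wordProd l')
    (hl : l.length = inversionNumber (wordProd l))
    (hl' : l'.length = inversionNumber (wordProd l')) (f : MvPolynomial (Fin n) R) :
    wordDividedDifference l f = wordDividedDifference l' f := by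
  induction hk : l.length using Nat.strong_induction_on generalizing l l' with
  | _ k ih =>
  subst hk
  have hlen : l.length = l'.length := by rw [hl, hl', h]
  match l, l' with
  | [], [] => rfl
  | [], _ :: _ => simp at hlen
  | _ :: _, [] => simp at hlen
  | i :: a, j :: b =>
    have hai : a.length = inversionNumber (wordProd a) := by
      have h1 := inversionNumber_wordProd_le a
      have h2 := inversionNumber_simple_mul_cases i (wordProd a)
      rw [wordProd_cons, List.length_cons] at hl
      omega
    have hbj : b.length = inversionNumber (wordProd b) := by
      have h1 := inversionNumber_wordProd_le b
      have h2 := inversionNumber_simple_mul_cases j (wordProd b)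
      rw [wordProd_cons, List.length_cons] at hl'
      omega
    have hlab : a.length = b.length := by simpa using hlen
    set w := wordProd (i :: a) with hw
    have hwa : wordProd a = simpleTransposition n i * w := by
      rw [hw, wordProd_cons, simpleTransposition_mul_cancel]
    have hwb : wordProd b = simpleTransposition n j * w := by
      rw [h, wordProd_cons, simpleTransposition_mul_cancel]
    have hlw : inversionNumber w = a.length + 1 := by rw [← hl, List.length_cons]
    have hdi : IsDescent i w := by rw [isDescent_iff, ← hwa]; omega
    have hdj : IsDescent j w := by rw [isDescent_iff, ← hwb]; omega
    -- Here `c` is a reduced word of `s_j s_i w`, so that `j :: c` and `i :: c` are reduced words of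
    -- `s_i w` and `s_j w`. The induction hypothesis is an argument so that the claim can be used
    -- with `i` and `j` exchanged.
    have far : ∀ (i j : Fin (n - 1)) (a b : List (Fin (n - 1))),
        (i : ℕ) + 1 < j → IsDescent i w → IsDescent j w →
        wordProd a = simpleTransposition n i * w → wordProd b = simpleTransposition n j * w →
        a.length + 1 = inversionNumber w → b.length + 1 = inversionNumber w →
        a.length < (i :: a).length → (∀ m < (i :: a).length, ∀ (l l' : List (Fin (n - 1))),
          wordProd l = wordProd l' → l.length = inversionNumber (wordProd l) →
          l'.length = inversionNumber (wordProd l') → l.length = m →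
          wordDividedDifference l f = wordDividedDifference l' f) →
        wordDividedDifference (i :: a) f = wordDividedDifference (j :: b) f := by
      intro i j a b hij hdi hdj hwa hwb hla hlb hlt ih
      have hcomm := simpleTransposition_comm hij
      have e1 : inversionNumber (simpleTransposition n i * w)
          = inversionNumber (simpleTransposition n j * (simpleTransposition n i * w)) + 1 := by
        rw [← isDescent_iff, IsDescent]
        have hne : ∀ {a b : Fin n}, (a : ℕ) ≠ b → a ≠ b := fun h h' => h (congrArg _ h')
        rw [mul_inv_rev, simpleTransposition_inv, Equiv.Perm.mul_apply, Equiv.Perm.mul_apply,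
          simpleTransposition_of_ne i (hne (by simp; omega)) (hne (by simp; omega)),
          simpleTransposition_of_ne i (hne (by simp; omega)) (hne (by simp; omega))]
        exact hdj
      rw [isDescent_iff] at hdi hdj
      obtain ⟨c, hc, hc'⟩ := exists_word_length_eq
        (simpleTransposition n j * (simpleTransposition n i * w))
      have h1 : wordDividedDifference a f = wordDividedDifference (j :: c) f := by
        refine ih a.length hlt a (j :: c) ?_ ?_ ?_ rfl
        · rw [wordProd_cons, hc, simpleTransposition_mul_cancel, hwa]
        · rw [hwa]; omega
        · rw [wordProd_cons, hc, simpleTransposition_mul_cancel, List.length_cons, hc']; omega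
      have h2 : wordDividedDifference b f = wordDividedDifference (i :: c) f := by
        have hwc : wordProd (i :: c) = simpleTransposition n j * w := by
          rw [wordProd_cons, hc, ← mul_assoc (simpleTransposition n j), ← hcomm, mul_assoc,
            simpleTransposition_mul_cancel]
        refine ih b.length (by simp; omega) b (i :: c) (by rw [hwc, hwb]) ?_ ?_ rfl
        · rw [hwb]; omega
        · rw [hwc, List.length_cons, hc']; omega
      simp only [wordDividedDifference, List.foldr_cons] at h1 h2 ⊢
      rw [h1, h2, simpleDividedDifference_comm hij]
    -- The same with the braid relation: `c` is a reduced word of `s_i s_j s_i w`, completed by `j,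
    -- i` on one side and by `i, j` on the other.
    have near : ∀ (i j : Fin (n - 1)) (a b : List (Fin (n - 1))),
        (j : ℕ) = i + 1 → IsDescent i w → IsDescent j w →
        wordProd a = simpleTransposition n i * w → wordProd b = simpleTransposition n j * w →
        a.length + 1 = inversionNumber w → b.length + 1 = inversionNumber w →
        a.length < (i :: a).length → (∀ m < (i :: a).length, ∀ (l l' : List (Fin (n - 1))),
          wordProd l = wordProd l' → l.length = inversionNumber (wordProd l) →
          l'.length = inversionNumber (wordProd l') → l.length = m →
          wordDividedDifference l f = wordDividedDifference l' f) →
        wordDividedDifference (i :: a) f = wordDividedDifference (j :: b) f := by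
      intro i j a b hij hdi hdj hwa hwb hla hlb hlt ih
      have hbraid := simpleTransposition_braid hij
      have hlohi : lo j = hi i := by simp [Fin.ext_iff, hij]
      have hne1 : hi j ≠ lo i := by simp [Fin.ext_iff, hij]; omega
      have hne2 : hi j ≠ hi i := by simp [Fin.ext_iff, hij]
      have hne3 : lo i ≠ lo j := by simp [Fin.ext_iff, hij]
      have e0 : w⁻¹ (hi j) < w⁻¹ (hi i) := by
        have := hdj
        rwa [IsDescent, hlohi] at this
      have e1 : inversionNumber (simpleTransposition n i * w)
          = inversionNumber (simpleTransposition n j * (simpleTransposition n i * w)) + 1 := by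
        rw [← isDescent_iff, IsDescent, mul_inv_rev, simpleTransposition_inv,
          Equiv.Perm.mul_apply, Equiv.Perm.mul_apply, hlohi, simpleTransposition_hi,
          simpleTransposition_of_ne i hne1 hne2]
        exact e0.trans hdi
      have e2 : inversionNumber (simpleTransposition n j * (simpleTransposition n i * w))
          = inversionNumber (simpleTransposition n i *
            (simpleTransposition n j * (simpleTransposition n i * w))) + 1 := by
        rw [← isDescent_iff, IsDescent, mul_inv_rev, mul_inv_rev, simpleTransposition_inv,
          simpleTransposition_inv, Equiv.Perm.mul_apply, Equiv.Perm.mul_apply,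
          Equiv.Perm.mul_apply, Equiv.Perm.mul_apply, ← hlohi, simpleTransposition_lo,
          simpleTransposition_of_ne j hne3 (hne1.symm), simpleTransposition_lo,
          simpleTransposition_of_ne i hne1 hne2]
        exact e0
      rw [isDescent_iff] at hdi hdj
      obtain ⟨c, hc, hc'⟩ := exists_word_length_eq
        (simpleTransposition n i * (simpleTransposition n j * (simpleTransposition n i * w)))
      have h1 : wordDividedDifference a f = wordDividedDifference (j :: i :: c) f := by
        have hwc : wordProd (j :: i :: c) = simpleTransposition n i * w := by
          rw [wordProd_cons, wordProd_cons, hc, simpleTransposition_mul_cancel,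
            simpleTransposition_mul_cancel]
        refine ih a.length hlt a (j :: i :: c) (by rw [hwc, hwa]) ?_ ?_ rfl
        · rw [hwa]; omega
        · rw [hwc, List.length_cons, List.length_cons, hc']; omega
      have h2 : wordDividedDifference b f = wordDividedDifference (i :: j :: c) f := by
        have hwc : wordProd (i :: j :: c) = simpleTransposition n j * w := by
          rw [wordProd_cons, wordProd_cons, hc, show ∀ a b c : Equiv.Perm (Fin n),
            a * (b * (a * c)) = a * b * a * c from fun a b c => by simp only [mul_assoc], hbraid]
          simp only [mul_assoc, simpleTransposition_mul_cancel]
        refine ih b.length (by simp; omega) b (i :: j :: c) (by rw [hwc, hwb]) ?_ ?_ rfl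
        · rw [hwb]; omega
        · rw [hwc, List.length_cons, List.length_cons, hc']; omega
      simp only [wordDividedDifference, List.foldr_cons] at h1 h2 ⊢
      rw [h1, h2, simpleDividedDifference_braid hij]
    have ih' : ∀ m < (i :: a).length, ∀ (l l' : List (Fin (n - 1))),
          wordProd l = wordProd l' → l.length = inversionNumber (wordProd l) →
          l'.length = inversionNumber (wordProd l') → l.length = m →
          wordDividedDifference l f = wordDividedDifference l' f :=
      fun m hm l l' h1 h2 h3 h4 => ih m hm l l' h1 h2 h3 h4
    have ih'' : ∀ m < (j :: b).length, ∀ (l l' : List (Fin (n - 1))),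
          wordProd l = wordProd l' → l.length = inversionNumber (wordProd l) →
          l'.length = inversionNumber (wordProd l') → l.length = m →
          wordDividedDifference l f = wordDividedDifference l' f := by
      rw [← hlen]; exact ih'
    rcases lt_trichotomy (i : ℕ) j with hij | hij | hij
    · by_cases hij' : (j : ℕ) = i + 1
      · exact near i j a b hij' hdi hdj hwa hwb (by omega) (by omega) (by simp) ih'
      · exact far i j a b (by omega) hdi hdj hwa hwb (by omega) (by omega) (by simp) ih'
    · obtain rfl : i = j := Fin.ext hij
      simp only [wordDividedDifference, List.foldr_cons]
      congr 1
      exact ih' a.length (by simp) a b (by rw [hwa, hwb]) hai hbj rfl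
    · symm
      by_cases hij' : (i : ℕ) = j + 1
      · exact near j i b a hij' hdj hdi hwb hwa (by omega) (by omega) (by simp) ih''
      · exact far j i b a (by omega) hdj hdi hwb hwa (by omega) (by omega) (by simp) ih''

theorem dividedDifference_eq_word {w : Equiv.Perm (Fin n)} {l : List (Fin (n - 1))}
    (h : wordProd l = w) (hl : l.length = inversionNumber w) (f : MvPolynomial (Fin n) R) :
    dividedDifference w f = wordDividedDifference l f := by
  have hspec := Classical.choose_spec (exists_reducedWord w)
  refine wordDividedDifference_congr _ l ?_ ?_ (by rw [h, hl]) f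
  · rw [h]; exact hspec.1
  · rw [hspec.length_eq]
    exact congrArg _ hspec.1.symm

@[simp] theorem dividedDifference_one (f : MvPolynomial (Fin n) R) :
    dividedDifference 1 f = f := by
  rw [dividedDifference_eq_word (l := []) (by simp [wordProd]) (by simp)]
  rfl

theorem simple_dividedDifference_of_ascent {i : Fin (n - 1)} {w : Equiv.Perm (Fin n)}
    (h : inversionNumber (simpleTransposition n i * w) = inversionNumber w + 1)
    (f : MvPolynomial (Fin n) R) :
    simpleDividedDifference i (dividedDifference w f)
      = dividedDifference (simpleTransposition n i * w) f := by
  obtain ⟨l, hl, hlen⟩ := exists_word_length_eq w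
  rw [dividedDifference_eq_word hl hlen,
    dividedDifference_eq_word (l := i :: l) (by rw [wordProd_cons, hl]) (by simp [hlen, h])]
  rfl

theorem simple_dividedDifference_of_descent {i : Fin (n - 1)} {w : Equiv.Perm (Fin n)}
    (h : inversionNumber w = inversionNumber (simpleTransposition n i * w) + 1)
    (f : MvPolynomial (Fin n) R) :
    simpleDividedDifference i (dividedDifference w f) = 0 := by
  have := simple_dividedDifference_of_ascent (i := i) (w := simpleTransposition n i * w)
    (by simpa using h) f
  rw [simpleTransposition_mul_cancel] at this
  rw [← this, simpleDividedDifference_self]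

/-- The first letter that lowers the length produces `∂_i ∂_i = 0`, and a deficit in length cannot
be made up by later letters. -/
theorem wordDividedDifference_dividedDifference (l : List (Fin (n - 1)))
    (w : Equiv.Perm (Fin n)) (f : MvPolynomial (Fin n) R) :
    wordDividedDifference l (dividedDifference w f)
      = if l.length + inversionNumber w = inversionNumber (wordProd l * w)
        then dividedDifference (wordProd l * w) f else 0 := by
  induction l with
  | nil => simp [wordProd, wordDividedDifference]
  | cons i l ih =>
    have e : wordDividedDifference (i :: l) (dividedDifference w f)
        = simpleDividedDifference i (wordDividedDifference l (dividedDifference w f)) := rfl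
    have hle : ∀ l : List (Fin (n - 1)),
        inversionNumber (wordProd l * w) ≤ l.length + inversionNumber w := by
      intro l
      induction l with
      | nil => simp [wordProd]
      | cons i l ih =>
        rw [wordProd_cons, mul_assoc, List.length_cons]
        have := inversionNumber_simple_mul_cases i (wordProd l * w)
        omega
    rw [e, ih, wordProd_cons, mul_assoc, List.length_cons]
    have h1 := hle l
    rcases inversionNumber_simple_mul_cases i (wordProd l * w) with h | h
    · split_ifs with h2 h3 h3
      · exact simple_dividedDifference_of_ascent h f
      · omega
      · omega
      · simp
    · split_ifs with h2 h3 h3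
      · omega
      · exact simple_dividedDifference_of_descent h f
      · omega
      · simp

theorem dividedDifference_dividedDifference (v w : Equiv.Perm (Fin n))
    (f : MvPolynomial (Fin n) R) :
    dividedDifference v (dividedDifference w f)
      = if inversionNumber v + inversionNumber w = inversionNumber (v * w)
        then dividedDifference (v * w) f else 0 := by
  obtain ⟨l, hl, hlen⟩ := exists_word_length_eq v
  rw [dividedDifference_eq_word hl hlen, wordDividedDifference_dividedDifference, hl, hlen]

theorem wordDividedDifference_eq (l : List (Fin (n - 1))) (f : MvPolynomial (Fin n) R) :
    wordDividedDifference l f = if l.length = inversionNumber (wordProd l)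
      then dividedDifference (wordProd l) f else 0 := by
  have := wordDividedDifference_dividedDifference l 1 f
  simpa using this

end Domain

end ToyGW

end

noncomputable section

namespace ToyGW

open MvPolynomial

/-! ### Linearity, homogeneity and the top coefficient form -/

section CommRing

variable {R : Type*} [CommRing R] {n : ℕ}

theorem constantCoeff_of_isHomogeneous {f : MvPolynomial (Fin n) R} {d : ℕ}
    (h : f.IsHomogeneous d) (hd : d ≠ 0) : constantCoeff f = 0 := by
  rw [constantCoeff_eq]
  exact h.coeff_eq_zero (by simpa using hd.symm)

theorem isSymmetric_of_simple {f : MvPolynomial (Fin n) R}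
    (h : ∀ i, simpleDividedDifference i f = 0) : f.IsSymmetric := by
  intro w
  obtain ⟨l, rfl⟩ := exists_word w
  change act (wordProd l) f = f
  induction l with
  | nil => simp [wordProd]
  | cons i l ih =>
    rw [wordProd_cons, act_mul, ih, act_eq_of_simpleDividedDifference_eq_zero (h i)]

/-- The staircase monomial `x_1^{n-1} x_2^{n-2} ⋯ x_{n-1}`. -/
def staircase (R : Type*) [CommRing R] (n : ℕ) : MvPolynomial (Fin n) R :=
  ∏ j : Fin n, X j ^ (n - 1 - j)

theorem act_prod_X_pow (w : Equiv.Perm (Fin n)) (m : Fin n → ℕ) :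
    act w (∏ j, X j ^ m j : MvPolynomial (Fin n) R) = ∏ j, X j ^ m (w⁻¹ j) := by
  rw [map_prod]
  simp only [map_pow, rename_X]
  exact Fintype.prod_equiv w _ _ fun j => by simp

theorem staircase_isHomogeneous :
    (staircase R n).IsHomogeneous (inversionNumber (longest n)) := by
  have h : (staircase R n).IsHomogeneous (∑ j : Fin n, (n - 1 - j)) :=
    IsHomogeneous.prod _ _ _ fun j _ => isHomogeneous_X_pow _ _
  rwa [Fin.sum_univ_eq_sum_range (fun k => n - 1 - k), Finset.sum_range_reflect (fun k => k),
    ← inversionNumber_longest] at h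

end CommRing

section Domain

variable {R : Type*} [CommRing R] [IsDomain R] {n : ℕ}

theorem wordDividedDifference_add (l : List (Fin (n - 1))) (f g : MvPolynomial (Fin n) R) :
    wordDividedDifference l (f + g)
      = wordDividedDifference l f + wordDividedDifference l g := by
  induction l with
  | nil => rfl
  | cons i l ih =>
    simp only [wordDividedDifference, List.foldr_cons] at ih ⊢
    rw [ih, simpleDividedDifference_add]

theorem wordDividedDifference_mul {g : MvPolynomial (Fin n) R} (hg : g.IsSymmetric)
    (l : List (Fin (n - 1))) (f : MvPolynomial (Fin n) R) :
    wordDividedDifference l (g * f) = g * wordDividedDifference l f := by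
  induction l with
  | nil => rfl
  | cons i l ih =>
    simp only [wordDividedDifference, List.foldr_cons] at ih ⊢
    rw [ih, simpleDividedDifference_mul_of_act_eq (hg _)]

theorem exists_dividedDifference_eq_word (w : Equiv.Perm (Fin n)) :
    ∃ l : List (Fin (n - 1)), wordProd l = w ∧ l.length = inversionNumber w ∧
      ∀ f : MvPolynomial (Fin n) R, dividedDifference w f = wordDividedDifference l f := by
  obtain ⟨l, hl, hlen⟩ := exists_word_length_eq w
  exact ⟨l, hl, hlen, dividedDifference_eq_word hl hlen⟩

theorem dividedDifference_add (w : Equiv.Perm (Fin n)) (f g : MvPolynomial (Fin n) R) :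
    dividedDifference w (f + g) = dividedDifference w f + dividedDifference w g :=
  wordDividedDifference_add _ f g

theorem dividedDifference_mul {g : MvPolynomial (Fin n) R} (hg : g.IsSymmetric)
    (w : Equiv.Perm (Fin n)) (f : MvPolynomial (Fin n) R) :
    dividedDifference w (g * f) = g * dividedDifference w f :=
  wordDividedDifference_mul hg _ f

/-- The divided difference `∂_w` as a linear map. -/
def dividedDifferenceₗ (w : Equiv.Perm (Fin n)) :
    MvPolynomial (Fin n) R →ₗ[R] MvPolynomial (Fin n) R where
  toFun := dividedDifference w
  map_add' := dividedDifference_add w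
  map_smul' r f := by
    rw [smul_eq_C_mul, dividedDifference_mul (IsSymmetric.C r), RingHom.id_apply, smul_eq_C_mul]

@[simp] theorem dividedDifferenceₗ_apply (w : Equiv.Perm (Fin n)) (f : MvPolynomial (Fin n) R) :
    dividedDifferenceₗ w f = dividedDifference w f := rfl

theorem dividedDifference_sum {ι : Type*} (w : Equiv.Perm (Fin n)) (s : Finset ι)
    (f : ι → MvPolynomial (Fin n) R) :
    dividedDifference w (∑ i ∈ s, f i) = ∑ i ∈ s, dividedDifference w (f i) :=
  map_sum (dividedDifferenceₗ w) f s

theorem dividedDifference_sub (w : Equiv.Perm (Fin n)) (f g : MvPolynomial (Fin n) R) :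
    dividedDifference w (f - g) = dividedDifference w f - dividedDifference w g :=
  map_sub (dividedDifferenceₗ w) f g

theorem dividedDifference_simple (i : Fin (n - 1)) (f : MvPolynomial (Fin n) R) :
    dividedDifference (simpleTransposition n i) f = simpleDividedDifference i f := by
  have h := simple_dividedDifference_of_ascent (i := i) (w := 1)
    (by rw [← not_isDescent_iff, IsDescent]; simp) f
  rw [dividedDifference_one, mul_one] at h
  exact h.symm

theorem isHomogeneous_of_mul {α g : MvPolynomial (Fin n) R} {a d : ℕ} (hα : α.IsHomogeneous a)
    (hα0 : α ≠ 0) (h : (α * g).IsHomogeneous (a + d)) : g.IsHomogeneous d := by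
  have key : ∀ k, homogeneousComponent (a + k) (α * g) = α * homogeneousComponent k g := by
    intro k
    conv_lhs => rw [← sum_homogeneousComponent g, Finset.mul_sum, map_sum]
    have h1 : ∀ i, homogeneousComponent (a + k) (α * homogeneousComponent i g)
        = if i = k then α * homogeneousComponent i g else 0 := by
      intro i
      rw [homogeneousComponent_of_mem (hα.mul (homogeneousComponent_isHomogeneous i g))]
      congr 1
      simp [eq_comm]
    simp_rw [h1]
    rw [Finset.sum_ite_eq']
    split_ifs with hk
    · rfl
    · rw [homogeneousComponent_eq_zero k g (by simpa using hk), mul_zero]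
  rw [← sum_homogeneousComponent g]
  refine IsHomogeneous.sum _ _ _ fun i _ => ?_
  by_cases hid : i = d
  · subst hid; exact homogeneousComponent_isHomogeneous _ _
  · have h2 := key i
    rw [homogeneousComponent_of_mem h, if_neg (by omega)] at h2
    rw [(mul_eq_zero.mp h2.symm).resolve_left hα0]
    exact isHomogeneous_zero _ _ _

theorem simpleDividedDifference_isHomogeneous {i : Fin (n - 1)} {f : MvPolynomial (Fin n) R}
    {d : ℕ} (h : f.IsHomogeneous (d + 1)) : (simpleDividedDifference i f).IsHomogeneous d := by
  refine isHomogeneous_of_mul (α := X (lo i) - X (hi i)) (a := 1)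
    ((isHomogeneous_X _ _).sub (isHomogeneous_X _ _)) (X_sub_X_ne_zero (lo_lt_hi i).ne) ?_
  rw [mul_simpleDividedDifference, add_comm]
  exact h.sub h.rename_isHomogeneous

theorem dividedDifference_isHomogeneous {w : Equiv.Perm (Fin n)} {f : MvPolynomial (Fin n) R}
    {d : ℕ} (h : f.IsHomogeneous (d + inversionNumber w)) :
    (dividedDifference w f).IsHomogeneous d := by
  obtain ⟨l, -, hlen, hw⟩ := exists_dividedDifference_eq_word (R := R) w
  rw [hw]
  rw [← hlen] at h
  clear hw hlen
  induction l generalizing d with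
  | nil => exact h
  | cons i l ih =>
    refine simpleDividedDifference_isHomogeneous (ih ?_)
    rwa [List.length_cons, ← add_assoc, add_right_comm] at h

theorem simpleDividedDifference_prod_X_pow (i : Fin (n - 1)) (m m' : Fin n → ℕ)
    (h : m (lo i) = m (hi i) + 1) (h1 : m' (lo i) = m (hi i))
    (h2 : ∀ j, j ≠ lo i → m' j = m j) :
    simpleDividedDifference i (∏ j, X j ^ m j : MvPolynomial (Fin n) R) = ∏ j, X j ^ m' j := by
  have e : (∏ j, X j ^ m j : MvPolynomial (Fin n) R) = X (lo i) * ∏ j, X j ^ m' j := by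
    rw [← Finset.mul_prod_erase _ _ (Finset.mem_univ (lo i)),
      ← Finset.mul_prod_erase (f := fun j => (X j : MvPolynomial (Fin n) R) ^ m' j) _
        (Finset.mem_univ (lo i)), ← mul_assoc, h, h1, pow_succ']
    congr 1
    refine Finset.prod_congr rfl fun j hj => ?_
    rw [h2 j (Finset.ne_of_mem_erase hj)]
  rw [e]
  apply simpleDividedDifference_X_mul
  rw [act_prod_X_pow]
  refine Finset.prod_congr rfl fun j _ => ?_
  congr 1
  rw [simpleTransposition_inv]
  by_cases hj : j = lo i
  · rw [hj, simpleTransposition_lo, h1, h2 _ (lo_lt_hi i).ne']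
  · by_cases hj' : j = hi i
    · rw [hj', simpleTransposition_hi, h1, h2 _ (lo_lt_hi i).ne']
    · rw [simpleTransposition_of_ne i hj hj']

theorem exists_word_staircase (r : ℕ) (hr : r ≤ n - 1) :
    ∃ l : List (Fin (n - 1)), l.length = ∑ k ∈ Finset.range (r + 1), k ∧
      wordDividedDifference l (∏ j : Fin n, X j ^ (r - j) : MvPolynomial (Fin n) R) = 1 := by
  induction r with
  | zero => exact ⟨[], by simp, by simp [wordDividedDifference]⟩
  | succ r ih =>
    obtain ⟨l, hl, hl'⟩ := ih (by omega)
    -- Applying `∂_0, ∂_1, …, ∂_r` in this order lowers the exponents `r + 1, r, …, 1` by one each: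
    -- at each stage the two exponents concerned differ by exactly one.
    have key : ∀ k ≤ r + 1, ∃ l' : List (Fin (n - 1)), l'.length = k ∧
        wordDividedDifference l' (∏ j : Fin n, X j ^ (r + 1 - j) : MvPolynomial (Fin n) R)
          = ∏ j : Fin n, X j ^ (if (j : ℕ) < k then r - j else r + 1 - j) := by
      intro k
      induction k with
      | zero => exact fun _ => ⟨[], rfl, by simp [wordDividedDifference]⟩
      | succ k ih =>
        intro hk
        obtain ⟨l', h1, h2⟩ := ih (by omega)
        refine ⟨⟨k, by omega⟩ :: l', by simp [h1], ?_⟩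
        rw [wordDividedDifference, List.foldr_cons]
        rw [wordDividedDifference] at h2
        rw [h2]
        apply simpleDividedDifference_prod_X_pow
        · simp; omega
        · simp
        · intro j hj
          have : (j : ℕ) ≠ k := fun h => hj (Fin.ext h)
          by_cases hjk : (j : ℕ) < k
          · rw [if_pos hjk, if_pos (by omega)]
          · rw [if_neg hjk, if_neg (by omega)]
    obtain ⟨l', h1, h2⟩ := key (r + 1) le_rfl
    refine ⟨l ++ l', by rw [List.length_append, hl, h1, Finset.sum_range_succ _ (r + 1)], ?_⟩
    rw [wordDividedDifference, List.foldr_append]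
    rw [wordDividedDifference] at h2
    rw [h2, ← hl', wordDividedDifference]
    congr 1
    refine Finset.prod_congr rfl fun j _ => ?_
    congr 1
    split_ifs <;> omega

@[simp] theorem dividedDifference_longest_staircase :
    dividedDifference (longest n) (staircase R n) = 1 := by
  obtain ⟨l, hl, hl'⟩ := exists_word_staircase (R := R) (n := n) (n - 1) le_rfl
  have h := wordDividedDifference_eq l (staircase R n)
  have hlen : l.length = inversionNumber (longest n) := by
    rw [hl, inversionNumber_longest]
    rcases n with _ | n <;> simp
  -- The word found has the length of `w₀` and does not act as zero. It is therefore reduced, and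
  -- its product has to be `w₀`; the product itself is never computed.
  have hne : wordDividedDifference l (staircase R n) ≠ 0 := by
    rw [staircase, hl']; exact one_ne_zero
  split_ifs at h with hc
  · rw [eq_longest_of_inversionNumber (hc.symm.trans hlen)] at h
    rw [← h, staircase, hl']
  · exact absurd h hne

/-- The constant term of `∂_{w₀} f`. -/
def topCoeff (R : Type*) [CommRing R] [IsDomain R] (n : ℕ) : MvPolynomial (Fin n) R →ₗ[R] R :=
  lcoeff R 0 ∘ₗ dividedDifferenceₗ (longest n)

/-! ### Antisymmetry and adjunction for the top coefficient form. -/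

theorem topCoeff_apply (f : MvPolynomial (Fin n) R) :
    topCoeff R n f = constantCoeff (dividedDifference (longest n) f) := rfl

theorem dividedDifference_longest_simple (i : Fin (n - 1)) (f : MvPolynomial (Fin n) R) :
    dividedDifference (longest n) f
      = dividedDifference (longest n * simpleTransposition n i)
        (simpleDividedDifference i f) := by
  rw [← dividedDifference_simple, dividedDifference_dividedDifference, mul_assoc,
    simpleTransposition_mul_self, mul_one, if_pos]
  rw [add_comm]
  exact inversionNumber_longest_mul _

theorem topCoeff_act_simple (i : Fin (n - 1)) (f : MvPolynomial (Fin n) R) :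
    topCoeff R n (act (simpleTransposition n i) f) = - topCoeff R n f := by
  rw [topCoeff_apply, dividedDifference_longest_simple i, simpleDividedDifference_act,
    topCoeff_apply, dividedDifference_longest_simple i f, ← dividedDifferenceₗ_apply, map_neg,
    dividedDifferenceₗ_apply, map_neg]

theorem topCoeff_simple (i : Fin (n - 1)) (f : MvPolynomial (Fin n) R) :
    topCoeff R n (simpleDividedDifference i f) = 0 := by
  rw [topCoeff_apply, dividedDifference_longest_simple i, simpleDividedDifference_self,
    ← dividedDifferenceₗ_apply, map_zero, map_zero]

theorem sign_simpleTransposition (i : Fin (n - 1)) :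
    Equiv.Perm.sign (simpleTransposition n i) = -1 :=
  Equiv.Perm.sign_swap (lo_lt_hi i).ne

theorem topCoeff_act (w : Equiv.Perm (Fin n)) (f : MvPolynomial (Fin n) R) :
    topCoeff R n (act w f) = (Equiv.Perm.sign w : ℤ) * topCoeff R n f := by
  obtain ⟨l, rfl⟩ := exists_word w
  change topCoeff R n (act (wordProd l) f) = (Equiv.Perm.sign (wordProd l) : ℤ) * _
  induction l with
  | nil => simp [wordProd]
  | cons i l ih =>
    rw [wordProd_cons, act_mul, topCoeff_act_simple, ih, map_mul, sign_simpleTransposition]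
    simp

theorem topCoeff_simple_mul (i : Fin (n - 1)) (f g : MvPolynomial (Fin n) R) :
    topCoeff R n (simpleDividedDifference i f * g)
      = topCoeff R n (f * simpleDividedDifference i g) := by
  rw [← sub_eq_zero, ← map_sub, simpleDividedDifference_mul_sub, topCoeff_simple]

theorem topCoeff_dividedDifference_mul (w : Equiv.Perm (Fin n)) (f g : MvPolynomial (Fin n) R) :
    topCoeff R n (dividedDifference w f * g)
      = topCoeff R n (f * dividedDifference w⁻¹ g) := by
  obtain ⟨l, hl, hlen⟩ := exists_word_length_eq w
  have hrev : ∀ l : List (Fin (n - 1)), wordProd l.reverse = (wordProd l)⁻¹ := by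
    intro l
    rw [wordProd, wordProd, List.prod_inv_reverse, List.map_reverse, List.map_map]
    congr 3
  rw [dividedDifference_eq_word hl hlen, dividedDifference_eq_word (l := l.reverse)
    (by rw [hrev, hl]) (by rw [List.length_reverse, hlen, inversionNumber_inv])]
  clear hl hlen
  induction l generalizing g with
  | nil => rfl
  | cons i l ih =>
    rw [List.reverse_cons, wordDividedDifference, List.foldr_cons, topCoeff_simple_mul]
    rw [wordDividedDifference] at ih
    rw [ih, wordDividedDifference, wordDividedDifference, List.foldr_append]
    rfl

theorem topCoeff_staircase : topCoeff R n (staircase R n) = 1 := by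
  rw [topCoeff_apply, dividedDifference_longest_staircase, map_one]

/-- The staircase monomial already has the degree of `∂_{w₀}`, so a component of `f` of degree `k`
contributes a polynomial of degree `k`, without constant term unless `k = 0`. -/
theorem topCoeff_staircase_mul (f : MvPolynomial (Fin n) R) :
    topCoeff R n (staircase R n * f) = constantCoeff f := by
  conv_lhs => rw [← sum_homogeneousComponent f, Finset.mul_sum, map_sum]
  rw [Finset.sum_eq_single 0]
  · rw [homogeneousComponent_zero, mul_comm, ← smul_eq_C_mul, map_smul, topCoeff_staircase,
      smul_eq_mul, mul_one, constantCoeff_eq]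
  · intro k _ hk
    rw [topCoeff_apply]
    refine constantCoeff_of_isHomogeneous (d := k) (dividedDifference_isHomogeneous ?_) hk
    rw [add_comm]
    exact staircase_isHomogeneous.mul (homogeneousComponent_isHomogeneous k f)
  · simp

/-- The top coefficient of a product of polynomials in one variable each is a determinant. -/
theorem topCoeff_prod_aeval [CharZero R] (P : Fin n → Polynomial R)
    (hP : ∀ j, (P j).natDegree < n) :
    topCoeff R n (∏ j, Polynomial.aeval (X j) (P j))
      = Matrix.det (Matrix.of fun i j : Fin n => (P j).coeff (n - 1 - i)) := by
  have h1 : ∀ j, Polynomial.aeval (X j : MvPolynomial (Fin n) R) (P j)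
      = ∑ m : Fin n, C ((P j).coeff (n - 1 - m)) * X j ^ (n - 1 - (m : ℕ)) := by
    intro j
    conv_lhs => rw [(P j).as_sum_range' n (hP j)]
    rw [map_sum, ← Finset.sum_range_reflect,
      ← Fin.sum_univ_eq_sum_range
        (fun m => Polynomial.aeval (X j) (Polynomial.monomial (n - 1 - m)
          ((P j).coeff (n - 1 - m))))]
    refine Finset.sum_congr rfl fun m _ => ?_
    rw [Polynomial.aeval_monomial]
    rfl
  simp_rw [h1]
  rw [Finset.prod_univ_sum, Fintype.piFinset_univ, map_sum, Matrix.det_apply']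
  have h2 : ∀ σ : Fin n → Fin n, topCoeff R n
      (∏ j, C ((P j).coeff (n - 1 - (σ j : ℕ))) * X j ^ (n - 1 - (σ j : ℕ)))
      = (∏ j, (P j).coeff (n - 1 - (σ j : ℕ)))
        * topCoeff R n (∏ j, X j ^ (n - 1 - (σ j : ℕ))) := by
    intro σ
    rw [Finset.prod_mul_distrib, ← map_prod, ← smul_eq_C_mul, map_smul, smul_eq_mul]
  simp_rw [h2]
  symm
  refine Finset.sum_of_injOn (fun σ : Equiv.Perm (Fin n) => (σ : Fin n → Fin n))
    (fun _ _ _ _ h => DFunLike.coe_injective h) (fun _ _ => Finset.mem_coe.mpr (Finset.mem_univ _))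
    ?_ ?_
  -- A repeated exponent makes the monomial invariant under a transposition, while `topCoeff`
  -- changes sign; in characteristic zero the value is then zero.
  · intro σ _ hσ
    have hinj : ¬ Function.Injective σ := by
      intro hinj
      exact hσ ⟨Equiv.ofBijective σ (Finite.injective_iff_bijective.mp hinj), by simp, rfl⟩
    rw [Function.not_injective_iff] at hinj
    obtain ⟨a, b, hab, hne⟩ := hinj
    have hfix : act (Equiv.swap a b) (∏ j, X j ^ (n - 1 - (σ j : ℕ)) : MvPolynomial (Fin n) R)
        = ∏ j, X j ^ (n - 1 - (σ j : ℕ)) := by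
      rw [act_prod_X_pow (Equiv.swap a b) fun j => n - 1 - (σ j : ℕ)]
      refine Finset.prod_congr rfl fun j _ => ?_
      congr 3
      rw [Equiv.swap_inv]
      rcases eq_or_ne j a with rfl | ha
      · rw [Equiv.swap_apply_left, hab]
      rcases eq_or_ne j b with rfl | hb
      · rw [Equiv.swap_apply_right, hab]
      · rw [Equiv.swap_apply_of_ne_of_ne ha hb]
    have h3 := topCoeff_act (Equiv.swap a b)
      (∏ j, X j ^ (n - 1 - (σ j : ℕ)) : MvPolynomial (Fin n) R)
    rw [hfix, Equiv.Perm.sign_swap hne] at h3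
    have h4 : topCoeff R n (∏ j, X j ^ (n - 1 - (σ j : ℕ))) = 0 := by
      simpa [self_eq_neg] using h3
    rw [h4, mul_zero]
  -- The remaining monomials are permuted staircases, and antisymmetry supplies the signs of the
  -- Leibniz expansion.
  · intro σ _
    have h3 := topCoeff_act σ⁻¹ (staircase R n)
    rw [staircase, act_prod_X_pow σ⁻¹ fun j => n - 1 - (j : ℕ)] at h3
    simp only [inv_inv] at h3
    rw [h3, ← staircase, topCoeff_staircase, mul_one, Equiv.Perm.sign_inv, mul_comm]
    rfl

end Domain

theorem map_wordDividedDifference {R R' : Type*} [CommRing R] [CommRing R'] [IsDomain R']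
    {n : ℕ} (κ : R →+* R') (l : List (Fin (n - 1))) (f : MvPolynomial (Fin n) R) :
    map κ (wordDividedDifference l f) = wordDividedDifference l (map κ f) := by
  induction l with
  | nil => rfl
  | cons i l ih =>
    simp only [wordDividedDifference, List.foldr_cons] at ih ⊢
    rw [map_simpleDividedDifference, ih]

theorem map_dividedDifference {R R' : Type*} [CommRing R] [CommRing R'] [IsDomain R']
    {n : ℕ} (κ : R →+* R') (w : Equiv.Perm (Fin n)) (f : MvPolynomial (Fin n) R) :
    map κ (dividedDifference w f) = dividedDifference w (map κ f) :=
  map_wordDividedDifference κ _ f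

end ToyGW

end

noncomputable section

namespace ToyGW

open MvPolynomial

/-! ### Polynomials as a free module over the symmetric polynomials -/

section CommRing

variable {R : Type*} [CommRing R] {n : ℕ}

/-- The ideal generated by the elementary symmetric polynomials of positive degree. -/
def symmetricIdeal (R : Type*) [CommRing R] (n : ℕ) : Ideal (MvPolynomial (Fin n) R) :=
  Ideal.span (Set.range fun i : Fin n => esymm (Fin n) R (i + 1))

theorem esymm_isHomogeneous (k : ℕ) : (esymm (Fin n) R k).IsHomogeneous k := by
  rw [esymm]
  refine IsHomogeneous.sum _ _ _ fun s hs => ?_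
  rw [Finset.mem_powersetCard] at hs
  have := IsHomogeneous.prod s (fun i => (X i : MvPolynomial (Fin n) R)) (fun _ => 1)
    fun i _ => isHomogeneous_X _ _
  simpa [hs.2] using this

theorem constantCoeff_of_mem_symmetricIdeal {f : MvPolynomial (Fin n) R}
    (h : f ∈ symmetricIdeal R n) : constantCoeff f = 0 := by
  obtain ⟨c, rfl⟩ := Ideal.mem_span_range_iff_exists_fun.mp h
  rw [map_sum]
  refine Finset.sum_eq_zero fun i _ => ?_
  rw [map_mul, constantCoeff_of_isHomogeneous (esymm_isHomogeneous _) (Nat.succ_ne_zero _),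
    mul_zero]

theorem exists_aeval_esymm {f : MvPolynomial (Fin n) R} (h : f.IsSymmetric) :
    ∃ p : MvPolynomial (Fin n) R, aeval (fun i : Fin n => esymm (Fin n) R (i + 1)) p = f := by
  obtain ⟨p, hp⟩ := esymmAlgHom_surjective R (σ := Fin n) (n := n) (by simp) ⟨f, h⟩
  exact ⟨p, by rw [← esymmAlgHom_apply, hp]⟩

theorem aeval_esymm_injective :
    Function.Injective (aeval fun i : Fin n => esymm (Fin n) R (i + 1) :
      MvPolynomial (Fin n) R →ₐ[R] MvPolynomial (Fin n) R) := by
  intro p p' h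
  apply esymmAlgHom_injective R (σ := Fin n) (n := n) (by simp)
  apply Subtype.ext
  rw [esymmAlgHom_apply, esymmAlgHom_apply]
  exact h

theorem aeval_sub_C_mem {S σ : Type*} [CommRing S] [Algebra R S] (I : Ideal S) (g : σ → S)
    (hg : ∀ i, g i ∈ I) (p : MvPolynomial σ R) :
    aeval g p - algebraMap R S (constantCoeff p) ∈ I := by
  induction p using MvPolynomial.induction_on with
  | C r => simp [algHom_C]
  | add p p' h h' =>
    have := I.add_mem h h'
    rw [map_add, map_add, map_add]
    convert this using 1
    ring
  | mul_X p i h => simpa using I.mul_mem_left _ (hg i)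

theorem sub_C_mem_symmetricIdeal {f : MvPolynomial (Fin n) R} (h : f.IsSymmetric) :
    f - C (constantCoeff f) ∈ symmetricIdeal R n := by
  obtain ⟨p, rfl⟩ := exists_aeval_esymm h
  have h1 := aeval_sub_C_mem (symmetricIdeal R n) (fun i : Fin n => esymm (Fin n) R (i + 1))
    (fun i => Ideal.subset_span ⟨i, rfl⟩) p
  have h2 := constantCoeff_of_mem_symmetricIdeal h1
  rw [map_sub, algebraMap_eq, constantCoeff_C, sub_eq_zero] at h2
  rw [h2]
  exact h1

end CommRing

section Domain

variable {R : Type*} [CommRing R] [IsDomain R] {n : ℕ}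

/-- The classical Schubert polynomial. -/
def classicalSchubert (R : Type*) [CommRing R] {n : ℕ} (w : Equiv.Perm (Fin n)) :
    MvPolynomial (Fin n) R :=
  dividedDifference (w⁻¹ * longest n) (staircase R n)

theorem inversionNumber_inv_mul_longest (w : Equiv.Perm (Fin n)) :
    inversionNumber w + inversionNumber (w⁻¹ * longest n) = inversionNumber (longest n) := by
  rw [← inversionNumber_inv w]
  exact inversionNumber_mul_longest _

theorem classicalSchubert_isHomogeneous (w : Equiv.Perm (Fin n)) :
    (classicalSchubert R w).IsHomogeneous (inversionNumber w) := by
  refine dividedDifference_isHomogeneous ?_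
  rw [inversionNumber_inv_mul_longest]
  exact staircase_isHomogeneous

/-- The composite `∂_v ∂_{w⁻¹w₀}` vanishes unless the lengths add up. Their sum is at least the
length of `w₀`, so only the product `w₀` is possible. -/
theorem dividedDifference_classicalSchubert {v w : Equiv.Perm (Fin n)}
    (h : inversionNumber w ≤ inversionNumber v) :
    dividedDifference v (classicalSchubert R w) = if v = w then 1 else 0 := by
  rw [classicalSchubert, dividedDifference_dividedDifference]
  have h1 := inversionNumber_inv_mul_longest w
  have h2 := inversionNumber_le (v * (w⁻¹ * longest n))
  by_cases hvw : v = w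
  · subst hvw
    rw [mul_inv_cancel_left, if_pos h1, if_pos rfl, dividedDifference_longest_staircase]
  · rw [if_neg hvw, if_neg]
    intro h3
    apply hvw
    have h4 := eq_longest_of_inversionNumber
      (show inversionNumber (v * (w⁻¹ * longest n)) = _ by omega)
    rwa [← mul_assoc, mul_eq_right, mul_inv_eq_one] at h4

theorem constantCoeff_dividedDifference_classicalSchubert (v w : Equiv.Perm (Fin n)) :
    constantCoeff (dividedDifference v (classicalSchubert R w)) = if v = w then 1 else 0 := by
  rcases le_or_gt (inversionNumber w) (inversionNumber v) with h | h
  · rw [dividedDifference_classicalSchubert h]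
    split_ifs <;> simp
  · rw [if_neg (by rintro rfl; exact lt_irrefl _ h)]
    refine constantCoeff_of_isHomogeneous (d := inversionNumber w - inversionNumber v)
      (dividedDifference_isHomogeneous ?_) (by omega)
    rw [Nat.sub_add_cancel h.le]
    exact classicalSchubert_isHomogeneous w

/-- If `∂_w f = 0` for all `w` of length above `k`, then each `∂_w f` with `w` of length `k` is
killed by all `∂_i`, hence symmetric. Subtracting `∑ (∂_w f) · S_w` over these `w`, with `S_w` the
classical Schubert polynomial, lowers the bound. -/
theorem exists_symmetric_combination (f : MvPolynomial (Fin n) R) :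
    ∃ c : Equiv.Perm (Fin n) → MvPolynomial (Fin n) R, (∀ w, (c w).IsSymmetric) ∧
      f = ∑ w, c w * classicalSchubert R w := by
  have key : ∀ (k : ℕ) (f : MvPolynomial (Fin n) R),
      (∀ w, k ≤ inversionNumber w → dividedDifference w f = 0) →
      ∃ c : Equiv.Perm (Fin n) → MvPolynomial (Fin n) R, (∀ w, (c w).IsSymmetric) ∧
        f = ∑ w, c w * classicalSchubert R w := by
    intro k
    induction k with
    | zero =>
      intro f hf
      refine ⟨0, fun _ => IsSymmetric.zero, ?_⟩
      have := hf 1 (Nat.zero_le _)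
      rw [dividedDifference_one] at this
      simp [this]
    | succ k ih =>
      intro f hf
      have hsym : ∀ w, inversionNumber w = k → (dividedDifference w f).IsSymmetric := by
        intro w hw
        refine isSymmetric_of_simple fun i => ?_
        rcases inversionNumber_simple_mul_cases i w with h | h
        · rw [simple_dividedDifference_of_ascent h]
          exact hf _ (by omega)
        · exact simple_dividedDifference_of_descent h f
      set c₀ : Equiv.Perm (Fin n) → MvPolynomial (Fin n) R :=
        fun w => if inversionNumber w = k then dividedDifference w f else 0 with hc₀
      have hc₀s : ∀ w, (c₀ w).IsSymmetric := by
        intro w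
        simp only [hc₀]
        split_ifs with h
        · exact hsym w h
        · exact IsSymmetric.zero
      obtain ⟨c, hc, hfc⟩ := ih (f - ∑ w, c₀ w * classicalSchubert R w) (by
        intro v hv
        rw [dividedDifference_sub, dividedDifference_sum, sub_eq_zero]
        rw [Finset.sum_eq_single v]
        · rw [dividedDifference_mul (hc₀s v), dividedDifference_classicalSchubert le_rfl,
            if_pos rfl, mul_one]
          simp only [hc₀]
          split_ifs with h
          · rfl
          · exact hf v (by omega)
        · intro w _ hwv
          rw [dividedDifference_mul (hc₀s w)]
          by_cases h : inversionNumber w = k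
          · rw [dividedDifference_classicalSchubert (by omega), if_neg (Ne.symm hwv), mul_zero]
          · simp [hc₀, h]
        · simp)
      refine ⟨fun w => c w + c₀ w, fun w => (hc w).add (hc₀s w), ?_⟩
      simp only [add_mul, Finset.sum_add_distrib]
      rw [← hfc, sub_add_cancel]
  refine key (inversionNumber (longest n) + 1) f fun w hw => ?_
  have := inversionNumber_le w
  omega

/-- Applying `∂_v`, starting from the longest `v`, isolates the coefficient `c v`. -/
theorem eq_zero_of_symmetric_combination {c : Equiv.Perm (Fin n) → MvPolynomial (Fin n) R}
    (hc : ∀ w, (c w).IsSymmetric) (h : ∑ w, c w * classicalSchubert R w = 0) : c = 0 := by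
  have key : ∀ (k : ℕ) (w : Equiv.Perm (Fin n)),
      inversionNumber (longest n) ≤ inversionNumber w + k → c w = 0 := by
    intro k
    induction k using Nat.strong_induction_on with
    | _ k ih =>
    intro v hv
    have h1 := congrArg (dividedDifference v) h
    rw [dividedDifference_sum, ← dividedDifferenceₗ_apply v 0, map_zero,
      Finset.sum_eq_single v] at h1
    · rwa [dividedDifference_mul (hc v), dividedDifference_classicalSchubert le_rfl, if_pos rfl,
        mul_one] at h1
    · intro w _ hwv
      rcases le_or_gt (inversionNumber w) (inversionNumber v) with h2 | h2
      · rw [dividedDifference_mul (hc w), dividedDifference_classicalSchubert h2,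
          if_neg (Ne.symm hwv), mul_zero]
      · have hle := inversionNumber_le w
        rw [ih (inversionNumber (longest n) - inversionNumber w) (by omega) w (by omega),
          zero_mul, ← dividedDifferenceₗ_apply, map_zero]
    · simp
  funext w
  exact key _ w (Nat.le_add_left _ _)

theorem constantCoeff_dividedDifference_of_mem {f : MvPolynomial (Fin n) R}
    (h : f ∈ symmetricIdeal R n) (w : Equiv.Perm (Fin n)) :
    constantCoeff (dividedDifference w f) = 0 := by
  obtain ⟨c, rfl⟩ := Ideal.mem_span_range_iff_exists_fun.mp h
  rw [dividedDifference_sum, map_sum]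
  refine Finset.sum_eq_zero fun i _ => ?_
  rw [mul_comm, dividedDifference_mul (esymm_isSymmetric _ _ _), map_mul,
    constantCoeff_of_isHomogeneous (esymm_isHomogeneous _) (Nat.succ_ne_zero _), zero_mul]

theorem topCoeff_of_mem {f : MvPolynomial (Fin n) R} (h : f ∈ symmetricIdeal R n) :
    topCoeff R n f = 0 :=
  constantCoeff_dividedDifference_of_mem h _

/-- Newton's interpolation modulo symmetric polynomials of positive degree. -/
theorem sub_sum_mem_symmetricIdeal (f : MvPolynomial (Fin n) R) :
    f - ∑ w, C (constantCoeff (dividedDifference w f)) * classicalSchubert R w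
      ∈ symmetricIdeal R n := by
  obtain ⟨c, hc, hf⟩ := exists_symmetric_combination f
  have h1 : ∀ v, constantCoeff (dividedDifference v f) = constantCoeff (c v) := by
    intro v
    rw [hf, dividedDifference_sum, map_sum, Finset.sum_eq_single v]
    · rw [dividedDifference_mul (hc v), map_mul,
        constantCoeff_dividedDifference_classicalSchubert, if_pos rfl, mul_one]
    · intro w _ hwv
      rw [dividedDifference_mul (hc w), map_mul,
        constantCoeff_dividedDifference_classicalSchubert, if_neg (Ne.symm hwv), mul_zero]
    · simp
  simp_rw [h1]
  rw [hf, ← Finset.sum_sub_distrib]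
  refine Ideal.sum_mem _ fun w _ => ?_
  rw [← sub_mul]
  exact Ideal.mul_mem_right _ _ (sub_C_mem_symmetricIdeal (hc w))

/-- Adjunction moves the divided difference to `f` and leaves the staircase. This turns a pairing
with a Schubert polynomial into an interpolation coefficient. -/
theorem topCoeff_classicalSchubert_mul (w : Equiv.Perm (Fin n)) (f : MvPolynomial (Fin n) R) :
    topCoeff R n (classicalSchubert R w * f)
      = constantCoeff (dividedDifference (longest n * w) f) := by
  rw [classicalSchubert, topCoeff_dividedDifference_mul, topCoeff_staircase_mul, mul_inv_rev,
    inv_inv, longest_inv]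

theorem topCoeff_classicalSchubert (w : Equiv.Perm (Fin n)) :
    topCoeff R n (classicalSchubert R w) = if w = longest n then 1 else 0 := by
  rw [topCoeff_apply, constantCoeff_dividedDifference_classicalSchubert]
  simp [eq_comm]

end Domain

end ToyGW

end

noncomputable section

namespace ToyGW

open MvPolynomial

/-! ### Continuants -/

section Continuant

variable {S : Type*} [CommRing S] (x q : ℕ → S) (t : S)

@[simp] theorem quantumDelta_zero : quantumDelta x q 0 t = 1 := by
  simp [quantumDelta]

@[simp] theorem quantumDelta_one : quantumDelta x q 1 t = x 0 + t := by
  simp [quantumDelta]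

/-- Laplace expansion along the last row. The entry `-1` cancels the sign of its cofactor, and its
minor has `q k` as the only nonzero entry of the last column. -/
theorem quantumDelta_add_two (k : ℕ) :
    quantumDelta x q (k + 2) t
      = (x (k + 1) + t) * quantumDelta x q (k + 1) t + q k * quantumDelta x q k t := by
  set A : Matrix (Fin (k + 2)) (Fin (k + 2)) S := Matrix.of fun i j =>
    if i = j then x i + t else if (j : ℕ) = i + 1 then q i
    else if (i : ℕ) = j + 1 then -1 else 0 with hA
  change A.det = _
  have hlast : ∀ j : Fin (k + 2), A (Fin.last (k + 1)) j
      = if (j : ℕ) = k + 1 then x (k + 1) + t else if (j : ℕ) = k then -1 else 0 := by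
    intro j
    have := j.2
    simp only [hA, Matrix.of_apply, Fin.ext_iff, Fin.val_last]
    split_ifs <;> first | rfl | omega
  rw [Matrix.det_succ_row A (Fin.last (k + 1)), Fin.sum_univ_castSucc, Fin.sum_univ_castSucc]
  rw [Finset.sum_eq_zero]
  · have e1 : A.submatrix (Fin.last (k + 1)).succAbove (Fin.last (k + 1)).succAbove
        = Matrix.of fun i j : Fin (k + 1) => if i = j then x i + t
          else if (j : ℕ) = i + 1 then q i else if (i : ℕ) = j + 1 then -1 else 0 := by
      ext i j
      simp [hA, Fin.ext_iff]
    have e2 : (A.submatrix (Fin.last (k + 1)).succAbove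
        (Fin.last k).castSucc.succAbove).det = q k * quantumDelta x q k t := by
      have hval : ∀ j : Fin (k + 1), (((Fin.last k).castSucc.succAbove j : Fin (k + 2)) : ℕ)
          = if (j : ℕ) < k then (j : ℕ) else k + 1 := by
        intro j
        have := j.2
        split_ifs with h
        · rw [Fin.succAbove_of_castSucc_lt _ _ (by simpa [Fin.lt_def] using h)]; rfl
        · rw [Fin.succAbove_of_le_castSucc _ _ (by simp [Fin.le_def]; omega)]
          simp; omega
      rw [Matrix.det_succ_column _ (Fin.last k), Fin.sum_univ_castSucc, Finset.sum_eq_zero]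
      · have e3 : ((A.submatrix (Fin.last (k + 1)).succAbove
            (Fin.last k).castSucc.succAbove).submatrix (Fin.last k).succAbove
            (Fin.last k).succAbove) = Matrix.of fun i j : Fin k => if i = j then x i + t
              else if (j : ℕ) = i + 1 then q i else if (i : ℕ) = j + 1 then -1 else 0 := by
          ext i j
          simp [hA, Fin.ext_iff]
        rw [e3]
        simp only [Matrix.submatrix_apply, hA, Matrix.of_apply, Fin.ext_iff, hval]
        simp [quantumDelta, Fin.ext_iff]
      · intro i _
        have := i.2
        simp only [Matrix.submatrix_apply, hA, Matrix.of_apply, Fin.ext_iff, hval]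
        simp only [Fin.val_castSucc, Fin.val_last, Fin.succAbove_last]
        rw [if_neg (lt_irrefl k), if_neg (by omega), if_neg (by omega), if_neg (by omega)]
        simp
    rw [e1, e2, hlast, hlast]
    simp only [Fin.val_last, Fin.val_castSucc, if_true, zero_add]
    rw [if_neg (by omega)]
    rw [show k + 1 + k = 2 * k + 1 by ring, show k + 1 + (k + 1) = 2 * (k + 1) by ring,
      pow_succ, pow_mul, pow_mul]
    simp [quantumDelta]
    ring
  · intro j _
    rw [hlast]
    have := j.2
    simp only [Fin.val_castSucc]
    rw [if_neg (by omega), if_neg (by omega)]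
    simp

end Continuant

end ToyGW

end

noncomputable section

namespace ToyGW

open MvPolynomial

/-! ### Deformations of homogeneous bases -/

section Degree

variable {R : Type*} [CommRing R] {σ : Type*}

/-- Polynomials all of whose monomials have degree less than `d`. -/
def degreeLT (R : Type*) [CommRing R] (σ : Type*) (d : ℕ) : Submodule R (MvPolynomial σ R) where
  carrier := {f | ∀ m : σ →₀ ℕ, d ≤ m.degree → coeff m f = 0}
  add_mem' hf hg m hm := by rw [coeff_add, hf m hm, hg m hm, add_zero]
  zero_mem' m _ := coeff_zero m
  smul_mem' r f hf m hm := by rw [coeff_smul, hf m hm, smul_zero]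

theorem degreeLT_mono {a b : ℕ} (h : a ≤ b) : degreeLT R σ a ≤ degreeLT R σ b :=
  fun _ hf m hm => hf m (h.trans hm)

theorem mem_degreeLT_zero {f : MvPolynomial σ R} (h : f ∈ degreeLT R σ 0) : f = 0 :=
  MvPolynomial.ext _ _ fun m => by rw [h m (Nat.zero_le _), coeff_zero]

/-- The asymmetric bounds (below `a`, at most `b`) keep the claim sharp and include the case `a =
0`, where `f` vanishes. -/
theorem mul_mem_degreeLT {a b : ℕ} {f g : MvPolynomial σ R} (hf : f ∈ degreeLT R σ a)
    (hg : g ∈ degreeLT R σ (b + 1)) : f * g ∈ degreeLT R σ (a + b) := by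
  classical
  intro m hm
  rw [coeff_mul]
  refine Finset.sum_eq_zero fun p hp => ?_
  rw [Finset.HasAntidiagonal.mem_antidiagonal] at hp
  have hdeg : p.1.degree + p.2.degree = m.degree := by rw [← hp, map_add]
  rcases le_or_gt a p.1.degree with h | h
  · rw [hf _ h, zero_mul]
  · rw [hg _ (by omega), mul_zero]

theorem mem_degreeLT_of_isHomogeneous {d : ℕ} {f : MvPolynomial σ R} (h : f.IsHomogeneous d) :
    f ∈ degreeLT R σ (d + 1) :=
  fun m hm => h.coeff_eq_zero (by omega)

theorem exists_mem_degreeLT (f : MvPolynomial σ R) : ∃ d, f ∈ degreeLT R σ d := by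
  refine ⟨f.totalDegree + 1, fun m hm => coeff_eq_zero_of_totalDegree_lt ?_⟩
  rwa [Nat.lt_iff_add_one_le, ← Finsupp.degree_apply]

/-- `g` is the sum of the homogeneous polynomial `f` of degree `d` and of terms of degree less
than `d`. -/
def HasTopForm (d : ℕ) (f g : MvPolynomial σ R) : Prop :=
  f.IsHomogeneous d ∧ g - f ∈ degreeLT R σ d

namespace HasTopForm

variable {a b : ℕ} {f f' g g' : MvPolynomial σ R}

theorem mem (h : HasTopForm a f f') : f' ∈ degreeLT R σ (a + 1) := by
  have := (degreeLT R σ (a + 1)).add_mem (degreeLT_mono (Nat.le_succ a) h.2)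
    (mem_degreeLT_of_isHomogeneous h.1)
  rwa [sub_add_cancel] at this

theorem refl (h : f.IsHomogeneous a) : HasTopForm a f f :=
  ⟨h, by rw [sub_self]; exact zero_mem _⟩

theorem mul (hf : HasTopForm a f f') (hg : HasTopForm b g g') :
    HasTopForm (a + b) (f * g) (f' * g') := by
  refine ⟨hf.1.mul hg.1, ?_⟩
  have h1 := mul_mem_degreeLT hf.2 hg.mem
  have h2 := mul_mem_degreeLT hg.2 (mem_degreeLT_of_isHomogeneous hf.1)
  rw [add_comm] at h2
  convert (degreeLT R σ (a + b)).add_mem h1 h2 using 1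
  ring

theorem pow (hf : HasTopForm a f f') (k : ℕ) : HasTopForm (k * a) (f ^ k) (f' ^ k) := by
  induction k with
  | zero => simpa using refl (isHomogeneous_one σ R)
  | succ k ih =>
    rw [pow_succ, pow_succ, Nat.succ_mul]
    exact ih.mul hf

theorem prod {ι : Type*} (s : Finset ι) {d : ι → ℕ} {f f' : ι → MvPolynomial σ R}
    (h : ∀ i ∈ s, HasTopForm (d i) (f i) (f' i)) :
    HasTopForm (∑ i ∈ s, d i) (∏ i ∈ s, f i) (∏ i ∈ s, f' i) := by
  classical
  induction s using Finset.induction_on with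
  | empty => simpa using refl (isHomogeneous_one σ R)
  | insert i s hi ih =>
    rw [Finset.sum_insert hi, Finset.prod_insert hi, Finset.prod_insert hi]
    exact (h i (Finset.mem_insert_self i s)).mul
      (ih fun j hj => h j (Finset.mem_insert_of_mem hj))

variable {ι : Type*} {d : ι → ℕ} {E E' : ι → MvPolynomial σ R}

/-- Expand in the homogeneous family and replace each `E i` by `E' i`. The error has smaller degree
and is absorbed by induction. -/
theorem degreeLT_le_span (h : ∀ i, HasTopForm (d i) (E i) (E' i))
    (hs : Submodule.span R (Set.range E) = ⊤) (k : ℕ) :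
    degreeLT R σ k ≤ Submodule.span R (E' '' {i | d i < k}) := by
  induction k with
  | zero => intro f hf; rw [mem_degreeLT_zero hf]; exact zero_mem _
  | succ k ih =>
    intro f hf
    obtain ⟨c, hc⟩ := Finsupp.mem_span_range_iff_exists_finsupp.mp
      (show f ∈ Submodule.span R (Set.range E) by rw [hs]; trivial)
    -- Members of degree above `k` do not contribute to the components of degree at most `k`, and
    -- `f` has no others.
    have h1 : f = ∑ i ∈ c.support with d i ≤ k, c i • E i := by
      ext m
      rw [coeff_sum]
      rcases le_or_gt m.degree k with hm | hm
      · rw [← hc, Finsupp.sum, coeff_sum, Finset.sum_filter]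
        refine Finset.sum_congr rfl fun i _ => ?_
        split_ifs with hi
        · rfl
        · rw [coeff_smul, (h i).1.coeff_eq_zero (by omega), smul_zero]
      · rw [hf m (by omega)]
        symm
        refine Finset.sum_eq_zero fun i hi => ?_
        rw [Finset.mem_filter] at hi
        rw [coeff_smul, (h i).1.coeff_eq_zero (by omega), smul_zero]
    have h2 : f = ∑ i ∈ c.support with d i ≤ k, c i • E' i
        - ∑ i ∈ c.support with d i ≤ k, c i • (E' i - E i) := by
      rw [← Finset.sum_sub_distrib]
      conv_lhs => rw [h1]
      refine Finset.sum_congr rfl fun i _ => ?_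
      rw [← smul_sub, sub_sub_cancel]
    rw [h2]
    refine sub_mem (sum_mem fun i hi => Submodule.smul_mem _ _ (Submodule.subset_span ?_))
      (Submodule.span_mono ?_ (ih (sum_mem fun i hi => Submodule.smul_mem _ _ ?_)))
    · exact ⟨i, Nat.lt_succ_of_le (Finset.mem_filter.mp hi).2, rfl⟩
    · exact Set.image_mono fun i hi => Nat.lt_succ_of_lt hi
    · exact degreeLT_mono (Finset.mem_filter.mp hi).2 (h i).2

theorem span_eq_top (h : ∀ i, HasTopForm (d i) (E i) (E' i))
    (hs : Submodule.span R (Set.range E) = ⊤) : Submodule.span R (Set.range E') = ⊤ := by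
  rw [eq_top_iff]
  intro f _
  obtain ⟨k, hk⟩ := exists_mem_degreeLT f
  exact Submodule.span_mono (Set.image_subset_range _ _) (degreeLT_le_span h hs k hk)

/-- The part of highest degree of a relation among the `E' i` is a relation among the homogeneous `E
i`, so the coefficients of highest degree vanish. -/
theorem linearIndependent (h : ∀ i, HasTopForm (d i) (E i) (E' i))
    (hl : LinearIndependent R E) : LinearIndependent R E' := by
  rw [linearIndependent_iff] at hl ⊢
  intro c hc
  have key : ∀ k, (∀ i ∈ c.support, d i < k) → c = 0 := by
    intro k
    induction k with
    | zero =>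
      intro hk
      rw [← Finsupp.support_eq_empty, Finset.eq_empty_iff_forall_notMem]
      exact fun i hi => absurd (hk i hi) (Nat.not_lt_zero _)
    | succ k ih =>
      intro hk
      apply ih
      intro i hi
      refine lt_of_le_of_ne (Nat.lt_succ_iff.mp (hk i hi)) fun hdi => ?_
      have h0 := hl (c.filter fun i => d i = k) (by
        ext m
        rw [Finsupp.linearCombination_apply, Finsupp.sum, coeff_sum, coeff_zero,
          Finsupp.support_filter]
        by_cases hm : m.degree = k
        · have h1 := congrArg (coeff m) hc
          rw [Finsupp.linearCombination_apply, Finsupp.sum, coeff_sum, coeff_zero] at h1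
          rw [← h1, Finset.sum_filter]
          refine Finset.sum_congr rfl fun j hj => ?_
          split_ifs with hj'
          · rw [Finsupp.filter_apply_pos (fun i => d i = k) _ hj', coeff_smul, coeff_smul]
            have h2 := (h j).2 m (by omega)
            rw [coeff_sub, sub_eq_zero] at h2
            rw [h2]
          · have h3 := hk j hj
            rw [coeff_smul, (h j).mem m (by omega), smul_zero]
        · refine Finset.sum_eq_zero fun j hj => ?_
          rw [Finset.mem_filter] at hj
          rw [coeff_smul, (h j).1.coeff_eq_zero (by omega), smul_zero])
      have h4 := DFunLike.congr_fun h0 i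
      rw [Finsupp.filter_apply_pos (fun i => d i = k) _ hdi, Finsupp.coe_zero, Pi.zero_apply] at h4
      exact Finsupp.mem_support_iff.mp hi h4
  refine key (c.support.sup d + 1) fun i hi => ?_
  exact Nat.lt_succ_of_le (Finset.le_sup hi)

end HasTopForm

end Degree

/-! ### The top form of the quantum elementary symmetric polynomials -/

section Elementary

variable {R : Type*} [CommRing R] {n : ℕ}

/-- The coefficient of `t ^ m` has degree less than `d` as soon as `c ≤ m + d`. -/
def CoeffDegreeLT (c : ℕ) (P : Polynomial (MvPolynomial (Fin n) R)) : Prop :=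
  ∀ m d, c ≤ m + d → P.coeff m ∈ degreeLT R (Fin n) d

namespace CoeffDegreeLT

variable {c : ℕ} {P Q : Polynomial (MvPolynomial (Fin n) R)}

theorem mono {c' : ℕ} (h : CoeffDegreeLT c P) (hc : c ≤ c') : CoeffDegreeLT c' P :=
  fun m d hm => h m d (hc.trans hm)

theorem add (hP : CoeffDegreeLT c P) (hQ : CoeffDegreeLT c Q) : CoeffDegreeLT c (P + Q) := by
  intro m d hm
  rw [Polynomial.coeff_add]
  exact add_mem (hP m d hm) (hQ m d hm)

theorem C_C_mul (h : CoeffDegreeLT c P) (r : R) :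
    CoeffDegreeLT c (Polynomial.C (C r) * P) := by
  intro m d hm
  rw [Polynomial.coeff_C_mul, ← smul_eq_C_mul]
  exact Submodule.smul_mem _ _ (h m d hm)

theorem X_add_X_mul (h : CoeffDegreeLT c P) (i : Fin n) :
    CoeffDegreeLT (c + 1) ((Polynomial.C (X i) + Polynomial.X) * P) := by
  intro m d hm
  rw [add_mul, Polynomial.coeff_add, Polynomial.coeff_C_mul]
  refine add_mem ?_ ?_
  · rcases d with _ | d
    · rw [mem_degreeLT_zero (h m 0 (by omega)), mul_zero]
      exact zero_mem _
    · rw [mul_comm]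
      exact mul_mem_degreeLT (h m d (by omega))
        (mem_degreeLT_of_isHomogeneous (isHomogeneous_X R i))
  · rcases m with _ | m
    · rw [Polynomial.coeff_X_mul_zero]
      exact zero_mem _
    · rw [Polynomial.coeff_X_mul]
      exact h m d (by omega)

end CoeffDegreeLT

/-- The Givental--Kim determinant as a polynomial in its parameter. -/
abbrev deltaPoly (q : Fin (n - 1) → R) (k : ℕ) : Polynomial (MvPolynomial (Fin n) R) :=
  quantumDelta (extend fun j : Fin n => Polynomial.C (X j))
    (extend fun j => Polynomial.C (C (q j))) k Polynomial.X

/-- With `x` and `t` in degree one and `q` in degree zero, `Δ_k` has total degree at most `k`. The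
term with `q` in the recurrence loses two degrees, so it does not affect the top form, the product
of the factors `t + x_j`. -/
theorem coeffDegreeLT_deltaPoly (q : Fin (n - 1) → R) (k : ℕ) (hk : k ≤ n) :
    CoeffDegreeLT (k + 1) (deltaPoly q k) ∧
      CoeffDegreeLT k (deltaPoly q k - ∏ j ∈ Finset.range k,
        (Polynomial.X + extend (fun j : Fin n => Polynomial.C (X j)) j)) := by
  induction k using Nat.strong_induction_on with
  | _ k ih =>
  match k with
  | 0 =>
    refine ⟨fun m d hm => ?_, fun m d _ => ?_⟩
    · rw [deltaPoly, quantumDelta_zero, Polynomial.coeff_one]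
      split_ifs with h
      · exact degreeLT_mono (by omega)
          (mem_degreeLT_of_isHomogeneous (isHomogeneous_one (Fin n) R))
      · exact zero_mem _
    · rw [deltaPoly, quantumDelta_zero, Finset.prod_range_zero, sub_self,
        Polynomial.coeff_zero]
      exact zero_mem _
  | 1 =>
    have h0 : extend (fun j : Fin n => Polynomial.C (X j : MvPolynomial (Fin n) R)) 0
        = Polynomial.C (X ⟨0, by omega⟩) := by rw [extend, dif_pos (by omega)]
    refine ⟨?_, fun m d _ => ?_⟩
    · have h1 := (ih 0 (by omega) (by omega)).1.X_add_X_mul ⟨0, by omega⟩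
      rw [deltaPoly, quantumDelta_zero, mul_one] at h1
      rw [deltaPoly, quantumDelta_one, h0]
      exact h1
    · rw [deltaPoly, quantumDelta_one, Finset.prod_range_one, add_comm, sub_self,
        Polynomial.coeff_zero]
      exact zero_mem _
  | k + 2 =>
    obtain ⟨h1, h2⟩ := ih (k + 1) (by omega) (by omega)
    obtain ⟨h3, -⟩ := ih k (by omega) (by omega)
    have hx : extend (fun j : Fin n => Polynomial.C (X j : MvPolynomial (Fin n) R)) (k + 1)
        = Polynomial.C (X ⟨k + 1, by omega⟩) := by rw [extend, dif_pos (by omega)]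
    have hq : extend (fun j => Polynomial.C (C (q j) : MvPolynomial (Fin n) R)) k
        = Polynomial.C (C (q ⟨k, by omega⟩)) := by rw [extend, dif_pos (by omega)]
    constructor
    · rw [deltaPoly, quantumDelta_add_two, hx, hq]
      exact (h1.X_add_X_mul _).add ((h3.C_C_mul _).mono (by omega))
    · rw [Finset.prod_range_succ, deltaPoly, quantumDelta_add_two, hx, hq]
      have := (h2.X_add_X_mul ⟨k + 1, by omega⟩).add
        ((h3.C_C_mul (q ⟨k, by omega⟩)).mono (Nat.le_succ _))
      convert this using 1
      ring

theorem quantumElementary_hasTopForm (q : Fin (n - 1) → R) (i : Fin n) :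
    HasTopForm (i + 1) (esymm (Fin n) R (i + 1)) (quantumElementary q i) := by
  refine ⟨esymm_isHomogeneous _, ?_⟩
  have h1 := (coeffDegreeLT_deltaPoly q n le_rfl).2 (n - (i + 1)) (i + 1) (by omega)
  rw [Polynomial.coeff_sub, ← Fin.prod_univ_eq_prod_range
    (fun j => Polynomial.X + extend (fun j : Fin n => Polynomial.C (X j)) j) n] at h1
  have h2 : ∀ j : Fin n, extend (fun j : Fin n => Polynomial.C (X j : MvPolynomial (Fin n) R)) j
      = Polynomial.C (X j) := by
    intro j
    rw [extend, dif_pos j.2]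
  simp_rw [h2] at h1
  rw [MvPolynomial.prod_X_add_C_coeff _ _ _ (by simp), Fintype.card_fin,
    show n - (n - ((i : ℕ) + 1)) = i + 1 by omega] at h1
  exact h1

end Elementary

/-! ### Polynomials modulo the quantum ideal -/

section Combination

variable {R : Type*} [CommRing R] {n : ℕ}

/-- The combination of classical Schubert polynomials whose coefficients are polynomials
in `g`. -/
def schubertCombination (g : Fin n → MvPolynomial (Fin n) R) :
    (Equiv.Perm (Fin n) → MvPolynomial (Fin n) R) →ₗ[R] MvPolynomial (Fin n) R :=
  ∑ w, (LinearMap.mulRight R (classicalSchubert R w)) ∘ₗ (aeval g).toLinearMap ∘ₗ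
    LinearMap.proj w

theorem schubertCombination_apply (g : Fin n → MvPolynomial (Fin n) R)
    (p : Equiv.Perm (Fin n) → MvPolynomial (Fin n) R) :
    schubertCombination g p = ∑ w, aeval g (p w) * classicalSchubert R w := by
  simp [schubertCombination]

theorem schubertCombination_single (g : Fin n → MvPolynomial (Fin n) R)
    (w : Equiv.Perm (Fin n)) (p : MvPolynomial (Fin n) R) :
    schubertCombination g (Pi.single w p) = aeval g p * classicalSchubert R w := by
  rw [schubertCombination_apply, Finset.sum_eq_single w]
  · rw [Pi.single_eq_same]
  · intro v _ hv
    rw [Pi.single_eq_of_ne hv, map_zero, zero_mul]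
  · simp

/-- The products of monomials in `g` and classical Schubert polynomials. -/
def schubertMonomial (g : Fin n → MvPolynomial (Fin n) R)
    (s : Σ _ : Equiv.Perm (Fin n), Fin n →₀ ℕ) : MvPolynomial (Fin n) R :=
  (∏ i, g i ^ s.2 i) * classicalSchubert R s.1

theorem schubertMonomial_eq (g : Fin n → MvPolynomial (Fin n) R) :
    schubertMonomial g = schubertCombination g ∘ Pi.basis fun _ => basisMonomials (Fin n) R := by
  funext s
  rw [Function.comp_apply, Pi.basis_apply, schubertCombination_single, coe_basisMonomials,
    aeval_monomial, map_one, one_mul, Finsupp.prod_fintype _ _ (fun i => pow_zero _)]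
  rfl

theorem schubertMonomial_zero (g : Fin n → MvPolynomial (Fin n) R) (w : Equiv.Perm (Fin n)) :
    schubertMonomial g ⟨w, 0⟩ = classicalSchubert R w := by
  simp [schubertMonomial]

end Combination

section Domain

variable {R : Type*} [CommRing R] [IsDomain R] {n : ℕ}

/-- Combines the freeness over symmetric polynomials with the algebraic independence of the
elementary symmetric polynomials. -/
theorem schubertMonomial_esymm_linearIndependent :
    LinearIndependent R (schubertMonomial fun i : Fin n => esymm (Fin n) R (i + 1)) := by
  rw [schubertMonomial_eq]
  refine (Module.Basis.linearIndependent _).map' _ ?_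
  rw [LinearMap.ker_eq_bot']
  intro p hp
  rw [schubertCombination_apply] at hp
  have h := eq_zero_of_symmetric_combination (fun w => by
    rw [← esymmAlgHom_apply]; exact (esymmAlgHom (Fin n) R n (p w)).2) hp
  funext w
  apply aeval_esymm_injective
  rw [Pi.zero_apply, map_zero]
  exact congrFun h w

theorem schubertMonomial_esymm_span :
    Submodule.span R (Set.range (schubertMonomial fun i : Fin n => esymm (Fin n) R (i + 1)))
      = ⊤ := by
  rw [schubertMonomial_eq, Set.range_comp, Submodule.span_image, Module.Basis.span_eq,
    Submodule.map_top, LinearMap.range_eq_top]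
  intro f
  obtain ⟨c, hc, hf⟩ := exists_symmetric_combination f
  choose p hp using fun w => exists_aeval_esymm (hc w)
  refine ⟨p, ?_⟩
  rw [schubertCombination_apply, hf]
  simp_rw [hp]

theorem schubertMonomial_hasTopForm (q : Fin (n - 1) → R)
    (s : Σ _ : Equiv.Perm (Fin n), Fin n →₀ ℕ) :
    HasTopForm (∑ i : Fin n, s.2 i * ((i : ℕ) + 1) + inversionNumber s.1)
      (schubertMonomial (fun i : Fin n => esymm (Fin n) R (i + 1)) s)
      (schubertMonomial (quantumElementary q) s) :=
  (HasTopForm.prod _ fun i _ => (quantumElementary_hasTopForm q i).pow _).mul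
    (HasTopForm.refl (classicalSchubert_isHomogeneous _))

/-- The basis of the polynomial ring made of the products of monomials in the quantum elementary
symmetric polynomials and of classical Schubert polynomials. -/
def schubertMonomialBasis (q : Fin (n - 1) → R) :
    Module.Basis (Σ _ : Equiv.Perm (Fin n), Fin n →₀ ℕ) R (MvPolynomial (Fin n) R) :=
  Module.Basis.mk
    (HasTopForm.linearIndependent (schubertMonomial_hasTopForm q)
      schubertMonomial_esymm_linearIndependent)
    (HasTopForm.span_eq_top (schubertMonomial_hasTopForm q) schubertMonomial_esymm_span).ge

@[simp] theorem schubertMonomialBasis_apply (q : Fin (n - 1) → R)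
    (s : Σ _ : Equiv.Perm (Fin n), Fin n →₀ ℕ) :
    schubertMonomialBasis q s = schubertMonomial (quantumElementary q) s :=
  Module.Basis.mk_apply _ _ s

/-- The coordinates modulo the quantum ideal in the basis of classical Schubert polynomials. -/
def classicalCoord (q : Fin (n - 1) → R) (w : Equiv.Perm (Fin n)) :
    MvPolynomial (Fin n) R →ₗ[R] R :=
  (schubertMonomialBasis q).coord ⟨w, 0⟩

theorem classicalCoord_schubertMonomial (q : Fin (n - 1) → R) (v : Equiv.Perm (Fin n))
    (s : Σ _ : Equiv.Perm (Fin n), Fin n →₀ ℕ) :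
    classicalCoord q v (schubertMonomial (quantumElementary q) s)
      = if s = ⟨v, 0⟩ then 1 else 0 := by
  rw [classicalCoord, Module.Basis.coord_apply, ← schubertMonomialBasis_apply,
    Module.Basis.repr_self, Finsupp.single_apply]

theorem classicalCoord_classicalSchubert (q : Fin (n - 1) → R) (v w : Equiv.Perm (Fin n)) :
    classicalCoord q v (classicalSchubert R w) = if v = w then 1 else 0 := by
  rw [← schubertMonomial_zero (quantumElementary q), classicalCoord_schubertMonomial]
  simp [eq_comm]

/-- Multiplication by a generator `ẽ_i` permutes basis elements into basis elements with exponent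
vector different from `0`, where the coordinate vanishes. -/
theorem classicalCoord_of_mem (q : Fin (n - 1) → R) (v : Equiv.Perm (Fin n))
    {f : MvPolynomial (Fin n) R} (h : f ∈ quantumIdeal q) : classicalCoord q v f = 0 := by
  obtain ⟨c, rfl⟩ := Ideal.mem_span_range_iff_exists_fun.mp h
  rw [map_sum]
  refine Finset.sum_eq_zero fun i _ => ?_
  have h1 : classicalCoord q v ∘ₗ LinearMap.mulRight R (quantumElementary q i) = 0 := by
    refine (schubertMonomialBasis q).ext fun s => ?_
    rw [LinearMap.comp_apply, LinearMap.mulRight_apply, schubertMonomialBasis_apply]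
    have h2 : schubertMonomial (quantumElementary q) s * quantumElementary q i
        = schubertMonomial (quantumElementary q) ⟨s.1, s.2 + Finsupp.single i 1⟩ := by
      simp only [schubertMonomial, Finsupp.add_apply, pow_add, Finset.prod_mul_distrib]
      rw [Finset.prod_eq_single (f := fun j => quantumElementary q j ^
        (Finsupp.single i 1 : Fin n →₀ ℕ) j) i]
      · simp; ring
      · intro j _ hj
        rw [Finsupp.single_eq_of_ne hj, pow_zero]
      · simp
    rw [h2, classicalCoord_schubertMonomial, if_neg, LinearMap.zero_apply]
    intro h3
    have h4 := DFunLike.congr_fun (eq_of_heq (Sigma.mk.inj h3).2) i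
    simp at h4
  exact DFunLike.congr_fun h1 (c i)

/-- A basis element with a nonzero exponent vector is divisible by some `ẽ_i`, so only classical
Schubert polynomials survive modulo the ideal. -/
theorem sub_sum_classicalCoord_mem (q : Fin (n - 1) → R) (f : MvPolynomial (Fin n) R) :
    f - ∑ w, C (classicalCoord q w f) * classicalSchubert R w ∈ quantumIdeal q := by
  set L : MvPolynomial (Fin n) R →ₗ[R] MvPolynomial (Fin n) R :=
    LinearMap.id - ∑ w, (classicalCoord q w).smulRight (classicalSchubert R w) with hL
  have hLf : L f = f - ∑ w, C (classicalCoord q w f) * classicalSchubert R w := by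
    simp [hL, smul_eq_C_mul]
  rw [← hLf]
  suffices h : (⊤ : Submodule R (MvPolynomial (Fin n) R))
      ≤ ((quantumIdeal q).restrictScalars R).comap L from h trivial
  rw [← (schubertMonomialBasis q).span_eq, Submodule.span_le]
  rintro _ ⟨⟨w, J⟩, rfl⟩
  rw [SetLike.mem_coe, Submodule.mem_comap, Submodule.restrictScalars_mem,
    schubertMonomialBasis_apply]
  simp only [hL, LinearMap.sub_apply, LinearMap.id_apply, LinearMap.sum_apply,
    LinearMap.smulRight_apply, classicalCoord_schubertMonomial]
  by_cases hJ : J = 0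
  · subst hJ
    rw [Finset.sum_eq_single w]
    · rw [if_pos rfl, one_smul, schubertMonomial_zero, sub_self]
      exact zero_mem _
    · intro v _ hv
      rw [if_neg (by simpa using hv.symm), zero_smul]
    · simp
  · rw [Finset.sum_eq_zero, sub_zero]
    · obtain ⟨i, hi⟩ := DFunLike.ne_iff.mp hJ
      rw [schubertMonomial]
      refine Ideal.mul_mem_right _ _ (Ideal.mem_of_dvd _ ?_
        (Ideal.subset_span ⟨i, rfl⟩ : quantumElementary q i ∈ quantumIdeal q))
      exact (dvd_pow_self _ hi).trans
        (Finset.dvd_prod_of_mem (fun i => quantumElementary q i ^ J i) (Finset.mem_univ i))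
    · intro v _
      rw [if_neg, zero_smul]
      intro h
      exact hJ (eq_of_heq (Sigma.mk.inj h).2)

end Domain

end ToyGW

end

noncomputable section

namespace ToyGW

open MvPolynomial

/-! ### Tails of continuants -/

section Tail

variable {S : Type*} [CommRing S]

/-- The lower right minor of size `r` of the tridiagonal matrix of `quantumDelta x q n t`. -/
def tailDelta (x q : ℕ → S) (n : ℕ) (t : S) : ℕ → S
  | 0 => 1
  | 1 => x (n - 1) + t
  | r + 2 => (x (n - (r + 2)) + t) * tailDelta x q n t (r + 1)
      + q (n - (r + 2)) * tailDelta x q n t r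

variable (x q : ℕ → S) (t : S)

/-- The expansion of a continuant along the cut between two consecutive indices. -/
theorem quantumDelta_eq_add (r : ℕ) : ∀ j : ℕ,
    quantumDelta x q (j + (r + 2)) t
      = quantumDelta x q (j + 1) t * tailDelta x q (j + (r + 2)) t (r + 1)
        + q j * quantumDelta x q j t * tailDelta x q (j + (r + 2)) t r := by
  induction r with
  | zero =>
    intro j
    rw [zero_add, quantumDelta_add_two, tailDelta, tailDelta, show j + 2 - 1 = j + 1 by omega]
    ring
  | succ r ih =>
    intro j
    have h := ih (j + 1)
    rw [show j + 1 + (r + 2) = j + (r + 1 + 2) by omega] at h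
    rw [h, tailDelta, show j + (r + 1 + 2) - (r + 2) = j + 1 by omega, quantumDelta_add_two]
    ring

theorem quantumDelta_congr {x x' : ℕ → S} {k : ℕ} (h : ∀ i < k, x i = x' i) :
    quantumDelta x q k t = quantumDelta x' q k t := by
  have : ∀ i : Fin k, x i = x' i := fun i => h i i.2
  simp only [quantumDelta, this]

theorem tailDelta_congr {x x' : ℕ → S} {n : ℕ} (r : ℕ) :
    (∀ i, n - r ≤ i → i < n → x i = x' i) → r ≤ n →
      tailDelta x q n t r = tailDelta x' q n t r := by
  induction r using Nat.strong_induction_on with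
  | _ r ih =>
  intro h hr
  match r with
  | 0 => rfl
  | 1 => rw [tailDelta, tailDelta, h (n - 1) le_rfl (by omega)]
  | r + 2 =>
    rw [tailDelta, tailDelta, h _ le_rfl (by omega),
      ih (r + 1) (by omega) (fun i h1 h2 => h i (by omega) h2) (by omega),
      ih r (by omega) (fun i h1 h2 => h i (by omega) h2) (by omega)]

theorem quantumDelta_succ_sub {x x' : ℕ → S} {j : ℕ} (h : ∀ i < j, x i = x' i) :
    quantumDelta x q (j + 1) t - quantumDelta x' q (j + 1) t
      = (x j - x' j) * quantumDelta x q j t := by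
  match j with
  | 0 => rw [quantumDelta_one, quantumDelta_one, quantumDelta_zero]; ring
  | j + 1 =>
    rw [quantumDelta_add_two, quantumDelta_add_two, ← quantumDelta_congr q t h,
      ← quantumDelta_congr q t fun i hi => h i (by omega)]
    ring

/-- A continuant is affine in each of its diagonal entries. -/
theorem quantumDelta_sub {x x' : ℕ → S} {n j : ℕ} (hj : j < n) (h : ∀ i < n, i ≠ j → x i = x' i) :
    quantumDelta x q n t - quantumDelta x' q n t
      = (x j - x' j) * (quantumDelta x q j t * tailDelta x' q n t (n - 1 - j)) := by
  obtain ⟨r, rfl⟩ : ∃ r, n = j + 1 + r := ⟨n - (j + 1), by omega⟩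
  rw [show j + 1 + r - 1 - j = r by omega]
  match r with
  | 0 => rw [add_zero, quantumDelta_succ_sub q t fun i hi => h i (by omega) (by omega),
      tailDelta, mul_one]
  | r + 1 =>
    rw [show j + 1 + (r + 1) = j + (r + 2) by omega] at h ⊢
    rw [quantumDelta_eq_add, quantumDelta_eq_add,
      tailDelta_congr q t r (fun i h1 h2 => h i h2 (by omega)) (by omega),
      tailDelta_congr q t (r + 1) (fun i h1 h2 => h i h2 (by omega)) (by omega),
      ← quantumDelta_congr q t (k := j) fun i hi => h i (by omega) (by omega)]
    have h1 := quantumDelta_succ_sub q t (j := j) fun i hi => h i (by omega) (by omega)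
    rw [sub_eq_iff_eq_add] at h1
    rw [h1]
    ring

/-- Modulo `Δ_n`, the products `Δ_{n-1} · tail_r` and the continuants `Δ_{n-1-r}`, rescaled by
signed products of `q`, obey the same recurrence in `r` with the same start. -/
theorem quantumDelta_dvd_mul_tailDelta (n r : ℕ) : ∀ j : ℕ, n = j + 1 + r →
    quantumDelta x q n t ∣ quantumDelta x q (n - 1) t * tailDelta x q n t r
      - (-1) ^ r * (∏ i ∈ Finset.range r, q (j + i)) * quantumDelta x q j t := by
  induction r using Nat.strong_induction_on with
  | _ r ih =>
  intro j hj
  match r with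
  | 0 =>
    subst hj
    simp [tailDelta]
  | 1 =>
    subst hj
    refine ⟨1, ?_⟩
    rw [tailDelta, show j + 1 + 1 - 1 = j + 1 by omega, quantumDelta_add_two]
    simp
    ring
  | r + 2 =>
    obtain ⟨a, ha⟩ := ih (r + 1) (by omega) (j + 1) (by omega)
    obtain ⟨b, hb⟩ := ih r (by omega) (j + 2) (by omega)
    refine ⟨(x (j + 1) + t) * a + q (j + 1) * b, ?_⟩
    rw [sub_eq_iff_eq_add] at ha hb
    have hp1 : ∏ i ∈ Finset.range (r + 2), q (j + i)
        = q j * q (j + 1) * ∏ i ∈ Finset.range r, q (j + 2 + i) := by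
      rw [Finset.prod_range_succ', Finset.prod_range_succ', add_zero, zero_add, mul_comm,
        mul_comm _ (q (j + 1)), ← mul_assoc]
      simp [add_comm, add_left_comm]
    have hp2 : ∏ i ∈ Finset.range (r + 1), q (j + 1 + i)
        = q (j + 1) * ∏ i ∈ Finset.range r, q (j + 2 + i) := by
      rw [Finset.prod_range_succ', mul_comm]
      simp [add_comm, add_left_comm]
    rw [tailDelta, show n - (r + 2) = j + 1 by omega, mul_add, mul_left_comm, ha,
      mul_left_comm (quantumDelta x q (n - 1) t) (q (j + 1)), hb, hp1, hp2, quantumDelta_add_two]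
    ring

/-! ### Continuants and tails as monic polynomials in their parameter. -/

variable {S' : Type*} [CommRing S'] (φ : S →+* S')

theorem map_quantumDelta (k : ℕ) :
    φ (quantumDelta x q k t) = quantumDelta (fun i => φ (x i)) (fun i => φ (q i)) k (φ t) := by
  induction k using Nat.strong_induction_on with
  | _ k ih =>
  match k with
  | 0 => simp
  | 1 => simp
  | k + 2 =>
    rw [quantumDelta_add_two, quantumDelta_add_two, map_add, map_mul, map_mul, map_add,
      ih (k + 1) (by omega), ih k (by omega)]

theorem map_extend {m : ℕ} (v : Fin m → S) (i : ℕ) :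
    φ (extend v i) = extend (fun j => φ (v j)) i := by
  unfold extend
  split_ifs
  · rfl
  · exact map_zero φ

/-- The polynomial in `t` whose value is `quantumDelta x q k t`. -/
def continuantPoly (k : ℕ) : Polynomial S :=
  quantumDelta (fun i => Polynomial.C (x i)) (fun i => Polynomial.C (q i)) k Polynomial.X

/-- The polynomial in `t` whose value is `tailDelta x q n t r`. -/
def tailPoly (n r : ℕ) : Polynomial S :=
  tailDelta (fun i => Polynomial.C (x i)) (fun i => Polynomial.C (q i)) n Polynomial.X r

theorem aeval_continuantPoly [Algebra S S'] (k : ℕ) (s : S') :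
    Polynomial.aeval s (continuantPoly x q k)
      = quantumDelta (fun i => algebraMap S S' (x i)) (fun i => algebraMap S S' (q i)) k s := by
  rw [continuantPoly, ← AlgHom.coe_toRingHom, map_quantumDelta]
  simp

theorem isMonicOfDegree_X_add_C_mul_add [Nontrivial S] {k : ℕ} {P Q : Polynomial S} (a b : S)
    (hP : Polynomial.IsMonicOfDegree P (k + 1)) (hQ : Polynomial.IsMonicOfDegree Q k) :
    Polynomial.IsMonicOfDegree
      ((Polynomial.C a + Polynomial.X) * P + Polynomial.C b * Q) (k + 2) := by
  refine Polynomial.IsMonicOfDegree.add_right ?_ ?_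
  · have h1 := (Polynomial.isMonicOfDegree_X_add_one a).mul hP
    rwa [add_comm Polynomial.X, show 1 + (k + 1) = k + 2 by omega] at h1
  · refine (Polynomial.natDegree_C_mul_le _ _).trans_lt ?_
    rw [hQ.natDegree_eq]
    omega

theorem isMonicOfDegree_continuantPoly [Nontrivial S] (k : ℕ) :
    (continuantPoly x q k).IsMonicOfDegree k := by
  induction k using Nat.strong_induction_on with
  | _ k ih =>
  match k with
  | 0 => rw [continuantPoly, quantumDelta_zero]; exact Polynomial.isMonicOfDegree_zero_iff.mpr rfl
  | 1 =>
    rw [continuantPoly, quantumDelta_one, add_comm]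
    exact Polynomial.isMonicOfDegree_X_add_one _
  | k + 2 =>
    rw [continuantPoly, quantumDelta_add_two]
    exact isMonicOfDegree_X_add_C_mul_add _ _ (ih (k + 1) (by omega)) (ih k (by omega))

theorem isMonicOfDegree_tailPoly [Nontrivial S] (n r : ℕ) :
    (tailPoly x q n r).IsMonicOfDegree r := by
  induction r using Nat.strong_induction_on with
  | _ r ih =>
  match r with
  | 0 => rw [tailPoly, tailDelta]; exact Polynomial.isMonicOfDegree_zero_iff.mpr rfl
  | 1 =>
    rw [tailPoly, tailDelta, add_comm]
    exact Polynomial.isMonicOfDegree_X_add_one _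
  | r + 2 =>
    rw [tailPoly, tailDelta]
    exact isMonicOfDegree_X_add_C_mul_add _ _ (ih (r + 1) (by omega)) (ih r (by omega))

end Tail

/-! ### The top quantum double Schubert polynomial and its dual -/

section TopProd

variable {S : Type*} [CommRing S] (n : ℕ) (x q : ℕ → S)

/-- The product of the continuants of length `n - 1 - j` with parameter `X j`. -/
def deltaProd : MvPolynomial (Fin n) S :=
  ∏ j : Fin n, Polynomial.aeval (X j) (continuantPoly x q (n - 1 - j))

/-- The product of the tails of length `j` with parameter `X j`. -/
def tailProd : MvPolynomial (Fin n) S :=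
  ∏ j : Fin n, Polynomial.aeval (X j) (tailPoly x q n j)

/-- The degrees `n - 1 - j` make the matrix of coefficients unitriangular. -/
theorem topCoeff_prod_aeval_of_isMonicOfDegree [IsDomain S] [CharZero S]
    (P : Fin n → Polynomial S) (hP : ∀ j, (P j).IsMonicOfDegree (n - 1 - j)) :
    topCoeff S n (∏ j, Polynomial.aeval (X j) (P j)) = 1 := by
  rw [topCoeff_prod_aeval _ fun j => by rw [(hP j).natDegree_eq]; omega,
    Matrix.det_of_isLowerTriangular]
  · refine Finset.prod_eq_one fun j _ => ?_
    have h := (hP j).monic.coeff_natDegree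
    rwa [(hP j).natDegree_eq] at h
  · intro i j hij
    have hij : i < j := hij
    rw [Matrix.of_apply]
    apply Polynomial.coeff_eq_zero_of_natDegree_lt
    rw [(hP j).natDegree_eq]
    have := Fin.lt_def.mp hij
    omega

theorem topCoeff_deltaProd [IsDomain S] [CharZero S] : topCoeff S n (deltaProd n x q) = 1 :=
  topCoeff_prod_aeval_of_isMonicOfDegree n _ fun _ => isMonicOfDegree_continuantPoly x q _

theorem act_longest_tailProd :
    act (longest n) (tailProd n x q)
      = ∏ j : Fin n, Polynomial.aeval (X j) (tailPoly x q n (n - 1 - j)) := by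
  rw [tailProd, map_prod, ← Equiv.prod_comp (longest n)]
  refine Finset.prod_congr rfl fun j _ => ?_
  rw [← Polynomial.aeval_algHom_apply, act, rename_X, longest, Fin.revPerm_apply,
    Fin.revPerm_apply, Fin.rev_rev, Fin.val_rev, show n - ((j : ℕ) + 1) = n - 1 - j by omega]

theorem act_longest_deltaProd :
    act (longest n) (deltaProd n x q)
      = ∏ j : Fin n, Polynomial.aeval (X j) (continuantPoly x q j) := by
  rw [deltaProd, map_prod, ← Equiv.prod_comp (longest n)]
  refine Finset.prod_congr rfl fun j _ => ?_
  rw [← Polynomial.aeval_algHom_apply, act, rename_X, longest, Fin.revPerm_apply,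
    Fin.revPerm_apply, Fin.rev_rev, Fin.val_rev, show n - 1 - (n - ((j : ℕ) + 1)) = j by omega]

/-- The tails have increasing degrees `j`; reversing the variables restores decreasing degrees at
the cost of the sign of `w₀`. -/
theorem topCoeff_tailProd [IsDomain S] [CharZero S] :
    topCoeff S n (tailProd n x q) = ((Equiv.Perm.sign (longest n) : ℤ) : S) := by
  have h := topCoeff_act (longest n) (tailProd n x q)
  rw [act_longest_tailProd, topCoeff_prod_aeval_of_isMonicOfDegree n _ fun _ =>
    isMonicOfDegree_tailPoly x q n _] at h
  have hs : ((Equiv.Perm.sign (longest n) : ℤ) : S) * ((Equiv.Perm.sign (longest n) : ℤ) : S)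
      = 1 := by
    rw [← Int.cast_mul, ← Units.val_mul, Int.units_mul_self]
    simp
  calc _ = ((Equiv.Perm.sign (longest n) : ℤ) : S) * (((Equiv.Perm.sign (longest n) : ℤ) : S)
        * topCoeff S n (tailProd n x q)) := by rw [← mul_assoc, hs, one_mul]
    _ = _ := by rw [← h, mul_one]

theorem map_deltaProd {S' : Type*} [CommRing S'] (φ : S →+* S') :
    map φ (deltaProd n x q) = deltaProd n (fun i => φ (x i)) (fun i => φ (q i)) := by
  rw [deltaProd, map_prod, deltaProd]
  refine Finset.prod_congr rfl fun j _ => ?_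
  rw [aeval_continuantPoly, aeval_continuantPoly, map_quantumDelta]
  simp [algebraMap_eq]

end TopProd

/-- The additional factor, for the last index, is the empty continuant `1`; the others match after
reversal of the index. -/
theorem quantumDoubleTop_eq {R : Type*} [CommRing R] {n : ℕ} (q : Fin (n - 1) → R) :
    quantumDoubleTop q = deltaProd n (extend fun j => X j) (extend fun j => C (q j)) := by
  rw [quantumDoubleTop, deltaProd]
  match n with
  | 0 => rfl
  | n + 1 =>
    rw [Fin.prod_univ_castSucc, Fin.val_last, show n + 1 - 1 - n = 0 by omega]
    rw [show Polynomial.aeval (X (Fin.last n)) (continuantPoly _ _ 0) = 1 by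
      simp [continuantPoly], mul_one]
    change ∏ i : Fin n, _ = _
    rw [← Equiv.prod_comp Fin.revPerm]
    refine Finset.prod_congr rfl fun j _ => ?_
    rw [aeval_continuantPoly]
    simp only [algebraMap_eq, map_extend, Fin.revPerm_apply, Fin.val_rev]
    have := j.2
    congr 1
    · simp; omega
    · congr 1
      ext
      simp
      omega

end ToyGW

end

noncomputable section

namespace ToyGW

open MvPolynomial

/-! ### Naturality in the coefficients -/

section Naturality

variable {R R' : Type*} [CommRing R] [CommRing R'] {n : ℕ} (κ : R →+* R') (q : Fin (n - 1) → R)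

/-- The variables, followed by zeros. -/
abbrev varSeq (R : Type*) [CommRing R] (n : ℕ) : ℕ → MvPolynomial (Fin n) R :=
  extend fun j => X j

/-- The constant polynomials given by a family of parameters, followed by zeros. -/
abbrev paramSeq (q : Fin (n - 1) → R) : ℕ → MvPolynomial (Fin n) R :=
  extend fun j => C (q j)

theorem quantumElementary_eq_coeff (i : Fin n) :
    quantumElementary q i
      = (continuantPoly (varSeq R n) (paramSeq q) n).coeff
        (n - (i + 1)) := by
  rw [quantumElementary, continuantPoly]
  simp_rw [map_extend]

theorem map_continuantPoly {S S' : Type*} [CommRing S] [CommRing S'] (φ : S →+* S')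
    (x q : ℕ → S) (k : ℕ) :
    (continuantPoly x q k).map φ = continuantPoly (fun i => φ (x i)) (fun i => φ (q i)) k := by
  rw [continuantPoly, ← Polynomial.coe_mapRingHom, map_quantumDelta]
  simp [continuantPoly]

theorem map_quantumElementary (i : Fin n) :
    map κ (quantumElementary q i) = quantumElementary (fun j => κ (q j)) i := by
  rw [quantumElementary_eq_coeff, quantumElementary_eq_coeff, ← Polynomial.coeff_map,
    map_continuantPoly]
  simp_rw [map_extend]
  simp

theorem map_quantumIdeal :
    (quantumIdeal q).map (map κ) = quantumIdeal fun j => κ (q j) := by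
  rw [quantumIdeal, Ideal.map_span, ← Set.range_comp, quantumIdeal]
  congr 2
  funext i
  exact map_quantumElementary κ q i

theorem map_quantumDoubleTop :
    map (map κ) (quantumDoubleTop q) = quantumDoubleTop fun j => κ (q j) := by
  rw [quantumDoubleTop_eq, quantumDoubleTop_eq, map_deltaProd]
  simp_rw [map_extend]
  simp

/-- Serves twice: with `κ = C`, to place the second factor of the Cauchy formula in the variables
`y`, and with the map from `ℚ[q]` to `ℚ[[q, t]]`, to see that the `S_w` do not involve `t`. -/
theorem map_quantumSchubert [IsDomain R'] (w : Equiv.Perm (Fin n)) :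
    map κ (quantumSchubert q w) = quantumSchubert (fun j => κ (q j)) w := by
  rw [quantumSchubert, quantumDoubleSchubert, ← constantCoeff_map, map_dividedDifference,
    map_quantumDoubleTop]
  rfl

end Naturality

/-! ### Monic polynomials and ideals -/

section MonicIdeal

theorem aeval_sub_pow_mem {A B : Type*} [CommRing A] [CommRing B] [Algebra A B] (I : Ideal B)
    {n : ℕ} {P : Polynomial A} (hP : P.IsMonicOfDegree n)
    (h : ∀ i < n, algebraMap A B (P.coeff i) ∈ I) (b : B) :
    Polynomial.aeval b P - b ^ n ∈ I := by
  have h1 := hP.monic.as_sum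
  rw [hP.natDegree_eq] at h1
  rw [h1, map_add, map_pow, Polynomial.aeval_X, add_sub_cancel_left, map_sum]
  refine sum_mem fun i hi => ?_
  rw [map_mul, Polynomial.aeval_C]
  exact Ideal.mul_mem_right _ _ (h i (Finset.mem_range.mp hi))

/-- The element `-x_j` is a root of the monic polynomial `∏ (t + x_k)`, whose lower coefficients are
elementary symmetric of positive degree. -/
theorem X_pow_mem_symmetricIdeal {R : Type*} [CommRing R] [IsDomain R] {n : ℕ} (j : Fin n) :
    (X j : MvPolynomial (Fin n) R) ^ n ∈ symmetricIdeal R n := by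
  set P : Polynomial (MvPolynomial (Fin n) R) :=
    ∏ k : Fin n, (Polynomial.X + Polynomial.C (X k)) with hP
  have hmon : P.IsMonicOfDegree n := by
    refine ⟨?_, Polynomial.monic_prod_of_monic _ _ fun k _ => Polynomial.monic_X_add_C (X k)⟩
    rw [hP, Polynomial.natDegree_prod_of_monic _ _ fun k _ => Polynomial.monic_X_add_C (X k)]
    simp
  have h1 := aeval_sub_pow_mem (symmetricIdeal R n) hmon (fun i hi => by
    rw [hP, MvPolynomial.prod_X_add_C_coeff _ _ _ (by simpa using hi.le), Fintype.card_fin,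
      Algebra.algebraMap_self, RingHom.id_apply]
    refine Ideal.subset_span ⟨⟨n - i - 1, by omega⟩, ?_⟩
    simp only
    congr 1
    omega) (-X j : MvPolynomial (Fin n) R)
  have h2 : Polynomial.aeval (-X j : MvPolynomial (Fin n) R) P = 0 := by
    rw [hP, map_prod]
    refine Finset.prod_eq_zero (Finset.mem_univ j) ?_
    simp
  rw [h2, zero_sub, neg_mem_iff, neg_pow] at h1
  have h3 := Ideal.mul_mem_left _ ((-1) ^ n) h1
  rwa [← mul_assoc, ← mul_pow, neg_one_mul, neg_neg, one_pow, one_mul] at h3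

theorem apply_mem_of_mem_map_C {S σ : Type*} [CommRing S] {I : Ideal S}
    (l : MvPolynomial σ S →ₗ[S] S) {f : MvPolynomial σ S} (hf : f ∈ I.map C) : l f ∈ I := by
  rw [mem_map_C_iff] at hf
  rw [f.as_sum, map_sum]
  refine sum_mem fun m _ => ?_
  rw [show monomial m (coeff m f) = coeff m f • monomial m (1 : S) by
    rw [smul_monomial, smul_eq_mul, mul_one], map_smul, smul_eq_mul]
  exact Ideal.mul_mem_right _ _ (hf m)

end MonicIdeal

/-! ### The duality between continuants and their tails -/

section Duality

variable {R : Type*} [CommRing R] [IsDomain R] {n : ℕ}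

/-- The quotient by the quantum ideal is free over the domain `R`, hence without torsion. -/
theorem mem_quantumIdeal_of_C_mul_mem (q : Fin (n - 1) → R) {a : R} (ha : a ≠ 0)
    {f : MvPolynomial (Fin n) R} (h : C a * f ∈ quantumIdeal q) : f ∈ quantumIdeal q := by
  have h1 := sub_sum_classicalCoord_mem q f
  have h2 : ∀ w, classicalCoord q w f = 0 := by
    intro w
    have h3 := classicalCoord_of_mem q w h
    rw [← smul_eq_C_mul, map_smul, smul_eq_mul] at h3
    exact (mul_eq_zero.mp h3).resolve_left ha
  simpa [h2] using h1

variable [CharZero R] (q : Fin (n - 1) → R)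

/-- As a polynomial in its parameter, `Δ_n` is monic with lower coefficients `ẽ_i`; these lie in the
first ideal, and the `n`-th power of the outer variable lies in the second. -/
theorem continuant_X_mem (j : Fin n) :
    Polynomial.aeval (X j) (continuantPoly (varSeq R n) (paramSeq q) n)
      ∈ (quantumIdeal q).map (C : _ →+* MvPolynomial (Fin n) (MvPolynomial (Fin n) R))
        ⊔ symmetricIdeal (MvPolynomial (Fin n) R) n := by
  have h1 := aeval_sub_pow_mem ((quantumIdeal q).map
    (C : _ →+* MvPolynomial (Fin n) (MvPolynomial (Fin n) R)))
    (isMonicOfDegree_continuantPoly (varSeq R n) (paramSeq q) n) (fun i hi => by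
      rw [algebraMap_eq]
      refine Ideal.mem_map_of_mem _ (Ideal.subset_span ⟨⟨n - 1 - i, by omega⟩, ?_⟩)
      rw [quantumElementary_eq_coeff]
      congr 1
      simp only
      omega) (X j)
  have h2 := Ideal.add_mem _ (Ideal.mem_sup_left (T := symmetricIdeal _ n) h1)
    (Ideal.mem_sup_right (X_pow_mem_symmetricIdeal j))
  rwa [sub_add_cancel] at h2

theorem isSymmetric_prod_aeval {S : Type*} [CommRing S] (P : Polynomial S) :
    (∏ j : Fin n, Polynomial.aeval (X j : MvPolynomial (Fin n) S) P).IsSymmetric := by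
  intro w
  rw [map_prod]
  conv_rhs => rw [← Equiv.prod_comp w]
  refine Finset.prod_congr rfl fun j _ => ?_
  rw [← Polynomial.aeval_algHom_apply, rename_X]

/-- Up to scalars, the product of tails is congruent to the product of continuants. -/
theorem exists_tailProd_congr (hq : ∀ i, q i ≠ 0) : ∃ (c : MvPolynomial (Fin n) R) (a : R), a ≠ 0 ∧
    C c * tailProd n (varSeq R n) (paramSeq q)
      - C (C a) * deltaProd n (varSeq R n) (paramSeq q)
      ∈ (quantumIdeal q).map (C : _ →+* MvPolynomial (Fin n) (MvPolynomial (Fin n) R))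
        ⊔ symmetricIdeal (MvPolynomial (Fin n) R) n := by
  set J := (quantumIdeal q).map (C : _ →+* MvPolynomial (Fin n) (MvPolynomial (Fin n) R))
        ⊔ symmetricIdeal (MvPolynomial (Fin n) R) n with hJ
  set x := varSeq R n
  set p := paramSeq q with hp
  set a : Fin n → R := fun j => (-1) ^ (j : ℕ) * ∏ i ∈ Finset.range j, extend q (n - 1 - j + i)
  have hterm : ∀ j : Fin n,
      Polynomial.aeval (X j : MvPolynomial (Fin n) (MvPolynomial (Fin n) R))
          (continuantPoly x p (n - 1))
        * Polynomial.aeval (X j : MvPolynomial (Fin n) (MvPolynomial (Fin n) R)) (tailPoly x p n j)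
        - C (C (a j)) * Polynomial.aeval (X j : MvPolynomial (Fin n) (MvPolynomial (Fin n) R))
          (continuantPoly x p (n - 1 - j)) ∈ J := by
    intro j
    obtain ⟨b, hb⟩ := quantumDelta_dvd_mul_tailDelta (fun i => Polynomial.C (x i))
      (fun i => Polynomial.C (p i)) Polynomial.X n j (n - 1 - j) (by omega)
    have h1 := congrArg (Polynomial.aeval (X j : MvPolynomial (Fin n) (MvPolynomial (Fin n) R))) hb
    rw [map_sub, map_mul, map_mul _ _ b, map_mul] at h1
    have h2 : Polynomial.aeval (X j : MvPolynomial (Fin n) (MvPolynomial (Fin n) R))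
        ((-1) ^ (j : ℕ) * ∏ i ∈ Finset.range j, Polynomial.C (p (n - 1 - j + i)))
        = C (C (a j)) := by
      simp only [a, map_mul, map_pow, map_neg, map_one, map_prod, Polynomial.aeval_C, hp,
        algebraMap_eq]
      simp only [paramSeq, map_extend]
    rw [h2] at h1
    change _ = Polynomial.aeval (X j) (continuantPoly x p n) * _ at h1
    change Polynomial.aeval _ (continuantPoly x p (n - 1))
      * Polynomial.aeval _ (tailPoly x p n j) - _ * Polynomial.aeval _ (continuantPoly x p _)
      = _ at h1
    rw [h1]
    exact Ideal.mul_mem_right _ _ (continuant_X_mem q j)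
  -- The product of the factors `Δ_{n-1}` is symmetric in the outer variables, so modulo the
  -- symmetric ideal it equals its constant term, which becomes `c`.
  set Θ : MvPolynomial (Fin n) (MvPolynomial (Fin n) R) :=
    ∏ j : Fin n, Polynomial.aeval (X j) (continuantPoly x p (n - 1)) with hΘ
  have hsym := sub_C_mem_symmetricIdeal (isSymmetric_prod_aeval (n := n)
    (continuantPoly x p (n - 1)))
  rw [← hΘ] at hsym
  refine ⟨constantCoeff Θ, ∏ j, a j, ?_, ?_⟩
  · refine Finset.prod_ne_zero_iff.mpr fun j _ => mul_ne_zero (by simp) ?_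
    refine Finset.prod_ne_zero_iff.mpr fun i hi => ?_
    have := Finset.mem_range.mp hi
    rw [extend, dif_pos (by omega)]
    exact hq _
  · have h3 : Θ * tailProd n x p - C (C (∏ j, a j)) * deltaProd n x p ∈ J := by
      rw [← Ideal.Quotient.eq, hΘ, tailProd, deltaProd, map_prod, map_prod,
        ← Finset.prod_mul_distrib, ← Finset.prod_mul_distrib, map_prod, map_prod]
      exact Finset.prod_congr rfl fun j _ => Ideal.Quotient.eq.mpr (hterm j)
    have h4 := Ideal.sub_mem _ h3 (Ideal.mul_mem_right (tailProd n x p) _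
      (Ideal.mem_sup_right (S := (quantumIdeal q).map
        (C : _ →+* MvPolynomial (Fin n) (MvPolynomial (Fin n) R))) hsym))
    convert h4 using 1
    ring

/-- Forms that vanish on the symmetric ideal turn the congruence of products into congruences in the
inner ring. The form `topCoeff` determines `c` as `± a`; the form `constantCoeff ∘ ∂_w` then gives
the claim multiplied by `a ≠ 0`, which may be cancelled. -/
theorem constantCoeff_dividedDifference_tailProd (hq : ∀ i, q i ≠ 0) (w : Equiv.Perm (Fin n)) :
    constantCoeff (dividedDifference w
        (tailProd n (varSeq R n) (paramSeq q)))
      - ((Equiv.Perm.sign (longest n) : ℤ) : MvPolynomial (Fin n) R)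
        * constantCoeff (dividedDifference w (quantumDoubleTop q)) ∈ quantumIdeal q := by
  obtain ⟨c, a, ha, h⟩ := exists_tailProd_congr q hq
  rw [quantumDoubleTop_eq]
  set T := deltaProd n (varSeq R n) (paramSeq q)
    with hT
  set T' := tailProd n (varSeq R n) (paramSeq q)
    with hT'
  set ε : MvPolynomial (Fin n) R := ((Equiv.Perm.sign (longest n) : ℤ) : MvPolynomial (Fin n) R)
    with hε
  have hε2 : ε * ε = 1 := by
    rw [hε, ← Int.cast_mul, ← Units.val_mul, Int.units_mul_self]
    simp
  have key : ∀ l : MvPolynomial (Fin n) (MvPolynomial (Fin n) R) →ₗ[MvPolynomial (Fin n) R]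
      MvPolynomial (Fin n) R, (∀ f ∈ symmetricIdeal (MvPolynomial (Fin n) R) n, l f = 0) →
      c * l T' - C a * l T ∈ quantumIdeal q := by
    intro l hl
    have h1 : l (C c * T' - C (C a) * T) ∈ quantumIdeal q := by
      obtain ⟨f, hf, g, hg, hfg⟩ := Submodule.mem_sup.mp h
      rw [← hfg, map_add, hl g hg, add_zero]
      exact apply_mem_of_mem_map_C l hf
    rwa [map_sub, ← smul_eq_C_mul, ← smul_eq_C_mul, map_smul, map_smul, smul_eq_mul,
      smul_eq_mul] at h1
  have h1 := key (topCoeff _ n) fun f hf => topCoeff_of_mem hf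
  rw [topCoeff_tailProd, topCoeff_deltaProd, ← hε, mul_one] at h1
  have h2 := key ((lcoeff _ 0).comp (dividedDifferenceₗ w)) fun f hf => by
    simpa [constantCoeff_eq] using constantCoeff_dividedDifference_of_mem hf w
  simp only [LinearMap.comp_apply, dividedDifferenceₗ_apply, lcoeff_apply, ← constantCoeff_eq]
    at h2
  set A := constantCoeff (dividedDifference w T)
  set A' := constantCoeff (dividedDifference w T')
  refine mem_quantumIdeal_of_C_mul_mem q ha ?_
  have h3 := Ideal.mul_mem_left _ ε (Ideal.sub_mem _ h2 (Ideal.mul_mem_left _ (ε * A') h1))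
  convert h3 using 1
  linear_combination (ε * c * A' - C a * A') * hε2

end Duality

/-! ### The Bezoutian of the quantum elementary symmetric polynomials -/

section Bezoutian

variable {R : Type*} [CommRing R] {n : ℕ} (q : Fin (n - 1) → R)

/-- The variables of the coefficient ring of `R[x][y]`, followed by zeros. -/
abbrev innerVarSeq (R : Type*) [CommRing R] (n : ℕ) :
    ℕ → MvPolynomial (Fin n) (MvPolynomial (Fin n) R) :=
  fun i => C (varSeq R n i)

theorem mixedEval_quantumElementary (k : ℕ) (i : Fin n) :
    mixedEval R n k (quantumElementary q i)
      = (continuantPoly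
          (fun m => if m < k then innerVarSeq R n m else varSeq (MvPolynomial (Fin n) R) n m)
          (paramSeq fun j => C (q j)) n).coeff (n - (i + 1)) := by
  rw [quantumElementary_eq_coeff, ← AlgHom.coe_toRingHom, ← Polynomial.coeff_map,
    map_continuantPoly]
  congr 2
  · funext m
    rw [map_extend, innerVarSeq, map_extend]
    unfold varSeq extend
    split_ifs with h1 h2
    · simp [mixedEval, h2]
    · simp [mixedEval, h2]
    · rfl
    · rfl
  · funext m
    rw [map_extend]
    congr 1
    funext j
    rw [AlgHom.coe_toRingHom, algHom_C]
    rfl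

theorem C_X_sub_X_ne_zero [IsDomain R] (j : Fin n) :
    (C (X j) - X j : MvPolynomial (Fin n) (MvPolynomial (Fin n) R)) ≠ 0 := by
  intro h
  have h1 := congrArg constantCoeff h
  rw [map_sub, constantCoeff_C, constantCoeff_X, sub_zero, map_zero] at h1
  exact X_ne_zero j h1

/-- The two substitutions differ in the diagonal entry `j` alone, and the determinant is affine in
it. The slope is the minor before `j`, with entries in `x`, times the minor after `j`, with entries
in `y`. -/
theorem bezoutian_entry [IsDomain R] (i j : Fin n) :
    Classical.choose (dvd_mixedEval_sub j (quantumElementary q i))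
      = (continuantPoly (innerVarSeq R n) (paramSeq fun j => C (q j)) j
          * tailPoly (varSeq (MvPolynomial (Fin n) R) n) (paramSeq fun j => C (q j)) n
            (n - 1 - j)).coeff (n - 1 - i) := by
  have h := Classical.choose_spec (dvd_mixedEval_sub j (quantumElementary q i))
  apply mul_left_cancel₀ (C_X_sub_X_ne_zero j)
  rw [← h, mixedEval_quantumElementary, mixedEval_quantumElementary, ← Polynomial.coeff_sub]
  set x₁ : ℕ → MvPolynomial (Fin n) (MvPolynomial (Fin n) R) := fun m =>
    if m < (j : ℕ) + 1 then innerVarSeq R n m else varSeq (MvPolynomial (Fin n) R) n m with hx₁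
  set x₂ : ℕ → MvPolynomial (Fin n) (MvPolynomial (Fin n) R) := fun m =>
    if m < (j : ℕ) then innerVarSeq R n m else varSeq (MvPolynomial (Fin n) R) n m with hx₂
  have h₁ : ∀ m < (j : ℕ), x₁ m = innerVarSeq R n m := fun m hm => if_pos (by omega)
  have h₂ : ∀ m, n - (n - 1 - j) ≤ m → x₂ m = varSeq (MvPolynomial (Fin n) R) n m :=
    fun m hm => if_neg (by omega)
  have h₁₂ : ∀ m < n, m ≠ j → Polynomial.C (x₁ m) = Polynomial.C (x₂ m) := by
    intro m _ hm
    rcases lt_or_gt_of_ne hm with hm | hm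
    · rw [h₁ m hm, hx₂]
      simp only
      rw [if_pos hm]
    · rw [h₂ m (by omega), hx₁]
      simp only
      rw [if_neg (by omega)]
  have h₀ : x₁ j - x₂ j = C (X j) - X j := by
    rw [hx₁, hx₂]
    simp only
    rw [if_pos (by omega), if_neg (lt_irrefl _), innerVarSeq, varSeq, varSeq, extend,
      dif_pos j.2, extend, dif_pos j.2]
  rw [continuantPoly, continuantPoly, quantumDelta_sub _ _ j.2 h₁₂, ← Polynomial.C_sub, h₀,
    Polynomial.coeff_C_mul, show n - ((i : ℕ) + 1) = n - 1 - i by omega,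
    quantumDelta_congr _ _ fun m hm => congrArg Polynomial.C (h₁ m hm),
    tailDelta_congr _ _ _ (fun m hm _ => congrArg Polynomial.C (h₂ m hm)) (by omega)]
  rfl

/-- Column `j` lists the coefficients of a polynomial of degree `j + (n - 1 - j) < n`, so the
determinant is a top coefficient in a third set of variables. Reversing these variables produces the
sign. -/
theorem bezoutian_eq_topCoeff [IsDomain R] [CharZero R] :
    bezoutian (quantumElementary q)
      = ((Equiv.Perm.sign (longest n) : ℤ) : MvPolynomial (Fin n) (MvPolynomial (Fin n) R))
        * topCoeff (MvPolynomial (Fin n) (MvPolynomial (Fin n) R)) n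
          (deltaProd n (innerVarSeq R n) (paramSeq fun j => C (q j))
            * tailProd n (varSeq (MvPolynomial (Fin n) R) n) (paramSeq fun j => C (q j))) := by
  set P : Fin n → Polynomial (MvPolynomial (Fin n) (MvPolynomial (Fin n) R)) := fun j =>
    continuantPoly (innerVarSeq R n) (paramSeq fun j => C (q j)) j
      * tailPoly (varSeq (MvPolynomial (Fin n) R) n) (paramSeq fun j => C (q j)) n (n - 1 - j)
    with hP
  have h1 : bezoutian (quantumElementary q)
      = Matrix.det (Matrix.of fun i j : Fin n => (P j).coeff (n - 1 - i)) := by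
    rw [bezoutian]
    congr 2
    funext i j
    exact bezoutian_entry q i j
  have h2 : ∀ j, (P j).natDegree < n := by
    intro j
    rw [hP, ((isMonicOfDegree_continuantPoly _ _ _).mul
      (isMonicOfDegree_tailPoly _ _ _ _)).natDegree_eq]
    omega
  rw [h1, ← topCoeff_prod_aeval P h2, ← topCoeff_act, map_mul, act_longest_deltaProd,
    act_longest_tailProd, ← Finset.prod_mul_distrib]
  congr 1
  refine Finset.prod_congr rfl fun j _ => ?_
  rw [hP, map_mul]

/-- The Cauchy formula for the Bezoutian. -/
theorem bezoutian_sub_sum_mem [IsDomain R] [CharZero R] (hq : ∀ i, q i ≠ 0) :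
    bezoutian (quantumElementary q)
      - ∑ u, C (quantumSchubert q u) * map C (quantumSchubert q (longest n * u))
      ∈ quantumIdeal fun j => (C (q j) : MvPolynomial (Fin n) R) := by
  set T := deltaProd n (innerVarSeq R n) (paramSeq fun j => (C (q j) : MvPolynomial (Fin n) R))
    with hT
  set T' := tailProd n (varSeq (MvPolynomial (Fin n) R) n)
    (paramSeq fun j => (C (q j) : MvPolynomial (Fin n) R)) with hT'
  set ε : MvPolynomial (Fin n) (MvPolynomial (Fin n) R) :=
    ((Equiv.Perm.sign (longest n) : ℤ) : MvPolynomial (Fin n) (MvPolynomial (Fin n) R)) with hε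
  have hε2 : ε * ε = 1 := by
    rw [hε, ← Int.cast_mul, ← Units.val_mul, Int.units_mul_self]
    simp
  have hTx : T = map C (quantumDoubleTop q) := by
    rw [quantumDoubleTop_eq, map_deltaProd, hT]
    congr 1
    funext i
    rw [map_extend]
  have h1 : ∀ w, constantCoeff (dividedDifference w T) = C (quantumSchubert q (w * longest n)) := by
    intro w
    rw [hTx, ← map_dividedDifference, constantCoeff_map, quantumSchubert, quantumDoubleSchubert,
      mul_assoc, longest_mul_self, mul_one]
  -- Newton interpolation of `T` in the third set of variables: `T` involves only `x` besides these,
  -- so its interpolation coefficients are quantum Schubert polynomials in `x`.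
  have h2 : topCoeff _ n (T * T') = ∑ w, C (quantumSchubert q (w * longest n))
      * constantCoeff (dividedDifference (longest n * w) T') := by
    have h3 := topCoeff_of_mem (Ideal.mul_mem_right T' _ (sub_sum_mem_symmetricIdeal T))
    rw [sub_mul, map_sub, sub_eq_zero] at h3
    rw [h3, Finset.sum_mul, map_sum]
    refine Finset.sum_congr rfl fun w _ => ?_
    rw [mul_assoc, ← smul_eq_C_mul, map_smul, smul_eq_mul, topCoeff_classicalSchubert_mul, h1]
  have h3 : ∑ u, C (quantumSchubert q u) * map C (quantumSchubert q (longest n * u))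
      = ∑ w, C (quantumSchubert q (w * longest n)) * constantCoeff (dividedDifference (longest n * w)
        (quantumDoubleTop fun j => (C (q j) : MvPolynomial (Fin n) R))) := by
    rw [← Equiv.sum_comp (Equiv.mulRight (longest n))]
    refine Finset.sum_congr rfl fun w _ => ?_
    rw [map_quantumSchubert, Equiv.coe_mulRight]
    congr 1
    rw [quantumSchubert, quantumDoubleSchubert, ← mul_assoc, mul_assoc, longest_mul_self, mul_one]
  rw [bezoutian_eq_topCoeff, h2, h3, Finset.mul_sum, ← Finset.sum_sub_distrib]
  refine Ideal.sum_mem _ fun w _ => ?_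
  -- The tails in `y` are traded for continuants in `y`; the duality is applied with `R[x]` as ring
  -- of coefficients.
  have h4 := Ideal.mul_mem_left _ (ε * C (quantumSchubert q (w * longest n)))
    (constantCoeff_dividedDifference_tailProd (fun j => (C (q j) : MvPolynomial (Fin n) R))
      (fun i => (C_ne_zero).mpr (hq i)) (longest n * w))
  convert h4 using 1
  rw [← hε]
  linear_combination (C (quantumSchubert q (w * longest n)) * constantCoeff (dividedDifference
    (longest n * w) (quantumDoubleTop fun j => (C (q j) : MvPolynomial (Fin n) R)))) * hε2

end Bezoutian

end ToyGW

end

noncomputable section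

namespace ToyGW

open MvPolynomial

/-! ### Bidegrees -/

section Bidegree

variable {R : Type*} [CommRing R] {n : ℕ}

/-- The coefficient of a monomial of degree `k` has degree less than `e` as soon as
`d ≤ k + e`. -/
def BidegreeLT (d : ℕ) (p : MvPolynomial (Fin n) (MvPolynomial (Fin n) R)) : Prop :=
  ∀ (m : Fin n →₀ ℕ) (e : ℕ), d ≤ m.degree + e → coeff m p ∈ degreeLT R (Fin n) e

namespace BidegreeLT

variable {a b : ℕ} {p p' : MvPolynomial (Fin n) (MvPolynomial (Fin n) R)}

theorem mono (h : BidegreeLT a p) (hab : a ≤ b) : BidegreeLT b p :=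
  fun m e he => h m e (hab.trans he)

theorem zero : BidegreeLT a (0 : MvPolynomial (Fin n) (MvPolynomial (Fin n) R)) :=
  fun m e _ => by rw [coeff_zero]; exact zero_mem _

theorem add (h : BidegreeLT a p) (h' : BidegreeLT a p') : BidegreeLT a (p + p') :=
  fun m e he => by rw [coeff_add]; exact add_mem (h m e he) (h' m e he)

theorem C {f : MvPolynomial (Fin n) R} (h : f ∈ degreeLT R (Fin n) a) :
    BidegreeLT a (C f : MvPolynomial (Fin n) (MvPolynomial (Fin n) R)) := by
  intro m e he
  rw [coeff_C]
  split_ifs with hm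
  · subst hm
    exact degreeLT_mono (by simpa using he) h
  · exact zero_mem _

theorem one : BidegreeLT 1 (1 : MvPolynomial (Fin n) (MvPolynomial (Fin n) R)) :=
  C (mem_degreeLT_of_isHomogeneous (isHomogeneous_one (Fin n) R))

theorem X (j : Fin n) : BidegreeLT 2 (X j : MvPolynomial (Fin n) (MvPolynomial (Fin n) R)) := by
  intro m e he
  rw [coeff_X]
  split_ifs with hm
  · subst hm
    rw [Finsupp.degree_single] at he
    exact degreeLT_mono (by omega) (mem_degreeLT_of_isHomogeneous (isHomogeneous_one (Fin n) R))
  · exact zero_mem _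

theorem mul (h : BidegreeLT (a + 1) p) (h' : BidegreeLT (b + 1) p') :
    BidegreeLT (a + b + 1) (p * p') := by
  classical
  intro m e he
  rw [coeff_mul]
  refine sum_mem fun s hs => ?_
  rw [Finset.HasAntidiagonal.mem_antidiagonal] at hs
  have hdeg : s.1.degree + s.2.degree = m.degree := by rw [← hs, map_add]
  have h1 := h s.1 (a + 1 - s.1.degree) (by omega)
  have h2 := h' s.2 (b + 1 - s.2.degree) (by omega)
  rcases Nat.eq_zero_or_pos (b + 1 - s.2.degree) with hb | hb
  · rw [hb] at h2
    rw [mem_degreeLT_zero h2, mul_zero]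
    exact zero_mem _
  · rcases Nat.eq_zero_or_pos (a + 1 - s.1.degree) with ha | ha
    · rw [ha] at h1
      rw [mem_degreeLT_zero h1, zero_mul]
      exact zero_mem _
    · rw [show b + 1 - s.2.degree = b - s.2.degree + 1 by omega] at h2
      exact degreeLT_mono (by omega) (mul_mem_degreeLT h1 h2)

theorem prod {ι : Type*} (s : Finset ι) {d : ι → ℕ}
    {p : ι → MvPolynomial (Fin n) (MvPolynomial (Fin n) R)}
    (h : ∀ i ∈ s, BidegreeLT (d i + 1) (p i)) : BidegreeLT (∑ i ∈ s, d i + 1) (∏ i ∈ s, p i) := by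
  classical
  induction s using Finset.induction_on with
  | empty => simpa using one
  | insert i s hi ih =>
    rw [Finset.sum_insert hi, Finset.prod_insert hi]
    exact (h i (Finset.mem_insert_self i s)).mul
      (ih fun j hj => h j (Finset.mem_insert_of_mem hj))

end BidegreeLT

theorem bidegreeLT_innerVarSeq (i : ℕ) : BidegreeLT 2 (innerVarSeq R n i) := by
  rw [innerVarSeq, varSeq, extend]
  split_ifs
  · exact BidegreeLT.C (mem_degreeLT_of_isHomogeneous (isHomogeneous_X R _))
  · rw [map_zero]
    exact BidegreeLT.zero

theorem bidegreeLT_param (q : Fin (n - 1) → R) (i : ℕ) :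
    BidegreeLT 1 (C (paramSeq q i) : MvPolynomial (Fin n) (MvPolynomial (Fin n) R)) := by
  rw [paramSeq, extend]
  split_ifs
  · exact BidegreeLT.C (mem_degreeLT_of_isHomogeneous (isHomogeneous_C (Fin n) _))
  · rw [map_zero]
    exact BidegreeLT.zero

theorem bidegreeLT_continuant (q : Fin (n - 1) → R) (j : Fin n) (k : ℕ) :
    BidegreeLT (k + 1) (quantumDelta (innerVarSeq R n)
      (fun i => (C (paramSeq q i) : MvPolynomial (Fin n) (MvPolynomial (Fin n) R))) k (X j)) := by
  induction k using Nat.strong_induction_on with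
  | _ k ih =>
  match k with
  | 0 => rw [quantumDelta_zero]; exact BidegreeLT.one
  | 1 => rw [quantumDelta_one]; exact (bidegreeLT_innerVarSeq 0).add (BidegreeLT.X j)
  | k + 2 =>
    rw [quantumDelta_add_two]
    have h1 := ((bidegreeLT_innerVarSeq (k + 1)).add (BidegreeLT.X j)).mul (a := 1)
      (ih (k + 1) (by omega))
    have h2 := (bidegreeLT_param q k).mul (a := 0) (ih k (by omega))
    exact (h1.mono (by omega)).add (h2.mono (by omega))

theorem sum_reflect_eq_inversionNumber_longest (n : ℕ) :
    ∑ j : Fin n, (n - 1 - (j : ℕ)) = inversionNumber (longest n) := by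
  rw [Fin.sum_univ_eq_sum_range (fun k => n - 1 - k), Finset.sum_range_reflect (fun k => k),
    ← inversionNumber_longest]

theorem bidegreeLT_quantumDoubleTop (q : Fin (n - 1) → R) :
    BidegreeLT (inversionNumber (longest n) + 1) (quantumDoubleTop q) := by
  rw [quantumDoubleTop_eq, deltaProd, ← sum_reflect_eq_inversionNumber_longest]
  refine BidegreeLT.prod _ fun j _ => ?_
  rw [aeval_continuantPoly]
  exact bidegreeLT_continuant q j _

theorem hasTopForm_continuant_zero (q : Fin (n - 1) → R) (k : ℕ) (hk : k ≤ n) :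
    HasTopForm k (∏ i ∈ Finset.range k, varSeq R n i)
      (quantumDelta (varSeq R n) (paramSeq q) k 0) := by
  constructor
  · have := IsHomogeneous.prod (Finset.range k) (fun i => varSeq R n i) (fun _ => 1)
      fun i hi => by
        have := Finset.mem_range.mp hi
        rw [varSeq, extend, dif_pos (by omega)]
        exact isHomogeneous_X R _
    simpa using this
  · have h := (coeffDegreeLT_deltaPoly q k hk).2 0 k (by omega)
    rw [Polynomial.coeff_zero_eq_eval_zero, Polynomial.eval_sub, Polynomial.eval_prod] at h
    convert h using 2
    · rw [deltaPoly, ← Polynomial.coe_evalRingHom, map_quantumDelta]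
      simp only [map_extend]
      simp
    · refine Finset.prod_congr rfl fun i _ => ?_
      rw [Polynomial.eval_add, Polynomial.eval_X, zero_add, ← Polynomial.coe_evalRingHom,
        map_extend]
      simp

/-- The variable `X i` occurs in the factor `j` exactly when `i + j < n - 1`, a condition symmetric
in `i` and `j`. -/
theorem prod_prod_varSeq :
    ∏ j : Fin n, ∏ i ∈ Finset.range (n - 1 - j), varSeq R n i = staircase R n := by
  have h1 : ∀ j : Fin n, ∏ i ∈ Finset.range (n - 1 - j), varSeq R n i
      = ∏ i : Fin n, if (i : ℕ) < n - 1 - j then X i else 1 := by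
    intro j
    rw [← Finset.prod_filter]
    refine (Finset.prod_bij (fun (i : Fin n) _ => (i : ℕ)) ?_ ?_ ?_ ?_).symm
    · simp
    · exact fun a _ b _ h => Fin.ext h
    · intro b hb
      have := Finset.mem_range.mp hb
      exact ⟨⟨b, by omega⟩, by simpa using this, rfl⟩
    · intro i _
      rw [varSeq, extend, dif_pos i.2]
  simp_rw [h1]
  rw [Finset.prod_comm, staircase]
  refine Finset.prod_congr rfl fun i _ => ?_
  rw [← Finset.prod_filter, Finset.prod_const]
  congr 1
  have : Finset.univ.filter (fun j : Fin n => (i : ℕ) < n - 1 - j)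
      = Finset.univ.filter fun j : Fin n => (j : ℕ) < n - 1 - i := by
    ext j
    simp
    omega
  rw [this, Fin.card_filter_val_lt]
  have := i.2
  omega

end Bidegree

/-! ### Divided differences and degrees -/

section DegreeBounds

variable {R : Type*} [CommRing R] [IsDomain R] {n : ℕ}

theorem wordDividedDifference_isHomogeneous (l : List (Fin (n - 1))) {f : MvPolynomial (Fin n) R}
    {d : ℕ} (h : f.IsHomogeneous (d + l.length)) : (wordDividedDifference l f).IsHomogeneous d := by
  induction l generalizing d with
  | nil => exact h
  | cons i l ih =>
    refine simpleDividedDifference_isHomogeneous (ih ?_)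
    rwa [List.length_cons, ← add_assoc, add_right_comm] at h

theorem wordDividedDifference_eq_zero (l : List (Fin (n - 1))) {f : MvPolynomial (Fin n) R}
    {d : ℕ} (h : f.IsHomogeneous d) (hd : d < l.length) : wordDividedDifference l f = 0 := by
  induction l with
  | nil => exact absurd hd (Nat.not_lt_zero _)
  | cons i l ih =>
    change simpleDividedDifference i (wordDividedDifference l f) = 0
    rcases Nat.lt_succ_iff_lt_or_eq.mp hd with h' | h'
    · rw [ih h', simpleDividedDifference_zero]
    · have h1 := wordDividedDifference_isHomogeneous (d := 0) l (f := f) (by rwa [zero_add, ← h'])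
      rw [totalDegree_eq_zero_iff_eq_C.mp (Nat.le_zero.mp h1.totalDegree_le)]
      exact simpleDividedDifference_eq_zero (by simp [act])

theorem constantCoeff_dividedDifference_of_isHomogeneous {w : Equiv.Perm (Fin n)}
    {f : MvPolynomial (Fin n) R} {d : ℕ} (h : f.IsHomogeneous d) (hd : d ≠ inversionNumber w) :
    constantCoeff (dividedDifference w f) = 0 := by
  rcases lt_or_gt_of_ne hd with hd | hd
  · obtain ⟨l, -, hlen, hw⟩ := exists_dividedDifference_eq_word (R := R) w
    rw [hw, wordDividedDifference_eq_zero l h (by omega), map_zero]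
  · obtain ⟨k, rfl⟩ := Nat.exists_eq_add_of_lt hd
    refine constantCoeff_of_isHomogeneous (d := k + 1) (dividedDifference_isHomogeneous ?_)
      (Nat.succ_ne_zero k)
    rwa [add_comm, ← add_assoc]

theorem topCoeff_of_mem_degreeLT {f : MvPolynomial (Fin n) R}
    (h : f ∈ degreeLT R (Fin n) (inversionNumber (longest n))) : topCoeff R n f = 0 := by
  rw [f.as_sum, map_sum]
  refine Finset.sum_eq_zero fun m hm => ?_
  refine constantCoeff_dividedDifference_of_isHomogeneous (isHomogeneous_monomial _ rfl) ?_
  intro hd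
  exact (mem_support_iff.mp hm) (h m hd.ge)

/-- The constant term after `∂_{uw₀}` in `y` only sees monomials whose degree in `y` is the length
of `uw₀`. The total degree of the top polynomial leaves at most the length of `u` for `x`. -/
theorem quantumSchubert_mem_degreeLT (q : Fin (n - 1) → R) (u : Equiv.Perm (Fin n)) :
    quantumSchubert q u ∈ degreeLT R (Fin n) (inversionNumber u + 1) := by
  have h : quantumSchubert q u = ∑ m ∈ (quantumDoubleTop q).support, coeff m (quantumDoubleTop q)
      * C (constantCoeff (dividedDifference (u * longest n) (monomial m (1 : R)))) := by
    conv_lhs => rw [quantumSchubert, quantumDoubleSchubert, (quantumDoubleTop q).as_sum,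
      dividedDifference_sum, map_sum]
    refine Finset.sum_congr rfl fun m _ => ?_
    rw [show monomial m (coeff m (quantumDoubleTop q))
      = C (coeff m (quantumDoubleTop q)) * map C (monomial m (1 : R)) by
        rw [map_monomial, map_one, C_mul_monomial, mul_one],
      dividedDifference_mul (IsSymmetric.C _), map_mul, constantCoeff_C, ← map_dividedDifference,
      constantCoeff_map]
  rw [h]
  refine sum_mem fun m _ => ?_
  by_cases hm : m.degree = inversionNumber (u * longest n)
  · rw [mul_comm, ← smul_eq_C_mul]
    refine Submodule.smul_mem _ _ (bidegreeLT_quantumDoubleTop q m _ ?_)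
    have := inversionNumber_mul_longest u
    omega
  · rw [constantCoeff_dividedDifference_of_isHomogeneous (isHomogeneous_monomial _ rfl) hm,
      map_zero, mul_zero]
    exact zero_mem _

/-- For `u ≠ w₀` the degree is too small; for `u = w₀` the top form is the staircase monomial. -/
theorem topCoeff_quantumSchubert (q : Fin (n - 1) → R) (u : Equiv.Perm (Fin n)) :
    topCoeff R n (quantumSchubert q u) = if u = longest n then 1 else 0 := by
  split_ifs with hu
  · have h1 : HasTopForm (inversionNumber (longest n)) (staircase R n) (quantumSchubert q u) := by
      rw [← sum_reflect_eq_inversionNumber_longest, ← prod_prod_varSeq, hu, quantumSchubert,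
        quantumDoubleSchubert]
      change HasTopForm _ _ (constantCoeff (dividedDifference (longest n * longest n) _))
      rw [longest_mul_self, dividedDifference_one, quantumDoubleTop_eq, deltaProd, map_prod]
      refine HasTopForm.prod _ fun j _ => ?_
      rw [aeval_continuantPoly, map_quantumDelta, constantCoeff_X]
      simp only [algebraMap_eq, constantCoeff_C]
      exact hasTopForm_continuant_zero q _ (by omega)
    have h2 := topCoeff_of_mem_degreeLT h1.2
    rwa [map_sub, topCoeff_staircase, sub_eq_zero] at h2
  · refine topCoeff_of_mem_degreeLT (degreeLT_mono ?_ (quantumSchubert_mem_degreeLT q u))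
    have h1 := inversionNumber_le u
    rcases h1.lt_or_eq with h | h
    · exact h
    · exact absurd (eq_longest_of_inversionNumber h) hu

end DegreeBounds

end ToyGW

end

noncomputable section

namespace ToyGW

open MvPolynomial

/-! ### Application of a linear form to the coefficients -/

section ApplyCoeff

variable {R : Type*} [CommRing R] {n : ℕ}

/-- The polynomial obtained by applying a linear form to the coefficients. -/
def applyCoeff (η : MvPolynomial (Fin n) R →ₗ[R] R)
    (p : MvPolynomial (Fin n) (MvPolynomial (Fin n) R)) : MvPolynomial (Fin n) R :=
  ∑ m ∈ p.support, monomial m (η (coeff m p))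

variable (η : MvPolynomial (Fin n) R →ₗ[R] R)

theorem coeff_applyCoeff (p : MvPolynomial (Fin n) (MvPolynomial (Fin n) R)) (m : Fin n →₀ ℕ) :
    coeff m (applyCoeff η p) = η (coeff m p) := by
  classical
  rw [applyCoeff, coeff_sum]
  simp only [coeff_monomial]
  rw [Finset.sum_ite_eq' p.support m fun k => η (coeff k p)]
  split_ifs with h
  · rfl
  · rw [notMem_support_iff.mp h, map_zero]

theorem applyCoeff_add (p p' : MvPolynomial (Fin n) (MvPolynomial (Fin n) R)) :
    applyCoeff η (p + p') = applyCoeff η p + applyCoeff η p' := by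
  ext m
  simp [coeff_applyCoeff]

theorem applyCoeff_sub (p p' : MvPolynomial (Fin n) (MvPolynomial (Fin n) R)) :
    applyCoeff η (p - p') = applyCoeff η p - applyCoeff η p' := by
  ext m
  simp [coeff_applyCoeff]

theorem applyCoeff_sum {ι : Type*} (s : Finset ι)
    (p : ι → MvPolynomial (Fin n) (MvPolynomial (Fin n) R)) :
    applyCoeff η (∑ i ∈ s, p i) = ∑ i ∈ s, applyCoeff η (p i) := by
  ext m
  simp [coeff_applyCoeff, coeff_sum]

theorem applyCoeff_mul_map_C (p : MvPolynomial (Fin n) (MvPolynomial (Fin n) R))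
    (g : MvPolynomial (Fin n) R) : applyCoeff η (p * map C g) = applyCoeff η p * g := by
  classical
  ext m
  rw [coeff_applyCoeff, coeff_mul, coeff_mul, map_sum]
  refine Finset.sum_congr rfl fun s _ => ?_
  rw [coeff_map, mul_comm, ← smul_eq_C_mul, map_smul, smul_eq_mul, coeff_applyCoeff, mul_comm]

theorem applyCoeff_C (f : MvPolynomial (Fin n) R) : applyCoeff η (C f) = C (η f) := by
  classical
  ext m
  rw [coeff_applyCoeff, coeff_C, coeff_C]
  split_ifs
  · rfl
  · exact map_zero η

theorem applyCoeff_mem_of_mem_map_map {I : Ideal (MvPolynomial (Fin n) R)}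
    {p : MvPolynomial (Fin n) (MvPolynomial (Fin n) R)} (hp : p ∈ I.map (map C)) :
    applyCoeff η p ∈ I := by
  -- `applyCoeff η` is linear over polynomials in `y` but not over those in `x`, so the induction
  -- must carry arbitrary multiples.
  suffices h : ∀ a, applyCoeff η (a * p) ∈ I by simpa using h 1
  induction hp using Submodule.span_induction with
  | mem x hx =>
    obtain ⟨g, hg, rfl⟩ := hx
    intro a
    rw [applyCoeff_mul_map_C]
    exact Ideal.mul_mem_left _ _ hg
  | zero => simp [applyCoeff]
  | add x y _ _ hx hy =>
    intro a
    rw [mul_add, applyCoeff_add]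
    exact Ideal.add_mem _ (hx a) (hy a)
  | smul b x _ hx =>
    intro a
    rw [smul_eq_mul, ← mul_assoc]
    exact hx _

theorem applyCoeff_of_mem_map_C {I : Ideal (MvPolynomial (Fin n) R)} (hI : ∀ f ∈ I, η f = 0)
    {p : MvPolynomial (Fin n) (MvPolynomial (Fin n) R)} (hp : p ∈ I.map C) :
    applyCoeff η p = 0 := by
  rw [mem_map_C_iff] at hp
  ext m
  rw [coeff_applyCoeff, hI _ (hp m), coeff_zero]

end ApplyCoeff

/-! ### The Casimir property of Bezoutians -/

section Casimir

variable {R : Type*} [CommRing R] {n : ℕ}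

theorem mixedEval_top (f : MvPolynomial (Fin n) R) : mixedEval R n n f = C f := by
  rw [mixedEval]
  induction f using MvPolynomial.induction_on with
  | C r => rw [algHom_C]; rfl
  | add p p' h h' => rw [map_add, h, h', map_add]
  | mul_X p j h => rw [map_mul, h, aeval_X, if_pos j.2, map_mul]

theorem mixedEval_zero (f : MvPolynomial (Fin n) R) : mixedEval R n 0 f = map C f := by
  rw [mixedEval]
  induction f using MvPolynomial.induction_on with
  | C r => rw [algHom_C, map_C]; rfl
  | add p p' h h' => rw [map_add, h, h', map_add]
  | mul_X p j h => rw [map_mul, h, aeval_X, if_neg (Nat.not_lt_zero _), map_mul, map_X]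

theorem sum_bezoutian_entry_mul (g : MvPolynomial (Fin n) R) :
    ∑ j : Fin n, Classical.choose (dvd_mixedEval_sub j g) * (C (X j) - X j) = C g - map C g := by
  have h1 : ∀ j : Fin n, Classical.choose (dvd_mixedEval_sub j g) * (C (X j) - X j)
      = mixedEval R n (j + 1) g - mixedEval R n j g := by
    intro j
    rw [mul_comm]
    exact (Classical.choose_spec (dvd_mixedEval_sub j g)).symm
  simp_rw [h1]
  rw [Fin.sum_univ_eq_sum_range (fun j => mixedEval R n (j + 1) g - mixedEval R n j g),
    Finset.sum_range_sub fun j => mixedEval R n j g, mixedEval_top, mixedEval_zero]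

/-- Multiplications in `x` and in `y` agree on the Bezoutian modulo the two ideals. -/
theorem sub_mul_bezoutian_mem (g : Fin n → MvPolynomial (Fin n) R) (f : MvPolynomial (Fin n) R) :
    (C f - map C f) * bezoutian g ∈ (Ideal.span (Set.range g)).map C
      ⊔ (Ideal.span (Set.range g)).map (map C) := by
  set J := (Ideal.span (Set.range g)).map C ⊔ (Ideal.span (Set.range g)).map (map C) with hJ
  set B : Matrix (Fin n) (Fin n) (MvPolynomial (Fin n) (MvPolynomial (Fin n) R)) :=
    Matrix.of fun i j : Fin n => Classical.choose (dvd_mixedEval_sub j (g i)) with hB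
  set v : Fin n → MvPolynomial (Fin n) (MvPolynomial (Fin n) R) := fun j => C (X j) - X j with hv
  -- Cramer's rule: `adj B · B = det B`, and `B` sends the vector of the differences `x_j - y_j` to
  -- that of the differences `g_i(x) - g_i(y)`.
  have hX : ∀ j, v j * B.det ∈ J := by
    intro j
    have h1 : (B.adjugate.mulVec (B.mulVec v)) j = v j * B.det := by
      rw [Matrix.mulVec_mulVec, Matrix.adjugate_mul, Matrix.smul_mulVec, Matrix.one_mulVec,
        Pi.smul_apply, smul_eq_mul, mul_comm]
    rw [← h1, Matrix.mulVec, dotProduct]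
    refine Ideal.sum_mem _ fun i _ => Ideal.mul_mem_left _ _ ?_
    have h2 : B.mulVec v i = C (g i) - map C (g i) := sum_bezoutian_entry_mul (g i)
    rw [h2]
    exact Ideal.sub_mem _
      (Ideal.mem_sup_left (Ideal.mem_map_of_mem _ (Ideal.subset_span ⟨i, rfl⟩)))
      (Ideal.mem_sup_right (Ideal.mem_map_of_mem _ (Ideal.subset_span ⟨i, rfl⟩)))
  change (C f - map C f) * B.det ∈ J
  induction f using MvPolynomial.induction_on with
  | C r => rw [map_C, sub_self, zero_mul]; exact zero_mem _
  | add p p' h h' =>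
    convert Ideal.add_mem _ h h' using 1
    rw [map_add, map_add]
    ring
  | mul_X p j h =>
    convert Ideal.add_mem _ (Ideal.mul_mem_left _ (C (X j)) h)
      (Ideal.mul_mem_left _ (map C p) (hX j)) using 1
    rw [map_mul, map_mul, map_X, hv]
    ring

theorem applyCoeff_C_mul_bezoutian_sub (q : Fin (n - 1) → R) (η : MvPolynomial (Fin n) R →ₗ[R] R)
    (hη : ∀ f ∈ quantumIdeal q, η f = 0) (f : MvPolynomial (Fin n) R) :
    applyCoeff η (C f * bezoutian (quantumElementary q))
      - f * applyCoeff η (bezoutian (quantumElementary q)) ∈ quantumIdeal q := by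
  rw [mul_comm f, ← applyCoeff_mul_map_C, ← applyCoeff_sub, mul_comm _ (map C f), ← sub_mul]
  obtain ⟨a, ha, b, hb, hab⟩ := Submodule.mem_sup.mp
    (sub_mul_bezoutian_mem (quantumElementary q) f)
  rw [← hab, applyCoeff_add, applyCoeff_of_mem_map_C η hη ha, zero_add]
  exact applyCoeff_mem_of_mem_map_map η hb

end Casimir

/-! ### The residue form and the duality of quantum Schubert polynomials -/

section Residue

variable {R : Type*} [CommRing R] [IsDomain R] {n : ℕ} (q : Fin (n - 1) → R)

/-- The residue form: the coordinate of the staircase monomial modulo the quantum ideal. -/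
def residueForm : MvPolynomial (Fin n) R →ₗ[R] R := classicalCoord q (longest n)

theorem residueForm_of_mem {f : MvPolynomial (Fin n) R} (h : f ∈ quantumIdeal q) :
    residueForm q f = 0 := classicalCoord_of_mem q _ h

/-- In degrees up to the length of `w₀` the deformed basis differs from the classical one by terms
of smaller degree, which `topCoeff` does not see. It suffices to compare the two forms on basis
elements. -/
theorem residueForm_eq_topCoeff {f : MvPolynomial (Fin n) R}
    (h : f ∈ degreeLT R (Fin n) (inversionNumber (longest n) + 1)) :
    residueForm q f = topCoeff R n f := by
  have h1 := HasTopForm.degreeLT_le_span (schubertMonomial_hasTopForm q)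
    schubertMonomial_esymm_span _ h
  refine LinearMap.eqOn_span (f := residueForm q) (g := topCoeff R n) ?_ h1
  rintro _ ⟨s, hs, rfl⟩
  have h2 := topCoeff_of_mem_degreeLT
    (degreeLT_mono (Nat.lt_succ_iff.mp hs) (schubertMonomial_hasTopForm q s).2)
  rw [map_sub, sub_eq_zero] at h2
  rw [h2, residueForm, classicalCoord_schubertMonomial]
  obtain ⟨w, J⟩ := s
  by_cases hJ : J = 0
  · subst hJ
    rw [schubertMonomial_zero, topCoeff_classicalSchubert]
    simp
  · rw [if_neg (by simp [hJ]), topCoeff_of_mem]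
    obtain ⟨i, hi⟩ := DFunLike.ne_iff.mp hJ
    refine Ideal.mul_mem_right _ _ (Ideal.mem_of_dvd _ ?_
      (Ideal.subset_span ⟨i, rfl⟩ : esymm (Fin n) R (i + 1) ∈ symmetricIdeal R n))
    exact (dvd_pow_self _ hi).trans
      (Finset.dvd_prod_of_mem (fun i : Fin n => esymm (Fin n) R (i + 1) ^ J i)
        (Finset.mem_univ i))

theorem residueForm_quantumSchubert (u : Equiv.Perm (Fin n)) :
    residueForm q (quantumSchubert q u) = if u = longest n then 1 else 0 := by
  rw [residueForm_eq_topCoeff, topCoeff_quantumSchubert]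
  exact degreeLT_mono (Nat.succ_le_succ (inversionNumber_le u)) (quantumSchubert_mem_degreeLT q u)

variable [CharZero R]

theorem quantumSchubert_one : quantumSchubert q 1 = 1 := by
  rw [quantumSchubert, quantumDoubleSchubert, one_mul, quantumDoubleTop_eq]
  exact topCoeff_deltaProd n _ _

theorem applyCoeff_C_mul_bezoutian (hq : ∀ i, q i ≠ 0) (η : MvPolynomial (Fin n) R →ₗ[R] R)
    (f : MvPolynomial (Fin n) R) :
    applyCoeff η (C f * bezoutian (quantumElementary q))
      - ∑ u, C (η (f * quantumSchubert q u)) * quantumSchubert q (longest n * u)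
      ∈ quantumIdeal q := by
  have h1 := Ideal.mul_mem_left _ (C f) (bezoutian_sub_sum_mem q hq)
  rw [← map_quantumIdeal] at h1
  have h2 := applyCoeff_mem_of_mem_map_map η h1
  rw [mul_sub, applyCoeff_sub, Finset.mul_sum, applyCoeff_sum] at h2
  simp_rw [← mul_assoc, ← C_mul, applyCoeff_mul_map_C, applyCoeff_C] at h2
  exact h2

/-- In the Cauchy formula only `u = w₀` has a nonzero residue, and its partner is `S_1 = 1`. -/
theorem applyCoeff_residueForm_bezoutian (hq : ∀ i, q i ≠ 0) :
    applyCoeff (residueForm q) (bezoutian (quantumElementary q)) - 1 ∈ quantumIdeal q := by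
  have h := applyCoeff_C_mul_bezoutian q hq (residueForm q) 1
  simp_rw [C_1, one_mul, residueForm_quantumSchubert] at h
  rwa [Finset.sum_eq_single (longest n) (fun u _ hu => by rw [if_neg hu, C_0, zero_mul])
    (by simp), if_pos rfl, longest_mul_self, quantumSchubert_one, C_1, one_mul] at h

/-- With the residue taken in `x`, modulo the ideal: `f ≡ f · ⟨Bez⟩ ≡ ⟨f(x) Bez⟩`, and the Cauchy
formula evaluates the right side. -/
theorem sub_sum_residueForm_mem (hq : ∀ i, q i ≠ 0) (f : MvPolynomial (Fin n) R) :
    f - ∑ u, C (residueForm q (f * quantumSchubert q u)) * quantumSchubert q (longest n * u)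
      ∈ quantumIdeal q := by
  have h1 := applyCoeff_C_mul_bezoutian q hq (residueForm q) f
  have h2 := applyCoeff_C_mul_bezoutian_sub q (residueForm q) (fun _ => residueForm_of_mem q) f
  have h3 := Ideal.mul_mem_left _ f (applyCoeff_residueForm_bezoutian q hq)
  convert Ideal.sub_mem _ (Ideal.sub_mem _ h1 h2) h3 using 1
  ring

theorem sub_sum_residueForm_mem' (hq : ∀ i, q i ≠ 0) (f : MvPolynomial (Fin n) R) :
    f - ∑ u, C (residueForm q (f * quantumSchubert q (longest n * u))) * quantumSchubert q u
      ∈ quantumIdeal q := by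
  have h := sub_sum_residueForm_mem q hq f
  rw [← Equiv.sum_comp (Equiv.mulLeft (longest n))] at h
  simpa only [Equiv.coe_mulLeft, longest_mul_longest_mul] using h

/-- The quantum Schubert polynomials of `v` and `w₀ v` are dual to each other. -/
theorem residueForm_quantumSchubert_mul (hq : ∀ i, q i ≠ 0) (v u : Equiv.Perm (Fin n)) :
    residueForm q (quantumSchubert q v * quantumSchubert q (longest n * u))
      = if v = u then 1 else 0 := by
  set N : Matrix (Equiv.Perm (Fin n)) (Equiv.Perm (Fin n)) R := Matrix.of fun v u =>
    residueForm q (classicalSchubert R v * quantumSchubert q (longest n * u)) with hN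
  set M : Matrix (Equiv.Perm (Fin n)) (Equiv.Perm (Fin n)) R := Matrix.of fun u w =>
    classicalCoord q w (quantumSchubert q u) with hM
  -- The reproducing formula, read in classical coordinates, says that `N` is a left inverse of `M`.
  -- For square matrices it is also a right inverse, and the entries of `M * N` are the pairings
  -- sought.
  have hNM : N * M = 1 := by
    ext v w
    have h := classicalCoord_of_mem q w (sub_sum_residueForm_mem' q hq (classicalSchubert R v))
    rw [map_sub, sub_eq_zero, classicalCoord_classicalSchubert, map_sum] at h
    simp_rw [← smul_eq_C_mul, map_smul, smul_eq_mul] at h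
    rw [Matrix.mul_apply, Matrix.one_apply]
    simp_rw [eq_comm (a := v)]
    exact h.symm
  have hMN := mul_eq_one_comm.mp hNM
  have h1 := congrFun (congrFun hMN v) u
  rw [Matrix.mul_apply, Matrix.one_apply] at h1
  rw [← h1]
  have h2 := residueForm_of_mem q (Ideal.mul_mem_right (quantumSchubert q (longest n * u)) _
    (sub_sum_classicalCoord_mem q (quantumSchubert q v)))
  rw [sub_mul, map_sub, sub_eq_zero, Finset.sum_mul, map_sum] at h2
  simp_rw [mul_assoc, ← smul_eq_C_mul, map_smul, smul_eq_mul] at h2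
  exact h2

theorem isGrothendieckResidue_residueForm (hq : ∀ i, q i ≠ 0) :
    IsGrothendieckResidue (quantumElementary q) (residueForm q) :=
  ⟨fun _ => residueForm_of_mem q, applyCoeff_residueForm_bezoutian q hq⟩

/-- The normalization of `η` gives `1 ≡ ∑ η(S_u) S_{w₀u}`. Pairing with `S_v` shows `η(S_v) =
⟨S_v⟩`, and the `S_v` span modulo the ideal. -/
theorem IsGrothendieckResidue.eq_residueForm (hq : ∀ i, q i ≠ 0)
    {η : MvPolynomial (Fin n) R →ₗ[R] R} (h : IsGrothendieckResidue (quantumElementary q) η) :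
    η = residueForm q := by
  obtain ⟨h1, h2⟩ := h
  have h3 := applyCoeff_C_mul_bezoutian q hq η 1
  simp_rw [C_1, one_mul] at h3
  have h4 : 1 - ∑ u, C (η (quantumSchubert q u)) * quantumSchubert q (longest n * u)
      ∈ quantumIdeal q := by
    have h5 : applyCoeff η (bezoutian (quantumElementary q)) - 1 ∈ quantumIdeal q := h2
    convert Ideal.sub_mem _ h3 h5 using 1
    ring
  have h5 : ∀ v, η (quantumSchubert q v) = residueForm q (quantumSchubert q v) := by
    intro v
    have h6 := residueForm_of_mem q (Ideal.mul_mem_left _ (quantumSchubert q v) h4)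
    rw [mul_sub, mul_one, Finset.mul_sum, map_sub, sub_eq_zero, map_sum] at h6
    simp_rw [← smul_eq_C_mul, mul_smul_comm, map_smul, residueForm_quantumSchubert_mul q hq] at h6
    simpa using h6.symm
  refine LinearMap.ext fun f => ?_
  have h6 := sub_sum_residueForm_mem' q hq f
  have h7 := h1 _ h6
  have h8 := residueForm_of_mem q h6
  rw [map_sub, sub_eq_zero, map_sum] at h7 h8
  rw [h7, h8]
  simp_rw [← smul_eq_C_mul, map_smul, h5]

theorem existsUnique_isGrothendieckResidue (hq : ∀ i, q i ≠ 0) :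
    ∃! η : MvPolynomial (Fin n) R →ₗ[R] R, IsGrothendieckResidue (quantumElementary q) η :=
  ⟨residueForm q, isGrothendieckResidue_residueForm q hq, fun _ h => h.eq_residueForm q hq⟩

theorem grothendieckResidue_eq (hq : ∀ i, q i ≠ 0) :
    grothendieckResidue (quantumElementary q) = residueForm q :=
  (Classical.epsilon_spec (p := IsGrothendieckResidue (quantumElementary q))
    ⟨_, isGrothendieckResidue_residueForm q hq⟩).eq_residueForm q hq

end Residue

end ToyGW

end

noncomputable section

namespace ToyGW

open MvPolynomial

/-! ### Infinite sums of power series -/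

section InfiniteSum

variable {σ S : Type*} [DecidableEq σ] [CommRing S]

theorem sum_antidiagonal_assoc {M : Type*} [AddCommMonoid M] (k : σ →₀ ℕ)
    (F : (σ →₀ ℕ) → (σ →₀ ℕ) → (σ →₀ ℕ) → M) :
    ∑ s ∈ Finset.HasAntidiagonal.antidiagonal k, ∑ r ∈ Finset.HasAntidiagonal.antidiagonal s.1, F r.1 r.2 s.2
      = ∑ s ∈ Finset.HasAntidiagonal.antidiagonal k, ∑ r ∈ Finset.HasAntidiagonal.antidiagonal s.2, F s.1 r.1 r.2 := by
  simp only [Finset.sum_sigma']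
  refine Finset.sum_nbij' (fun s => ⟨(s.2.1, s.2.2 + s.1.2), (s.2.2, s.1.2)⟩)
    (fun s => ⟨(s.1.1 + s.2.1, s.2.2), (s.1.1, s.2.1)⟩) ?_ ?_ ?_ ?_ ?_
  · rintro ⟨⟨a, b⟩, ⟨c, d⟩⟩ h
    simp only [Finset.mem_sigma, Finset.HasAntidiagonal.mem_antidiagonal] at h ⊢
    rw [← h.1, ← h.2]
    exact ⟨(add_assoc _ _ _).symm, trivial⟩
  · rintro ⟨⟨a, b⟩, ⟨c, d⟩⟩ h
    simp only [Finset.mem_sigma, Finset.HasAntidiagonal.mem_antidiagonal] at h ⊢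
    rw [← h.1, ← h.2]
    exact ⟨add_assoc _ _ _, trivial⟩
  · rintro ⟨⟨a, b⟩, ⟨c, d⟩⟩ h
    simp only [Finset.mem_sigma, Finset.HasAntidiagonal.mem_antidiagonal] at h
    obtain ⟨-, rfl⟩ := h
    rfl
  · rintro ⟨⟨a, b⟩, ⟨c, d⟩⟩ h
    simp only [Finset.mem_sigma, Finset.HasAntidiagonal.mem_antidiagonal] at h
    obtain ⟨-, rfl⟩ := h
    rfl
  · intro s _
    rfl

/-- The infinite sum `∑_i T ^ i * h i` of power series. -/
def infSum (h : (σ →₀ ℕ) → MvPowerSeries σ S) : MvPowerSeries σ S :=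
  fun k => ∑ s ∈ Finset.HasAntidiagonal.antidiagonal k, MvPowerSeries.coeff s.2 (h s.1)

theorem coeff_infSum (h : (σ →₀ ℕ) → MvPowerSeries σ S) (k : σ →₀ ℕ) :
    MvPowerSeries.coeff k (infSum h)
      = ∑ s ∈ Finset.HasAntidiagonal.antidiagonal k, MvPowerSeries.coeff s.2 (h s.1) := rfl

theorem infSum_add (h h' : (σ →₀ ℕ) → MvPowerSeries σ S) :
    infSum (fun i => h i + h' i) = infSum h + infSum h' := by
  ext k
  simp [coeff_infSum, Finset.sum_add_distrib]

theorem infSum_sub (h h' : (σ →₀ ℕ) → MvPowerSeries σ S) :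
    infSum (fun i => h i - h' i) = infSum h - infSum h' := by
  ext k
  simp [coeff_infSum]

theorem infSum_sum {ι : Type*} (s : Finset ι) (h : ι → (σ →₀ ℕ) → MvPowerSeries σ S) :
    infSum (fun i => ∑ j ∈ s, h j i) = ∑ j ∈ s, infSum (h j) := by
  ext k
  simp only [coeff_infSum, map_sum]
  rw [Finset.sum_comm]

theorem infSum_mul (h : (σ →₀ ℕ) → MvPowerSeries σ S) (c : MvPowerSeries σ S) :
    infSum (fun i => h i * c) = infSum h * c := by
  ext k
  simp only [coeff_infSum, MvPowerSeries.coeff_mul, Finset.sum_mul]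
  exact (sum_antidiagonal_assoc k fun i j b =>
    MvPowerSeries.coeff j (h i) * MvPowerSeries.coeff b c).symm

/-- The coefficients of a product with `a` are a convolution in the index; this makes `extendCoeff`
linear over `ℚ[[q, t]]`. -/
theorem infSum_convolution (a : MvPowerSeries σ S) (h : (σ →₀ ℕ) → MvPowerSeries σ S) :
    infSum (fun i => ∑ s ∈ Finset.HasAntidiagonal.antidiagonal i, MvPowerSeries.coeff s.1 a • h s.2)
      = a * infSum h := by
  ext k
  simp only [coeff_infSum, MvPowerSeries.coeff_mul, Finset.mul_sum, map_sum, map_smul, smul_eq_mul]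
  exact sum_antidiagonal_assoc k fun i j b =>
    MvPowerSeries.coeff i a * MvPowerSeries.coeff b (h j)

theorem infSum_C (f : MvPowerSeries σ S) :
    infSum (fun i => MvPowerSeries.C (MvPowerSeries.coeff i f)) = f := by
  ext k
  rw [coeff_infSum, Finset.sum_eq_single (k, 0)]
  · simp
  · rintro ⟨a, b⟩ h hne
    rw [Finset.HasAntidiagonal.mem_antidiagonal] at h
    rw [MvPowerSeries.coeff_C, if_neg]
    rintro rfl
    exact hne (by simpa using h)
  · simp

theorem infSum_single (h : (σ →₀ ℕ) → MvPowerSeries σ S) (hh : ∀ i ≠ 0, h i = 0) :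
    infSum h = h 0 := by
  ext k
  rw [coeff_infSum, Finset.sum_eq_single (0, k)]
  · rintro ⟨a, b⟩ h hne
    rw [Finset.HasAntidiagonal.mem_antidiagonal] at h
    rw [hh, map_zero]
    rintro rfl
    exact hne (by simpa using h)
  · simp

theorem map_infSum {S' : Type*} [CommRing S'] (φ : S →+* S')
    (h : (σ →₀ ℕ) → MvPowerSeries σ S) :
    MvPowerSeries.map φ (infSum h) = infSum fun i => MvPowerSeries.map φ (h i) := by
  ext k
  simp [coeff_infSum]

end InfiniteSum

/-! ### The residue form on `ℚ[x][[q, t]]` -/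

section SeriesResidue

variable {n : ℕ}

instance (n : ℕ) : IsDomain (Coef n) := NoZeroDivisors.to_isDomain _

instance (n : ℕ) : CharZero (Coef n) := algebraRat.charZero _

theorem qVar_ne_zero (i : Fin (n - 1)) : qVar n i ≠ 0 := by
  intro h
  have h1 := congrArg (MvPowerSeries.coeff (Finsupp.single (Sum.inl i) 1)) h
  simp [qVar, MvPowerSeries.coeff_X] at h1

@[simp] theorem toSeries_C (a : Coef n) : toSeries n (C a) = MvPowerSeries.map C a := by
  simp [toSeries]

@[simp] theorem toSeries_X (i : Fin n) : toSeries n (X i) = MvPowerSeries.C (X i) := by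
  simp [toSeries]

/-- The inclusion of `ℚ[x]` into `ℚ[[q, t]][x]`. -/
abbrev toPoly (n : ℕ) : MvPolynomial (Fin n) ℚ →+* Poly n := map MvPowerSeries.C

theorem toSeries_toPoly (p : MvPolynomial (Fin n) ℚ) :
    toSeries n (toPoly n p) = MvPowerSeries.C p := by
  induction p using MvPolynomial.induction_on with
  | C r => rw [map_C, toSeries_C, MvPowerSeries.map_C]
  | add p p' h h' => rw [map_add, map_add, h, h', map_add]
  | mul_X p j h => rw [map_mul, map_mul, h, map_X, toSeries_X, map_mul]

/-- The extension to `ℚ[x][[q, t]]` of a linear map from `ℚ[x]` to `ℚ[[q, t]]`. -/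
def extendCoeff (L : MvPolynomial (Fin n) ℚ →ₗ[ℚ] Coef n) : Series n →+ Coef n where
  toFun f := infSum fun i => L (MvPowerSeries.coeff i f)
  map_zero' := by
    rw [infSum_single] <;> simp
  map_add' f g := by
    simp only [map_add]
    exact infSum_add _ _

theorem extendCoeff_apply (L : MvPolynomial (Fin n) ℚ →ₗ[ℚ] Coef n) (f : Series n) :
    extendCoeff L f = infSum fun i => L (MvPowerSeries.coeff i f) := rfl

theorem extendCoeff_map_mul (L : MvPolynomial (Fin n) ℚ →ₗ[ℚ] Coef n) (a : Coef n)
    (f : Series n) : extendCoeff L (MvPowerSeries.map C a * f) = a * extendCoeff L f := by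
  rw [extendCoeff_apply, extendCoeff_apply, ← infSum_convolution]
  congr 1
  funext i
  rw [MvPowerSeries.coeff_mul, map_sum]
  refine Finset.sum_congr rfl fun s _ => ?_
  rw [MvPowerSeries.coeff_map, ← smul_eq_C_mul, map_smul]

theorem extendCoeff_C (L : MvPolynomial (Fin n) ℚ →ₗ[ℚ] Coef n) (p : MvPolynomial (Fin n) ℚ) :
    extendCoeff L (MvPowerSeries.C p) = L p := by
  rw [extendCoeff_apply, infSum_single]
  · simp
  · intro i hi
    rw [MvPowerSeries.coeff_C, if_neg hi, map_zero]

/-- The `ℚ`-linear map `p ↦ ⟨p g⟩` on `ℚ[x]`, where `⟨·⟩` is the residue form. -/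
def residueMul (g : Poly n) : MvPolynomial (Fin n) ℚ →ₗ[ℚ] Coef n where
  toFun p := residueForm (qVar n) (toPoly n p * g)
  map_add' p p' := by rw [map_add, add_mul, map_add]
  map_smul' r p := by
    rw [smul_eq_C_mul, map_mul (toPoly n), map_C, mul_assoc, ← smul_eq_C_mul, map_smul, smul_eq_mul,
      RingHom.id_apply, MvPowerSeries.smul_eq_C_mul]

theorem residueMul_apply (g : Poly n) (p : MvPolynomial (Fin n) ℚ) :
    residueMul g p = residueForm (qVar n) (toPoly n p * g) := rfl

/-- The residue form on `ℚ[x][[q, t]]`. -/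
def seriesResidue : Series n →+ Coef n := extendCoeff (residueMul 1)

/-- Reduces residues of multiples of a polynomial `g` to residues of `p g` with `p` in `ℚ[x]`; hence
both the agreement with `residueForm` and the vanishing on the ideal. -/
theorem seriesResidue_mul_toSeries (f : Series n) (g : Poly n) :
    seriesResidue (f * toSeries n g) = extendCoeff (residueMul g) f := by
  induction g using MvPolynomial.induction_on generalizing f with
  | C a =>
    rw [toSeries_C, mul_comm, seriesResidue, extendCoeff_map_mul, extendCoeff_apply, extendCoeff_apply,
      mul_comm, ← infSum_mul]
    congr 1
    funext i
    rw [residueMul_apply, residueMul_apply, mul_one, mul_comm _ (C a), ← smul_eq_C_mul, map_smul,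
      smul_eq_mul, mul_comm]
  | add g g' h h' =>
    rw [map_add, mul_add, map_add, h, h', extendCoeff_apply, extendCoeff_apply, extendCoeff_apply,
      ← infSum_add]
    congr 1
    funext i
    rw [residueMul_apply, residueMul_apply, residueMul_apply, mul_add, map_add]
  | mul_X g j h =>
    rw [map_mul (toSeries n), toSeries_X, mul_comm (toSeries n g), ← mul_assoc, h, extendCoeff_apply,
      extendCoeff_apply]
    congr 1
    funext i
    rw [residueMul_apply, residueMul_apply, MvPowerSeries.coeff_mul_C, map_mul (toPoly n), map_X,
      mul_assoc, mul_comm (X j)]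

theorem seriesResidue_toSeries (g : Poly n) :
    seriesResidue (toSeries n g) = residueForm (qVar n) g := by
  rw [← one_mul (toSeries n g), seriesResidue_mul_toSeries, ← map_one MvPowerSeries.C,
    extendCoeff_C, residueMul_apply, map_one, one_mul]

/-- The ideal of `ℚ[x][[q, t]]` generated by the quantum elementary symmetric polynomials. -/
abbrev seriesIdeal (n : ℕ) : Ideal (Series n) := (quantumIdeal (qVar n)).map (toSeries n)

theorem seriesIdeal_eq_span :
    seriesIdeal n = Ideal.span (Set.range fun i => toSeries n (quantumElementary (qVar n) i)) := by
  rw [seriesIdeal, quantumIdeal, Ideal.map_span, ← Set.range_comp]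
  rfl

theorem seriesResidue_of_mem {f : Series n} (h : f ∈ seriesIdeal n) : seriesResidue f = 0 := by
  rw [seriesIdeal_eq_span] at h
  obtain ⟨c, rfl⟩ := Ideal.mem_span_range_iff_exists_fun.mp h
  rw [map_sum]
  refine Finset.sum_eq_zero fun i _ => ?_
  rw [seriesResidue_mul_toSeries]
  have h1 : residueMul (quantumElementary (qVar n) i) = 0 := by
    refine LinearMap.ext fun p => ?_
    exact residueForm_of_mem (qVar n) (Ideal.mul_mem_left _ _ (Ideal.subset_span ⟨i, rfl⟩))
  rw [h1, extendCoeff_apply, infSum_single] <;> simp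

/-- The pairing of a power series with the quantum Schubert polynomial of `u`. -/
def pairing (f : Series n) (u : Equiv.Perm (Fin n)) : Coef n :=
  seriesResidue (f * toSeries n (schubert u))

theorem pairing_eq_infSum (f : Series n) (u : Equiv.Perm (Fin n)) :
    pairing f u = infSum fun k => residueMul (schubert u) (MvPowerSeries.coeff k f) := by
  rw [pairing, seriesResidue_mul_toSeries, extendCoeff_apply]

theorem pairing_eq_of_sub_mem {f g : Series n} (h : f - g ∈ seriesIdeal n)
    (u : Equiv.Perm (Fin n)) : pairing f u = pairing g u := by
  rw [pairing, pairing, ← sub_eq_zero, ← map_sub, ← sub_mul]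
  exact seriesResidue_of_mem (Ideal.mul_mem_right _ _ h)

theorem pairing_toSeries_sum (c : Equiv.Perm (Fin n) → Coef n) (u : Equiv.Perm (Fin n)) :
    pairing (toSeries n (∑ v, c v • schubert v)) (longest n * u) = c u := by
  rw [pairing, ← map_mul, seriesResidue_toSeries, Finset.sum_mul, map_sum]
  simp_rw [smul_mul_assoc, map_smul]
  simp only [schubert, residueForm_quantumSchubert_mul _ qVar_ne_zero]
  simp

theorem toSeries_sum_smul (c : Equiv.Perm (Fin n) → Coef n) :
    toSeries n (∑ u, c u • schubert u)
      = ∑ u, MvPowerSeries.map C (c u) * toSeries n (schubert u) := by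
  rw [map_sum]
  refine Finset.sum_congr rfl fun u _ => ?_
  rw [smul_eq_C_mul, map_mul, toSeries_C]

/-- The expansion modulo the quantum ideal in the basis of quantum Schubert polynomials. -/
theorem sub_sum_pairing_mem (f : Series n) :
    f - toSeries n (∑ u, pairing f (longest n * u) • schubert u) ∈ seriesIdeal n := by
  have h1 : ∀ k, ∃ c : Fin n → Poly n, ∑ i, c i * quantumElementary (qVar n) i
      = toPoly n (MvPowerSeries.coeff k f)
        - ∑ u, C (residueMul (schubert (longest n * u)) (MvPowerSeries.coeff k f))
          * schubert u := fun k =>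
    Ideal.mem_span_range_iff_exists_fun.mp
      (sub_sum_residueForm_mem' (qVar n) qVar_ne_zero (toPoly n (MvPowerSeries.coeff k f)))
  -- An ideal need not be closed under infinite sums. The coefficients `c k i` are therefore chosen
  -- for each `k` and summed over `k` separately for each of the finitely many generators.
  choose c hc using h1
  have h3 : ∀ k, ∑ i, toSeries n (c k i) * toSeries n (quantumElementary (qVar n) i)
      = MvPowerSeries.C (MvPowerSeries.coeff k f)
        - ∑ u, MvPowerSeries.map C (residueMul (schubert (longest n * u))
          (MvPowerSeries.coeff k f)) * toSeries n (schubert u) := by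
    intro k
    have h4 := congrArg (toSeries n) (hc k)
    rw [map_sum, map_sub, toSeries_toPoly, map_sum] at h4
    simpa only [map_mul (toSeries n), toSeries_C] using h4
  have h2 := congrArg infSum (funext h3)
  rw [infSum_sub, infSum_C, infSum_sum, infSum_sum] at h2
  simp_rw [infSum_mul, ← map_infSum, ← pairing_eq_infSum] at h2
  rw [← toSeries_sum_smul] at h2
  rw [← h2, seriesIdeal_eq_span]
  exact Ideal.sum_mem _ fun i _ => Ideal.mul_mem_left _ _ (Ideal.subset_span ⟨i, rfl⟩)

theorem mem_span_schubert_iff (g : Poly n) :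
    g ∈ Submodule.span (Coef n) (Set.range (schubert (n := n)))
      ↔ ∃ c : Equiv.Perm (Fin n) → Coef n, ∑ u, c u • schubert u = g :=
  Submodule.mem_span_range_iff_exists_fun _

theorem isProjection_iff (f : Series n) (g : Poly n) :
    IsProjection f g ↔ g = ∑ u, pairing f (longest n * u) • schubert u := by
  constructor
  · rintro ⟨h1, h2⟩
    obtain ⟨c, rfl⟩ := (mem_span_schubert_iff g).mp h1
    refine Finset.sum_congr rfl fun u _ => ?_
    rw [pairing_eq_of_sub_mem h2, pairing_toSeries_sum]
  · rintro rfl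
    exact ⟨(mem_span_schubert_iff _).mpr ⟨_, rfl⟩, sub_sum_pairing_mem f⟩

theorem existsUnique_isProjection (f : Series n) : ∃! g : Poly n, IsProjection f g :=
  ⟨_, (isProjection_iff f _).mpr rfl, fun g h => (isProjection_iff f g).mp h⟩

theorem isProjection_proj (f : Series n) : IsProjection f (proj f) :=
  Classical.epsilon_spec (existsUnique_isProjection f).exists

theorem sub_proj_mem (f : Series n) : f - toSeries n (proj f) ∈ seriesIdeal n :=
  (isProjection_proj f).2

end SeriesResidue

end ToyGW

end

noncomputable section

namespace ToyGW

open MvPolynomial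

/-! ### Derivatives with respect to the parameters `t` -/

section Derivative

variable {n : ℕ}

theorem pderiv_map {σ R S : Type*} [CommRing R] [CommRing S] (φ : R →+* S) (i : σ)
    (f : MvPowerSeries σ R) :
    MvPowerSeries.pderiv S i (MvPowerSeries.map φ f)
      = MvPowerSeries.map φ (MvPowerSeries.pderiv R i f) := by
  ext k
  simp [MvPowerSeries.coeff_pderiv]

/-- The derivation `∂/∂t_w` of `ℚ[x][[q, t]]`. -/
abbrev seriesDt (w : Equiv.Perm (Fin n)) :
    Derivation (MvPolynomial (Fin n) ℚ) (Series n) (Series n) :=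
  MvPowerSeries.pderiv (MvPolynomial (Fin n) ℚ) (Sum.inr w)

theorem seriesDt_toSeries_C (w : Equiv.Perm (Fin n)) (a : Coef n) :
    seriesDt w (toSeries n (C a)) = MvPowerSeries.map C (dt w a) := by
  rw [toSeries_C, pderiv_map]
  rfl

/-- The specialization of polynomials in `q` to `ℚ[[q, t]]`. -/
def paramHom (n : ℕ) : MvPolynomial (Fin (n - 1)) ℚ →+* Coef n :=
  eval₂Hom MvPowerSeries.C (qVar n)

theorem paramHom_X : (fun j => paramHom n (X j)) = qVar n := by
  funext j
  simp [paramHom]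

theorem dt_paramHom (w : Equiv.Perm (Fin n)) (r : MvPolynomial (Fin (n - 1)) ℚ) :
    dt w (paramHom n r) = 0 := by
  induction r using MvPolynomial.induction_on with
  | C a => simp [dt, paramHom]
  | add p p' h h' =>
    rw [dt] at h h' ⊢
    rw [map_add, map_add, h, h', add_zero]
  | mul_X p j h =>
    rw [dt] at h ⊢
    rw [map_mul, Derivation.leibniz, h, smul_zero, add_zero]
    simp [paramHom, qVar, MvPowerSeries.pderiv_X_of_ne]

theorem seriesDt_toSeries_map (w : Equiv.Perm (Fin n))
    (P : MvPolynomial (Fin n) (MvPolynomial (Fin (n - 1)) ℚ)) :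
    seriesDt w (toSeries n (map (paramHom n) P)) = 0 := by
  induction P using MvPolynomial.induction_on with
  | C r => rw [map_C, seriesDt_toSeries_C, dt_paramHom, map_zero]
  | add p p' h h' => rw [map_add, map_add, map_add, h, h', add_zero]
  | mul_X p j h =>
    rw [map_mul, map_X, map_mul, Derivation.leibniz, h, smul_zero, add_zero, toSeries_X,
      MvPowerSeries.pderiv_C, smul_zero]

theorem seriesDt_schubert (w u : Equiv.Perm (Fin n)) :
    seriesDt w (toSeries n (schubert u)) = 0 := by
  have h := map_quantumSchubert (paramHom n) X u
  rw [paramHom_X] at h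
  rw [schubert, ← h, seriesDt_toSeries_map]

theorem seriesDt_quantumElementary (w : Equiv.Perm (Fin n)) (i : Fin n) :
    seriesDt w (toSeries n (quantumElementary (qVar n) i)) = 0 := by
  have h := map_quantumElementary (paramHom n) X i
  rw [paramHom_X] at h
  rw [← h, seriesDt_toSeries_map]

/-- The generators do not involve `t`, so the derivative falls on their coefficients only. -/
theorem seriesDt_mem (w : Equiv.Perm (Fin n)) {f : Series n} (h : f ∈ seriesIdeal n) :
    seriesDt w f ∈ seriesIdeal n := by
  rw [seriesIdeal_eq_span] at h ⊢
  obtain ⟨c, rfl⟩ := Ideal.mem_span_range_iff_exists_fun.mp h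
  rw [map_sum]
  refine Ideal.sum_mem _ fun i _ => ?_
  rw [Derivation.leibniz, seriesDt_quantumElementary, smul_zero, zero_add, smul_eq_mul]
  exact Ideal.mul_mem_right _ _ (Ideal.subset_span ⟨i, rfl⟩)

theorem seriesDt_toSeries_sum_smul (w : Equiv.Perm (Fin n)) (c : Equiv.Perm (Fin n) → Coef n) :
    seriesDt w (toSeries n (∑ u, c u • schubert u))
      = toSeries n (∑ u, dt w (c u) • schubert u) := by
  rw [toSeries_sum_smul, toSeries_sum_smul, map_sum]
  refine Finset.sum_congr rfl fun u _ => ?_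
  rw [Derivation.leibniz, seriesDt_schubert, smul_zero, zero_add, pderiv_map, smul_eq_mul,
    mul_comm]
  rfl

theorem pairing_one (f : Series n) : pairing f 1 = seriesResidue f := by
  rw [pairing, schubert, quantumSchubert_one, map_one, mul_one]

/-- Differentiates the expansion of `f` modulo the ideal in the basis of the `S_u`. The residue is
the coefficient of `S_{w₀}`, since it is the pairing with `S_1 = 1`. -/
theorem dt_seriesResidue (w : Equiv.Perm (Fin n)) (f : Series n) :
    dt w (seriesResidue f) = seriesResidue (seriesDt w f) := by
  have h := seriesDt_mem w (sub_sum_pairing_mem f)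
  rw [map_sub, seriesDt_toSeries_sum_smul] at h
  have h1 := pairing_eq_of_sub_mem h (longest n * longest n)
  rw [pairing_toSeries_sum] at h1
  simp only [longest_mul_self, pairing_one] at h1
  exact h1.symm

end Derivative

/-! ### Exponentials -/

section Exp

variable {σ S : Type*} [CommRing S]

theorem coeff_pow_eq_zero {a : MvPowerSeries σ S} (ha : MvPowerSeries.constantCoeff a = 0)
    {k : σ →₀ ℕ} {d : ℕ} (hd : k.degree < d) : MvPowerSeries.coeff k (a ^ d) = 0 := by
  apply MvPowerSeries.coeff_of_lt_order
  refine lt_of_lt_of_le ?_ (MvPowerSeries.le_order_pow_of_constantCoeff_eq_zero d ha)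
  exact_mod_cast hd

variable [Algebra ℚ S]

/-- The partial sums of the exponential series. -/
def expSum (a : MvPowerSeries σ S) (N : ℕ) : MvPowerSeries σ S :=
  ∑ d ∈ Finset.range N, algebraMap ℚ S (1 / (d.factorial : ℚ)) • a ^ d

theorem coeff_exp_subst {a : MvPowerSeries σ S} (ha : MvPowerSeries.constantCoeff a = 0)
    {k : σ →₀ ℕ} {N : ℕ} (hk : k.degree < N) :
    MvPowerSeries.coeff k ((PowerSeries.exp ℚ).subst a) = MvPowerSeries.coeff k (expSum a N) := by
  rw [PowerSeries.coeff_subst (PowerSeries.HasSubst.of_constantCoeff_zero ha),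
    finsum_eq_sum_of_support_subset (s := Finset.range N), expSum, map_sum]
  · refine Finset.sum_congr rfl fun d _ => ?_
    rw [map_smul, PowerSeries.coeff_exp, Algebra.smul_def, smul_eq_mul]
    simp
  · intro d hd
    rw [Finset.coe_range, Set.mem_Iio]
    by_contra h
    exact hd (by simp only [coeff_pow_eq_zero ha (lt_of_lt_of_le hk (not_lt.mp h)), smul_zero])

theorem constantCoeff_exp_subst {a : MvPowerSeries σ S} (ha : MvPowerSeries.constantCoeff a = 0) :
    MvPowerSeries.constantCoeff ((PowerSeries.exp ℚ).subst a) = 1 := by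
  have h := coeff_exp_subst ha (k := 0) (N := 1) (by simp)
  rw [MvPowerSeries.coeff_zero_eq_constantCoeff_apply] at h
  rw [h]
  simp [expSum]

theorem pderiv_expSum (a : MvPowerSeries σ S) (i : σ) (N : ℕ) :
    MvPowerSeries.pderiv S i (expSum a (N + 1)) = expSum a N * MvPowerSeries.pderiv S i a := by
  rw [expSum, expSum, map_sum, Finset.sum_range_succ', Finset.sum_mul]
  simp only [Derivation.map_smul, pow_zero, Derivation.map_one_eq_zero, smul_zero, add_zero]
  refine Finset.sum_congr rfl fun d _ => ?_
  rw [Derivation.leibniz_pow, Nat.add_sub_cancel, smul_eq_mul, smul_mul_assoc,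
    ← Nat.cast_smul_eq_nsmul S, smul_smul]
  congr 1
  rw [← map_natCast (algebraMap ℚ S), ← map_mul]
  congr 1
  rw [Nat.factorial_succ]
  have h1 : (d.factorial : ℚ) ≠ 0 := by exact_mod_cast d.factorial_ne_zero
  push_cast
  field_simp

theorem pderiv_exp_subst {a : MvPowerSeries σ S} (ha : MvPowerSeries.constantCoeff a = 0)
    (i : σ) : MvPowerSeries.pderiv S i ((PowerSeries.exp ℚ).subst a)
      = (PowerSeries.exp ℚ).subst a * MvPowerSeries.pderiv S i a := by
  classical
  ext k
  -- The derivative reads off a coefficient of degree one higher, and differentiation shortens the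
  -- partial sum by one term; hence the two extra terms.
  rw [MvPowerSeries.coeff_pderiv, coeff_exp_subst ha (N := k.degree + 1 + 1) (by simp),
    ← MvPowerSeries.coeff_pderiv, pderiv_expSum, MvPowerSeries.coeff_mul, MvPowerSeries.coeff_mul]
  refine Finset.sum_congr rfl fun s hs => ?_
  rw [Finset.HasAntidiagonal.mem_antidiagonal] at hs
  rw [coeff_exp_subst ha]
  rw [← hs, map_add]
  omega

end Exp

/-! ### The third derivatives of the potential -/

section Potential

variable {n : ℕ}

theorem constantCoeff_exponent :
    MvPowerSeries.constantCoeff (∑ w : Equiv.Perm (Fin n),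
      (MvPowerSeries.X (Sum.inr w) * toSeries n (schubert w) : Series n)) = 0 := by
  rw [map_sum]
  refine Finset.sum_eq_zero fun w _ => ?_
  rw [map_mul, MvPowerSeries.constantCoeff_X, zero_mul]

theorem seriesDt_exponent (u : Equiv.Perm (Fin n)) :
    seriesDt u (∑ w : Equiv.Perm (Fin n),
      (MvPowerSeries.X (Sum.inr w) * toSeries n (schubert w) : Series n))
        = toSeries n (schubert u) := by
  rw [map_sum, Finset.sum_eq_single u]
  · rw [Derivation.leibniz, seriesDt_schubert, smul_zero, zero_add, MvPowerSeries.pderiv_X_self,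
      smul_eq_mul, mul_one]
  · intro w _ hw
    rw [Derivation.leibniz, seriesDt_schubert, smul_zero, zero_add,
      MvPowerSeries.pderiv_X_of_ne (by simpa using hw), smul_zero]
  · simp

theorem seriesDt_expSeries (u : Equiv.Perm (Fin n)) :
    seriesDt u (expSeries n) = expSeries n * toSeries n (schubert u) := by
  rw [expSeries, seriesDt, pderiv_exp_subst constantCoeff_exponent, seriesDt_exponent]

theorem isUnit_expSeries : IsUnit (expSeries n) := by
  rw [MvPowerSeries.isUnit_iff_constantCoeff, expSeries,
    constantCoeff_exp_subst constantCoeff_exponent]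
  exact isUnit_one

theorem seriesDt_expSeries_mul (u : Equiv.Perm (Fin n)) {f : Series n} (hf : seriesDt u f = 0) :
    seriesDt u (expSeries n * f) = expSeries n * (toSeries n (schubert u) * f) := by
  rw [Derivation.leibniz, hf, smul_zero, zero_add, seriesDt_expSeries, smul_eq_mul]
  ring

theorem potential_eq : potential n = seriesResidue (expSeries n) := by
  rw [potential, grothendieckResidue_eq _ qVar_ne_zero, kernel, ← seriesResidue_toSeries, eq_comm,
    ← sub_eq_zero, ← map_sub]
  exact seriesResidue_of_mem (sub_proj_mem _)

theorem dt_dt_dt_potential (u w τ : Equiv.Perm (Fin n)) :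
    dt u (dt w (dt τ (potential n)))
      = pairing (expSeries n * (toSeries n (schubert u) * toSeries n (schubert w))) τ := by
  rw [potential_eq, dt_seriesResidue, seriesDt_expSeries, dt_seriesResidue,
    seriesDt_expSeries_mul w (seriesDt_schubert w τ), dt_seriesResidue, seriesDt_expSeries_mul u,
    pairing]
  · congr 1
    ring
  · rw [Derivation.leibniz, seriesDt_schubert, seriesDt_schubert, smul_zero, smul_zero, add_zero]

/-- Modulo the ideal neither of the two projections in the definition of the deformation matters. -/
theorem expSeries_mul_sub_schubertT_mem (w : Equiv.Perm (Fin n)) :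
    expSeries n * toSeries n (schubert w) - toSeries n (schubertT w) ∈ seriesIdeal n := by
  have h1 := sub_proj_mem (toSeries n (kernel n * schubert w))
  have h2 := Ideal.mul_mem_right (toSeries n (schubert w)) _ (sub_proj_mem (expSeries n))
  convert Ideal.add_mem _ h1 h2 using 1
  rw [schubertT, map_mul, kernel]
  ring

theorem schubertT_mem_span (w : Equiv.Perm (Fin n)) :
    schubertT w ∈ Submodule.span (Coef n) (Set.range (schubert (n := n))) :=
  (isProjection_proj _).1

theorem proj_eq_iff (f : Series n) {g : Poly n}
    (hg : g ∈ Submodule.span (Coef n) (Set.range (schubert (n := n)))) :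
    proj f = g ↔ f - toSeries n g ∈ seriesIdeal n :=
  ⟨fun h => h ▸ sub_proj_mem f,
    fun h => (existsUnique_isProjection f).unique (isProjection_proj f) ⟨hg, h⟩⟩

theorem sub_toSeries_mem_iff (f : Series n) (Λ : Equiv.Perm (Fin n) → Coef n) :
    f - toSeries n (∑ τ, Λ τ • schubert (longest n * τ)) ∈ seriesIdeal n
      ↔ ∀ τ, Λ τ = pairing f τ := by
  have h1 : ∑ τ, Λ τ • schubert (longest n * τ) = ∑ u, Λ (longest n * u) • schubert u := by
    rw [← Equiv.sum_comp (Equiv.mulLeft (longest n))]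
    simp only [Equiv.coe_mulLeft, longest_mul_longest_mul]
  rw [h1]
  constructor
  · intro h τ
    have h2 := pairing_eq_of_sub_mem h (longest n * (longest n * τ))
    rwa [pairing_toSeries_sum, longest_mul_longest_mul, eq_comm] at h2
  · intro h
    simp_rw [h]
    exact sub_sum_pairing_mem f

/-- Modulo the ideal both sides carry a factor `E`: the left is `E · (E S_u S_w)`, the right is `E ·
∑ Λ_τ S_{w₀τ}`. As `E` is a unit it cancels, and the duality identifies `Λ_τ` with the pairing of `E
S_u S_w` and `S_τ`. -/
theorem proj_schubertT_mul_eq_iff (u w : Equiv.Perm (Fin n)) (Λ : Equiv.Perm (Fin n) → Coef n) :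
    proj (toSeries n (schubertT u * schubertT w)) = ∑ τ, Λ τ • schubertT (longest n * τ)
      ↔ ∀ τ, Λ τ = dt u (dt w (dt τ (potential n))) := by
  simp_rw [dt_dt_dt_potential]
  rw [proj_eq_iff _ (sum_mem fun τ _ => Submodule.smul_mem _ _ (schubertT_mem_span _)),
    ← sub_toSeries_mem_iff]
  set E := expSeries n
  have hmul : E * (E * (toSeries n (schubert u) * toSeries n (schubert w)))
      - toSeries n (schubertT u * schubertT w) ∈ seriesIdeal n := by
    have h1 := Ideal.mul_mem_right (E * toSeries n (schubert w)) _
      (expSeries_mul_sub_schubertT_mem u)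
    have h2 := Ideal.mul_mem_left _ (toSeries n (schubertT u)) (expSeries_mul_sub_schubertT_mem w)
    convert Ideal.add_mem _ h1 h2 using 1
    rw [map_mul]
    ring
  have hsum : E * toSeries n (∑ τ, Λ τ • schubert (longest n * τ))
      - toSeries n (∑ τ, Λ τ • schubertT (longest n * τ)) ∈ seriesIdeal n := by
    rw [map_sum, map_sum, Finset.mul_sum, ← Finset.sum_sub_distrib]
    refine Ideal.sum_mem _ fun τ _ => ?_
    have h1 := Ideal.mul_mem_left _ (toSeries n (C (Λ τ)))
      (expSeries_mul_sub_schubertT_mem (longest n * τ))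
    convert h1 using 1
    rw [smul_eq_C_mul, smul_eq_C_mul, map_mul, map_mul]
    ring
  have hE : ∀ f, E * f ∈ seriesIdeal n ↔ f ∈ seriesIdeal n := fun f =>
    Ideal.unit_mul_mem_iff_mem _ isUnit_expSeries
  rw [← hE (_ - toSeries n (∑ τ, Λ τ • schubert (longest n * τ))), mul_sub]
  constructor
  · intro h
    convert Ideal.sub_mem _ (Ideal.add_mem _ h hmul) hsum using 1
    ring
  · intro h
    convert Ideal.add_mem _ (Ideal.sub_mem _ h hmul) hsum using 1
    ring

end Potential

end ToyGW

end

theorem lemmal2p4 (n : ℕ) :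
    (∀ f : ToyGW.Series n, ∃! g : ToyGW.Poly n, ToyGW.IsProjection f g) ∧
    (∃! η : ToyGW.Poly n →ₗ[ToyGW.Coef n] ToyGW.Coef n,
      ToyGW.IsGrothendieckResidue (ToyGW.quantumElementary (ToyGW.qVar n)) η) ∧
    ∀ (u w : Equiv.Perm (Fin n)) (Λ : Equiv.Perm (Fin n) → ToyGW.Coef n),
      ToyGW.proj (ToyGW.toSeries n (ToyGW.schubertT u * ToyGW.schubertT w)) =
          ∑ τ : Equiv.Perm (Fin n), Λ τ • ToyGW.schubertT (Fin.revPerm * τ) ↔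
        ∀ τ : Equiv.Perm (Fin n),
          Λ τ = ToyGW.dt u (ToyGW.dt w (ToyGW.dt τ (ToyGW.potential n))) :=
  ⟨ToyGW.existsUnique_isProjection,
    ToyGW.existsUnique_isGrothendieckResidue _ ToyGW.qVar_ne_zero,
    ToyGW.proj_schubertT_mul_eq_iff⟩
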